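/- Let $\pi: M\to\mathbb{R}$ be a fibration (a smooth surjective submersion), where $M$ is a smooth manifold of dimension $n+1$, let $\eta=\pi^*(dt)$, and let $\pi_M: T^*M\to M$ and $\tilde\pi_M=\pi\circ\pi_M: T^*M\to\mathbb{R}$ be the projections. Identify the manifolds of 1-jets of local sections of $\pi$ and of $\tilde\pi_M$ with the embedded submanifolds $J^1\pi=\{v\in TM : \eta(v)=1\}$ of $TM$ and $J^1\tilde\pi_M=\{z\in T(T^*M) : (\tilde\pi_M^*dt)(z)=1\}$ of $T(T^*M)$, so that the jet prolongation $j^1c(t)$ of a section $c$ is its velocity vector $\dot c(t)$. Let $A_M: T(T^*M)\to T^*(TM)$ be the canonical Tulczyjew diffeomorphism, locally $A_M(q,p;\dot q,\dot p)=(q,\dot q;\dot p,p)$, and let $\widetilde{A_\pi}: J^1\tilde\pi_M\to T^*(J^1\pi)$ be the canonical Tulczyjew fibration, $\widetilde{A_\pi}(z)=A_M(z)|_{T_v(J^1\pi)}$ with $v=T\pi_M(z)\in J^1\pi$. Let $\Omega_{J^1\tilde\pi_M}$ be the pullback to $J^1\tilde\pi_M$ of the complete lift $\Omega_M^c$ to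 $T(T^*M)$ of the canonical symplectic form $\Omega_M$ of $T^*M$. Let $L: J^1\pi\to\mathbb{R}$ be a smooth Lagrangian function, put $\widetilde{S_L}=\widetilde{A_\pi}^{-1}(dL(J^1\pi))$, and let $Leg_L: J^1\pi\to T^*M$ be the extended Legendre transformation, $$Leg_L(v)(X)=L(v)\,\eta(X)+\frac{d}{ds}\Big|_{s=0}L\big(v+s(X-\eta(X)v)\big),\qquad v\in J^1\pi,\ X\in T_{\pi_{1,0}(v)}M,$$ where $\pi_{1,0}: J^1\pi\to M$ is the projection. 1. Let $\sigma$ be a smooth local section of $\pi$, defined on an open set $J\subseteq\mathbb{R}$ (for example $J=\mathbb{R}$). Then $Leg_L\circ j^1\sigma$ is a smooth section of $\tilde\pi_M$ over $J$, and $\sigma$ is a solution of the Euler–Lagrange equations for $L$, that is, $\frac{d}{dt}\big(\frac{\partial L}{\partial\dot q^i}\circ j^1\sigma\big)=\frac{\partial L}{\partial q^i}\circ j^1\sigma$ for all $i$, in all charts $(t,q^i)$ of $M$ adapted to $\pi$, if and only if $$dL\circ j^1\sigma=\widetilde{A_\pi}\circ j^1(Leg_L\circ j^1\sigma)\quad\text{on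 } J.$$ 2. The local equations which define $\widetilde{S_L}$ as a Lagrangian submanifold of the presymplectic manifold $(J^1\tilde\pi_M,\Omega_{J^1\tilde\pi_M})$ are just the Euler–Lagrange equations for $L$. Precisely: (a) $(J^1\tilde\pi_M,\Omega_{J^1\tilde\pi_M})$ is a presymplectic manifold and $\widetilde{S_L}$ is a Lagrangian submanifold of it: $\widetilde{S_L}$ is an embedded submanifold, of a dimension $r$, contained in $J^1\tilde\pi_M$, the pullback of $\Omega_{J^1\tilde\pi_M}$ to $\widetilde{S_L}$ is zero, and $r=\frac12\,\mathrm{rank}\,\Omega_{J^1\tilde\pi_M}(z)+\dim\big(T_z\widetilde{S_L}\cap\mathrm{Ker}\,\Omega_{J^1\tilde\pi_M}(z)\big)$ for all $z\in\widetilde{S_L}$. (b) For every chart $(t,q^i)$ of $M$ adapted to $\pi$, with the induced coordinates $(t,q^i,p,p_i;\dot t,\dot q^i,\dot p,\dot p_i)$ of $T(T^*M)$, the equations $$\dot t=1,\qquad p_i=\frac{\partial L}{\partial\dot q^i}(t,q,\dot q),\qquad \dot p=\frac{\partial L}{\partial t}(t,q,\dot q),\qquad \dot p_i=\frac{\partial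 L}{\partial q^i}(t,q,\dot q)$$ (the first of which is the equation of $J^1\tilde\pi_M$) define $\widetilde{S_L}$ as an embedded submanifold over the chart domain: $\widetilde{S_L}$ is there the zero set of these smooth equations, whose differentials are linearly independent at every point of $\widetilde{S_L}$. (c) On jets of curves these equations are the Euler–Lagrange equations: if $\gamma$ is a smooth section of $\tilde\pi_M$ over an open interval $J$, then $j^1\gamma(t)\in\widetilde{S_L}$ for all $t\in J$ if and only if $\sigma=\pi_M\circ\gamma$ is a solution of the Euler–Lagrange equations for $L$ and there is a constant $c\in\mathbb{R}$ with $\gamma(t)=Leg_L(j^1\sigma(t))+c\,\eta(\sigma(t))$ for all $t\in J$. -/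

import Mathlib

open scoped Manifold ContDiff Topology

noncomputable section

namespace TimeMechanics

section General

variable {E : Type*} [NormedAddCommGroup E] [NormedSpace ℝ E] {H : Type*} [TopologicalSpace H]
  (I : ModelWithCorners ℝ E H) {N : Type*} [TopologicalSpace N] [ChartedSpace H N]

/-! ### Sections and 1-jets -/

/-- A fibration over the real line: a smooth surjective submersion. -/
structure IsFibration (p : N → ℝ) : Prop where
  smooth : ContMDiff I 𝓘(ℝ, ℝ) ∞ p
  surjective : Function.Surjective p
  submersion : ∀ x : N, mvfderiv I p x ≠ 0

/-- `c` is a smooth local section of `p : N → ℝ`, defined on the set `J` of parameters. -/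
def IsSectionOn (p : N → ℝ) (J : Set ℝ) (c : ℝ → N) : Prop :=
  ContMDiffOn 𝓘(ℝ, ℝ) I ∞ c J ∧ ∀ t ∈ J, p (c t) = t

/-- The manifold of 1-jets of local sections of `p : N → ℝ`, as the embedded submanifold
`{v | (p^* dt)(v) = 1}` of the tangent bundle. -/
def J1 (p : N → ℝ) : Set (TangentBundle I N) :=
  {v | mvfderiv I p v.proj v.2 = 1}

/-- The velocity `(c t, c' t)` of a curve, a point of the tangent bundle. If `c` is a local section
of a fibration over `ℝ`, this point is the jet prolongation of `c` at `t`. -/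
def jet (c : ℝ → N) (t : ℝ) : TangentBundle I N :=
  ⟨c t, mfderiv 𝓘(ℝ, ℝ) I c t (1 : ℝ)⟩

/-! ### Embedded submanifolds -/

/-- On the open set `U`, the equation `f = 0` defines `C` as an embedded submanifold:
`C ∩ U` is the zero set of the smooth map `f`, which is submersive along `C ∩ U`. -/
def DefinesSubmanifoldOn {F : Type*} [NormedAddCommGroup F] [NormedSpace ℝ F]
    (f : N → F) (U C : Set N) : Prop :=
  IsOpen U ∧ ContMDiffOn I 𝓘(ℝ, F) ∞ f U ∧ (∀ x ∈ U, x ∈ C ↔ f x = 0) ∧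
    ∀ x ∈ U, x ∈ C → Function.Surjective (mvfderiv I f x)

/-- `C` is an embedded submanifold of dimension `r` of the (finite-dimensional) manifold `N`. -/
def IsEmbeddedSubmanifold (C : Set N) (r : ℕ) : Prop :=
  ∃ k : ℕ, r + k = Module.finrank ℝ E ∧
    ∀ x ∈ C, ∃ (U : Set N) (f : N → EuclideanSpace ℝ (Fin k)),
      x ∈ U ∧ DefinesSubmanifoldOn I f U C

/-- The tangent space at `x` of an embedded submanifold `C` of `N`, as a subspace of `T_x N`:
it consists of the velocities of the smooth curves in `C` through `x`. -/
def tangentSpaceOf (C : Set N) (x : N) : Submodule ℝ (TangentSpace I x) :=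
  Submodule.span ℝ {u | ∃ c : ℝ → N, ContMDiffAt 𝓘(ℝ, ℝ) I ∞ c 0 ∧
    (∀ᶠ s in 𝓝 (0 : ℝ), c s ∈ C) ∧ jet I c 0 = ⟨x, u⟩}

/-- The cotangent bundle of an embedded submanifold `C` of `N` (only the fibres over the points
of `C` are relevant). -/
def CotangentOf (C : Set N) : Type _ :=
  Σ x : N, Module.Dual ℝ (tangentSpaceOf I C x)

/-- The differential `df : C → T^*C` of a function `f` that is smooth on the embedded
submanifold `C`. The derivatives of `f` within `C` agree on the tangent space of `C`, and they
depend on the restriction of `f` to `C` only. -/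
def diffOn (C : Set N) (f : N → ℝ) (x : N) : CotangentOf I C :=
  ⟨x, (mvfderivWithin I f C x).toLinearMap.domRestrict (tangentSpaceOf I C x)⟩

/-! ### Forms of degree one and two -/

/-- A field of covectors on `N`. -/
abbrev OneForm (N : Type*) [TopologicalSpace N] [ChartedSpace H N] : Type _ :=
  ∀ x : N, TangentSpace I x →L[ℝ] ℝ

/-- A field of bilinear forms on `N`. -/
abbrev TwoForm (N : Type*) [TopologicalSpace N] [ChartedSpace H N] : Type _ :=
  ∀ x : N, TangentSpace I x →L[ℝ] TangentSpace I x →L[ℝ] ℝ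

/-- The bilinear form `(u, w) ↦ B (f u) (g w)`. -/
def pullBilin {V W : Type*}
    [AddCommGroup V] [Module ℝ V] [TopologicalSpace V]
    [AddCommGroup W] [Module ℝ W] [TopologicalSpace W]
    (B : W →L[ℝ] W →L[ℝ] ℝ) (f g : V →L[ℝ] W) : V →L[ℝ] V →L[ℝ] ℝ :=
  (ContinuousLinearMap.precomp ℝ g) ∘L (B ∘L f)

/-- The expression, on the model space `E`, of a one-form in the preferred chart at `x₀`. -/
def OneForm.inChart (θ : OneForm I N) (x₀ : N) (y : E) : E →L[ℝ] ℝ :=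
  θ ((extChartAt I x₀).symm y) ∘L mfderiv 𝓘(ℝ, E) I (extChartAt I x₀).symm y

/-- The expression, on the model space `E`, of a two-form in the preferred chart at `x₀`. -/
def TwoForm.inChart (Ω : TwoForm I N) (x₀ : N) (y : E) : E →L[ℝ] E →L[ℝ] ℝ :=
  pullBilin (Ω ((extChartAt I x₀).symm y))
    (mfderiv 𝓘(ℝ, E) I (extChartAt I x₀).symm y) (mfderiv 𝓘(ℝ, E) I (extChartAt I x₀).symm y)

/-- The exterior derivative of a one-form, `dθ(u, w) = (D_u θ)(w) - (D_w θ)(u)` in the preferred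
chart at the point under consideration. -/
def exteriorDeriv (θ : OneForm I N) : TwoForm I N := fun x =>
  let D : E →L[ℝ] E →L[ℝ] ℝ := fderiv ℝ (OneForm.inChart I θ x) (extChartAt I x x)
  pullBilin (D - D.flip) (mvfderiv I (extChartAt I x) x) (mvfderiv I (extChartAt I x) x)

/-- `Ω` is a smooth closed 2-form. -/
def IsClosedTwoForm (Ω : TwoForm I N) : Prop :=
  (∀ (x : N) (u : TangentSpace I x), Ω x u u = 0) ∧
    ∀ x : N, ContDiffAt ℝ ∞ (TwoForm.inChart I Ω x) (extChartAt I x x) ∧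
      ∀ a b c : E,
        fderiv ℝ (TwoForm.inChart I Ω x) (extChartAt I x x) a b c
          + fderiv ℝ (TwoForm.inChart I Ω x) (extChartAt I x x) b c a
          + fderiv ℝ (TwoForm.inChart I Ω x) (extChartAt I x x) c a b = 0

/-! ### Lagrangian submanifolds of presymplectic manifolds

A presymplectic manifold is given here as an embedded submanifold `P` of `N` with the pullback to
`P` of a closed 2-form `Ω` of `N`. -/

/-- `P`, with the pullback of `Ω`, is a presymplectic manifold. -/
def IsPresymplectic (P : Set N) (Ω : TwoForm I N) : Prop :=
  (∃ d : ℕ, IsEmbeddedSubmanifold I P d) ∧ IsClosedTwoForm I Ω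

/-- The pullback of `Ω` to the tangent space of `P` at `x`. -/
def restrictedForm (P : Set N) (Ω : TwoForm I N) (x : N) :
    tangentSpaceOf I P x →ₗ[ℝ] Module.Dual ℝ (tangentSpaceOf I P x) :=
  (Module.Dual.transpose (tangentSpaceOf I P x).subtype) ∘ₗ
    ((ContinuousLinearMap.coeLM ℝ) ∘ₗ ((Ω x).toLinearMap.domRestrict (tangentSpaceOf I P x)))

/-- `C` is a Lagrangian submanifold of the presymplectic manifold `(P, i^* Ω)`, where `i` is the
inclusion of `P` in `N`: `C` is a submanifold of `P` of a dimension `r`, the pullback of `Ω` to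
`C` is zero, and `r = rank / 2 + dim (T_x C ∩ Ker)` for all `x` in `C`. -/
def IsLagrangianSubmanifold (P : Set N) (Ω : TwoForm I N) (C : Set N) : Prop :=
  IsPresymplectic I P Ω ∧ C ⊆ P ∧ ∃ r : ℕ, IsEmbeddedSubmanifold I C r ∧
    ∀ x ∈ C,
      (∀ u ∈ tangentSpaceOf I C x, ∀ w ∈ tangentSpaceOf I C x, Ω x u w = 0) ∧
      (r : ℚ) = (Module.finrank ℝ (LinearMap.range (restrictedForm I P Ω x)) : ℚ) / 2
        + Module.finrank ℝ ((tangentSpaceOf I C x ⊓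
            (LinearMap.ker (restrictedForm I P Ω x)).map (tangentSpaceOf I P x).subtype :
              Submodule ℝ (TangentSpace I x)))

/-! ### Coordinates on the tangent and the cotangent bundle -/

/-- The positions `q` of a tangent vector, in a chart `φ` of `N`. -/
def tanPos (φ : PartialEquiv N E) (v : TangentBundle I N) : E := φ v.proj

/-- The velocities `q̇` of a tangent vector, in a chart `φ` of `N`. -/
def tanVel (φ : PartialEquiv N E) (v : TangentBundle I N) : E := mvfderiv I φ v.proj v.2

variable [IsManifold I ∞ N]

/-- The cotangent bundle. -/
abbrev CotangentBundle (N : Type*) [TopologicalSpace N] [ChartedSpace H N]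
    [IsManifold I ∞ N] : Type _ :=
  Bundle.TotalSpace (E →L[ℝ] ℝ) (fun x : N => TangentSpace I x →L[ℝ] Bundle.Trivial N ℝ x)

/-- The model with corners of the cotangent bundle. -/
abbrev cotModel : ModelWithCorners ℝ (E × (E →L[ℝ] ℝ)) (ModelProd H (E →L[ℝ] ℝ)) :=
  I.prod 𝓘(ℝ, E →L[ℝ] ℝ)

/-- The momenta `p` of a covector, in a chart `φ` of `N`. -/
def cotMom (φ : PartialEquiv N E) (α : CotangentBundle I N) : E →L[ℝ] ℝ :=
  α.2 ∘L mfderiv 𝓘(ℝ, E) I φ.symm (φ α.proj)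

/-- The complete lift `Ω^c` of a 2-form `Ω` on `N` to `TN`: if `Ω = Ω_{ij} dx^i ⊗ dx^j` then
`Ω^c = (∂_k Ω_{ij}) ẋ^k dx^i ⊗ dx^j + Ω_{ij} dẋ^i ⊗ dx^j + Ω_{ij} dx^i ⊗ dẋ^j`, here in the
preferred chart of `N` at the base point. -/
def completeLift (Ω : TwoForm I N) : TwoForm I.tangent (TangentBundle I N) := fun z =>
  let φ := extChartAt I z.proj
  let Ω' := TwoForm.inChart I Ω z.proj
  let dx := mvfderiv I.tangent (tanPos I φ) z
  let dv := mvfderiv I.tangent (tanVel I φ) z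
  pullBilin (fderiv ℝ Ω' (tanPos I φ z) (tanVel I φ z)) dx dx
    + pullBilin (Ω' (tanPos I φ z)) dv dx + pullBilin (Ω' (tanPos I φ z)) dx dv

/-- The Liouville 1-form `p dq` of the cotangent bundle. -/
def liouvilleForm : OneForm (cotModel I) (CotangentBundle I N) := fun α =>
  α.2 ∘L mfderiv (cotModel I) I Bundle.TotalSpace.proj α

/-- The canonical symplectic form `dq ∧ dp` of the cotangent bundle. -/
def canonicalForm : TwoForm (cotModel I) (CotangentBundle I N) := fun α =>
  -exteriorDeriv (cotModel I) (liouvilleForm I) α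

/-- The tangent map `T(T^*N) → TN` of the projection `T^*N → N`. -/
def tangentProj (z : TangentBundle (cotModel I) (CotangentBundle I N)) : TangentBundle I N :=
  tangentMap (cotModel I) I Bundle.TotalSpace.proj z

/-- The canonical Tulczyjew diffeomorphism `T(T^*N) → T^*(TN)`,
`(q, p; q̇, ṗ) ↦ (q, q̇; ṗ, p)`, that is, the covector `ṗ dq + p dq̇` at `(q, q̇)`; the
coordinates are those of the preferred chart of `N` at the base point. -/
def tulczyjew (z : TangentBundle (cotModel I) (CotangentBundle I N)) :
    TangentSpace I.tangent (tangentProj I z) →L[ℝ] ℝ :=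
  let φ := extChartAt I z.proj.proj
  mvfderiv (cotModel I) (cotMom I φ) z.proj z.2
      ∘L mvfderiv I.tangent (tanPos I φ) (tangentProj I z)
    + cotMom I φ z.proj ∘L mvfderiv I.tangent (tanVel I φ) (tangentProj I z)

/-! ### The fibration, the Lagrangian function and the extended Tulczyjew map -/

/-- The fibration `T^*M → M → ℝ`. -/
def cotFibration (p : N → ℝ) : CotangentBundle I N → ℝ := fun α => p α.proj

/-- The manifold of 1-jets of local sections of the fibration `T^*M → ℝ`. -/
def J1Cot (p : N → ℝ) : Set (TangentBundle (cotModel I) (CotangentBundle I N)) :=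
  J1 (cotModel I) (cotFibration I p)

/-- The canonical Tulczyjew fibration, which maps a jet `z` of a section of `T^*M → ℝ` to the
restriction of the Tulczyjew covector at `z` to the tangent space of the jet manifold of `p`. It
is used on `J1Cot I p` only. -/
def extendedTulczyjew (p : N → ℝ) (z : TangentBundle (cotModel I) (CotangentBundle I N)) :
    CotangentOf I.tangent (J1 I p) :=
  ⟨tangentProj I z,
    (tulczyjew I z).toLinearMap.domRestrict (tangentSpaceOf I.tangent (J1 I p) (tangentProj I z))⟩

/-- The inverse image of `dL(J^1)` under the canonical Tulczyjew fibration. -/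
def lagrangianSet (p : N → ℝ) (L : TangentBundle I N → ℝ) :
    Set (TangentBundle (cotModel I) (CotangentBundle I N)) :=
  {z | z ∈ J1Cot I p ∧
    ∃ v ∈ J1 I p, extendedTulczyjew I p z = diffOn I.tangent (J1 I p) L v}

/-- The extended Legendre transformation:
`X ↦ L(v) η(X) + d/ds|_{s = 0} L(v + s (X - η(X) v))`, with `η = p^* dt`. -/
def legendre (p : N → ℝ) (L : TangentBundle I N → ℝ) (v : TangentBundle I N) :
    CotangentBundle I N :=
  ⟨v.proj, L v • mvfderiv I p v.proj
    + fderiv ℝ (fun X : TangentSpace I v.proj =>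
        L ⟨v.proj, v.2 + (X - mvfderiv I p v.proj X • v.2)⟩) 0⟩

/-- The action of `c : ℝ` on the cotangent bundle by translation: `α ↦ α + c η`, with
`η = p^* dt`. -/
def translate (p : N → ℝ) (c : ℝ) (α : CotangentBundle I N) : CotangentBundle I N :=
  ⟨α.proj, α.2 + (c • mvfderiv I p α.proj : TangentSpace I α.proj →L[ℝ] ℝ)⟩

end General

section EulerLagrange

variable {n : ℕ} {M : Type*} [TopologicalSpace M]
  [ChartedSpace (EuclideanSpace ℝ (Fin (n + 1))) M] [IsManifold (𝓡 (n + 1)) ∞ M]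

/-- `φ` is a chart `(t, q^1, …, q^n)` of `M` adapted to `p : M → ℝ`. -/
def IsAdaptedChart (p : M → ℝ) (φ : OpenPartialHomeomorph M (EuclideanSpace ℝ (Fin (n + 1)))) :
    Prop :=
  φ ∈ IsManifold.maximalAtlas (𝓡 (n + 1)) ∞ M ∧ ∀ x ∈ φ.source, φ x 0 = p x

/-- The Lagrangian function in the coordinates `(t, q, q̇)` given by the adapted chart `φ`; here
`y = (t, q)` and `w = q̇`. -/
def localLagrangian (φ : OpenPartialHomeomorph M (EuclideanSpace ℝ (Fin (n + 1))))
    (L : TangentBundle (𝓡 (n + 1)) M → ℝ)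
    (y : EuclideanSpace ℝ (Fin (n + 1))) (w : Fin n → ℝ) : ℝ :=
  L ⟨φ.symm y, mfderiv (𝓡 (n + 1)) (𝓡 (n + 1)) φ.symm y
    (WithLp.toLp 2 (Fin.cons 1 w : Fin (n + 1) → ℝ))⟩

/-- `∂L/∂t` (for `j = 0`) and `∂L/∂q^i` (for `j = i + 1`). -/
def dLdx (φ : OpenPartialHomeomorph M (EuclideanSpace ℝ (Fin (n + 1))))
    (L : TangentBundle (𝓡 (n + 1)) M → ℝ) (j : Fin (n + 1))
    (y : EuclideanSpace ℝ (Fin (n + 1))) (w : Fin n → ℝ) : ℝ :=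
  lineDeriv ℝ (fun y' => localLagrangian φ L y' w) y (EuclideanSpace.single j 1)

/-- `∂L/∂q̇^i`. -/
def dLdv (φ : OpenPartialHomeomorph M (EuclideanSpace ℝ (Fin (n + 1))))
    (L : TangentBundle (𝓡 (n + 1)) M → ℝ) (i : Fin n)
    (y : EuclideanSpace ℝ (Fin (n + 1))) (w : Fin n → ℝ) : ℝ :=
  lineDeriv ℝ (fun w' => localLagrangian φ L y w') w (Pi.single i 1)

/-- The section `σ`, defined on `J`, is a solution of the Euler-Lagrange equations
`d/dt (∂L/∂q̇^i) = ∂L/∂q^i`, in all adapted charts. -/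
def SolvesEulerLagrange (p : M → ℝ) (L : TangentBundle (𝓡 (n + 1)) M → ℝ) (J : Set ℝ)
    (σ : ℝ → M) : Prop :=
  ∀ φ : OpenPartialHomeomorph M (EuclideanSpace ℝ (Fin (n + 1))), IsAdaptedChart p φ →
    ∀ t ∈ J, σ t ∈ φ.source → ∀ i : Fin n,
      HasDerivAt
        (fun s => dLdv φ L i (φ (σ s)) (fun k => deriv (fun s' => φ (σ s') k.succ) s))
        (dLdx φ L i.succ (φ (σ t)) (fun k => deriv (fun s' => φ (σ s') k.succ) t)) t

/-- The left-hand sides of the local equations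
`ṫ - 1 = 0`, `p_i - ∂L/∂q̇^i = 0`, `ṗ - ∂L/∂t = 0`, `ṗ_i - ∂L/∂q^i = 0`
in the coordinates `(t, q^i, p, p_i; ṫ, q̇^i, ṗ, ṗ_i)` of `T(T^*M)` given by the adapted chart `φ`.
The first one is the equation of the jet manifold of `T^*M → ℝ` in `T(T^*M)`; along the jet
prolongation of a curve, the dotted coordinates are the derivatives of the undotted ones, and the
equations for `p_i` and `ṗ_i` together become the Euler-Lagrange equations. -/
def localEquations (φ : OpenPartialHomeomorph M (EuclideanSpace ℝ (Fin (n + 1))))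
    (L : TangentBundle (𝓡 (n + 1)) M → ℝ)
    (z : TangentBundle (cotModel (𝓡 (n + 1))) (CotangentBundle (𝓡 (n + 1)) M)) :
    ℝ × (Fin n → ℝ) × ℝ × (Fin n → ℝ) :=
  let y : EuclideanSpace ℝ (Fin (n + 1)) := φ z.proj.proj
  let xdot : EuclideanSpace ℝ (Fin (n + 1)) :=
    tanVel (𝓡 (n + 1)) φ.toPartialEquiv (tangentProj (𝓡 (n + 1)) z)
  let w : Fin n → ℝ := fun k => xdot k.succ
  let mom := cotMom (𝓡 (n + 1)) φ.toPartialEquiv z.proj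
  let momdot := mvfderiv (cotModel (𝓡 (n + 1))) (cotMom (𝓡 (n + 1)) φ.toPartialEquiv) z.proj z.2
  (xdot 0 - 1,
    fun i => mom (EuclideanSpace.single i.succ 1) - dLdv φ L i y w,
    momdot (EuclideanSpace.single 0 1) - dLdx φ L 0 y w,
    fun i => momdot (EuclideanSpace.single i.succ 1) - dLdx φ L i.succ y w)

end EulerLagrange

end TimeMechanics

end

/-!
In a chart `(t, q)` of `M` adapted to `π`, with induced coordinates `(y, p; ẏ, ṗ)` of `T(T^*M)`,
`y = (t, q)`, and with the Lagrangian function `Λ(y, q̇)`, a point `z` over the chart lies in `S_L`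
if and only if

  `ṫ = 1` and `ṗ(a) + p(0, b) = DΛ(y, q̇)(a, b)` for all `a ∈ ℝ^{n+1}`, `b ∈ ℝ^n`.

Indeed the Tulczyjew covector `ṗ dy + p dẏ` does not depend on the chart (`tulczyjew_eq`), and the
tangent space of `J¹π` is the kernel of `dṫ`; this is `IsAdaptedChart.mem_lagrangianSet`. The
components of this equation are the local equations of the theorem. They can be solved for `ṫ`,
`p_i` and `ṗ`, so that their differentials are independent
(`IsAdaptedChart.definesSubmanifoldOn_lagrangianSet`).

*Lagrangian submanifold.* In the same coordinates, the complete lift of the canonical form is the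
constant form `dẏ ∧ dp + dy ∧ dṗ` (`completeLift_canonicalForm`); hence it is closed. On the vectors
with `δṫ = 0` its kernel is the line spanned by `∂/∂p`, where `p` is the momentum conjugate to `t`
(`liftedForm_eq_zero_iff`). This line is tangent to `S_L`, because the equations of `S_L` do not
contain that momentum. On `S_L` the form is the antisymmetric part of the second derivative of `Λ`,
that is, zero. Thus the rank is `4n + 2`, the dimension of `S_L` is `2n + 2`, and
`2n + 2 = (4n + 2) / 2 + 1` (`isLagrangianSubmanifold_lagrangianSet`).

*Euler-Lagrange equations.* Let `γ` be a section of `T^*M` over the section `σ`. By the local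
equations, the jets of `γ` lie in `S_L` if and only if `p_i = ∂Λ/∂q̇^i` and `ṗ = DΛ(·, 0)` along
`γ`. The equations for `p_i` mean that `γ - Leg_L ∘ j¹σ` is a multiple of `η`; the factor is the
energy `p(ẏ) - Λ` (`IsAdaptedChart.eq_translate_legendre_iff`). If they hold, then the space
components of `ṗ = DΛ(·, 0)` are the Euler-Lagrange equations, and the value of `ṗ - DΛ(·, 0)` at
`ẏ` is the derivative of the energy (`hasDerivAt_energy`). Since `ẏ` and the space directions
generate `ℝ^{n+1}`, the equation for `ṗ` holds if and only if `σ` solves the Euler-Lagrange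
equations and the energy is locally constant (`forall_jet_mem_lagrangianSet_iff`). For
`γ = Leg_L ∘ j¹σ` the energy is zero, and this gives the first part of the theorem.

The tangent space of an embedded submanifold is defined through curves; it is identified with the
kernel of the differential of the defining equations by means of the inverse function theorem
(`tangentSpaceOf_eq_ker`). The changes of charts are handled by `SmoothChart`, a notion of chart
with values in an arbitrary normed space that passes from `N` to `TN` and to `T^*N`.
-/

noncomputable section

namespace TimeMechanics

/-! ### Smooth charts with values in a normed space -/

section SmoothChart

variable {E : Type*} [NormedAddCommGroup E] [NormedSpace ℝ E] {H : Type*} [TopologicalSpace H]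
  {I : ModelWithCorners ℝ E H} {N : Type*} [TopologicalSpace N] [ChartedSpace H N]
  {F : Type*} [NormedAddCommGroup F] [NormedSpace ℝ F]
  {G : Type*} [NormedAddCommGroup G] [NormedSpace ℝ G]

/-- A diffeomorphism from an open subset of the manifold `N` to an open subset of a normed space
`F`, which need not be the model space of `N`. -/
structure SmoothChart {E : Type*} [NormedAddCommGroup E] [NormedSpace ℝ E] {H : Type*}
    [TopologicalSpace H] (I : ModelWithCorners ℝ E H) (N : Type*) [TopologicalSpace N]
    [ChartedSpace H N] (F : Type*) [NormedAddCommGroup F] [NormedSpace ℝ F]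
    extends PartialEquiv N F where
  open_source : IsOpen source
  open_target : IsOpen target
  smooth : ContMDiffOn I 𝓘(ℝ, F) ∞ toPartialEquiv source
  smooth_symm : ContMDiffOn 𝓘(ℝ, F) I ∞ toPartialEquiv.symm target

namespace SmoothChart

instance : CoeFun (SmoothChart I N F) fun _ => N → F := ⟨fun Χ => Χ.toPartialEquiv⟩

variable (Χ : SmoothChart I N F)

/-- The derivative of a chart at a point of the manifold. -/
abbrev d (x : N) : TangentSpace I x →L[ℝ] F := mvfderiv I Χ x

/-- The derivative of the inverse of a chart at a point of the model space. -/
abbrev e (y : F) : F →L[ℝ] TangentSpace I (Χ.symm y) := mfderiv 𝓘(ℝ, F) I Χ.symm y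

variable {Χ} {x : N} {y : F}

lemma source_mem_nhds (hx : x ∈ Χ.source) : Χ.source ∈ 𝓝 x := Χ.open_source.mem_nhds hx

lemma target_mem_nhds (hy : y ∈ Χ.target) : Χ.target ∈ 𝓝 y := Χ.open_target.mem_nhds hy

lemma contMDiffAt (hx : x ∈ Χ.source) : ContMDiffAt I 𝓘(ℝ, F) ∞ Χ x :=
  Χ.smooth.contMDiffAt (source_mem_nhds hx)

lemma contMDiffAt_symm (hy : y ∈ Χ.target) : ContMDiffAt 𝓘(ℝ, F) I ∞ Χ.symm y :=
  Χ.smooth_symm.contMDiffAt (target_mem_nhds hy)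

lemma mdifferentiableAt (hx : x ∈ Χ.source) : MDifferentiableAt I 𝓘(ℝ, F) Χ x :=
  (contMDiffAt hx).mdifferentiableAt (by simp)

lemma mdifferentiableAt_symm (hy : y ∈ Χ.target) : MDifferentiableAt 𝓘(ℝ, F) I Χ.symm y :=
  (contMDiffAt_symm hy).mdifferentiableAt (by simp)

lemma eventually_right_inv (hy : y ∈ Χ.target) : ∀ᶠ y' in 𝓝 y, Χ (Χ.symm y') = y' :=
  Filter.eventually_of_mem (target_mem_nhds hy) fun _ h => Χ.right_inv h

lemma eventually_left_inv (hx : x ∈ Χ.source) : ∀ᶠ x' in 𝓝 x, Χ.symm (Χ x') = x' :=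
  Filter.eventually_of_mem (source_mem_nhds hx) fun _ h => Χ.left_inv h

/-- A function that factors through a chart is differentiated by the chain rule. -/
lemma hasMFDerivAt_of_factor {f : N → G} {h : F → G} {h' : F →L[ℝ] G} (hx : x ∈ Χ.source)
    (hf : ∀ᶠ x' in 𝓝 x, f x' = h (Χ x')) (hh : HasFDerivAt h h' (Χ x)) :
    HasMFDerivAt I 𝓘(ℝ, G) f x (h' ∘L Χ.d x : TangentSpace I x →L[ℝ] G) := by
  have h1 := (hh.hasMFDerivAt).comp x (mdifferentiableAt hx).hasMFDerivAt
  exact h1.congr_of_eventuallyEq hf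

lemma mvfderiv_of_factor' {f : N → G} {h : F → G} {h' : F →L[ℝ] G} (hx : x ∈ Χ.source)
    (hf : ∀ᶠ x' in 𝓝 x, f x' = h (Χ x')) (hh : HasFDerivAt h h' (Χ x)) :
    mvfderiv I f x = h' ∘L Χ.d x :=
  (hasMFDerivAt_of_factor hx hf hh).mfderiv

lemma mvfderiv_of_factor {f : N → G} {h : F → G} {h' : F →L[ℝ] G} (hx : x ∈ Χ.source)
    (hf : ∀ᶠ x' in 𝓝 x, f x' = h (Χ x')) (hh : HasFDerivAt h h' (Χ x)) (u : TangentSpace I x) :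
    mvfderiv I f x u = h' (Χ.d x u) := by
  rw [mvfderiv_of_factor' hx hf hh]; rfl

lemma contMDiffAt_of_factor {f : N → G} {h : F → G} (hx : x ∈ Χ.source)
    (hf : ∀ᶠ x' in 𝓝 x, f x' = h (Χ x')) (hh : ContDiffAt ℝ ∞ h (Χ x)) :
    ContMDiffAt I 𝓘(ℝ, G) ∞ f x :=
  (hh.contMDiffAt.comp x (contMDiffAt hx)).congr_of_eventuallyEq hf

/-- The derivative of a chart and the derivative of its inverse are inverse to each other. -/
lemma d_e (hy : y ∈ Χ.target) (a : F) : Χ.d (Χ.symm y) (Χ.e y a) = a := by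
  have h := mfderiv_comp (I := 𝓘(ℝ, F)) (I' := I) (I'' := 𝓘(ℝ, F)) y
    (mdifferentiableAt (Χ := Χ) (Χ.map_target hy)) (mdifferentiableAt_symm hy)
  have h2 : (Χ ∘ Χ.symm) =ᶠ[𝓝 y] id := eventually_right_inv hy
  rw [h2.mfderiv_eq, mfderiv_id] at h
  exact (congrArg (fun l : F →L[ℝ] F => l a) h).symm

lemma e_d (hx : x ∈ Χ.source) (u : TangentSpace I x) : Χ.e (Χ x) (Χ.d x u) = u := by
  have h := mfderiv_comp (I := I) (I' := 𝓘(ℝ, F)) (I'' := I) x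
    (mdifferentiableAt_symm (Χ := Χ) (Χ.map_source hx)) (mdifferentiableAt hx)
  have h2 : (Χ.symm ∘ Χ) =ᶠ[𝓝 x] id := eventually_left_inv hx
  rw [h2.mfderiv_eq, mfderiv_id] at h
  exact (congrArg (fun l : E →L[ℝ] E => l u) h).symm

lemma e_d' (hy : y ∈ Χ.target) (u : TangentSpace I (Χ.symm y)) :
    Χ.e y (Χ.d (Χ.symm y) u) = u := by
  have := e_d (Χ := Χ) (Χ.map_target hy) u
  rwa [Χ.right_inv hy] at this

/-- The derivative of a chart as a linear equivalence. -/
def dEquiv (hx : x ∈ Χ.source) : TangentSpace I x ≃ₗ[ℝ] F :=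
  LinearEquiv.ofBijective (Χ.d x).toLinearMap
    ⟨Function.LeftInverse.injective (g := fun a => Χ.e (Χ x) a) (e_d hx), fun a =>
      ⟨Χ.e (Χ x) a, by
        have := d_e (Χ := Χ) (Χ.map_source hx) a
        rwa [Χ.left_inv hx] at this⟩⟩

lemma d_surjective (hx : x ∈ Χ.source) : Function.Surjective (Χ.d x) := (dEquiv hx).surjective

lemma d_injective (hx : x ∈ Χ.source) : Function.Injective (Χ.d x) := (dEquiv hx).injective

/-! ### Curves in a chart -/

section Curves

variable {c : ℝ → N} {t : ℝ}

lemma hasDerivAt_comp (hx : c t ∈ Χ.source) (hc : MDifferentiableAt 𝓘(ℝ, ℝ) I c t) :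
    HasDerivAt (fun s => Χ (c s)) (Χ.d (c t) (jet I c t).2) t := by
  have h := (mdifferentiableAt hx).hasMFDerivAt.comp t hc.hasMFDerivAt
  have h' : HasFDerivAt (fun s => Χ (c s))
      ((Χ.d (c t)).comp (mfderiv 𝓘(ℝ, ℝ) I c t) : ℝ →L[ℝ] F) t := h.hasFDerivAt
  exact h'.hasDerivAt

lemma d_jet (hx : c t ∈ Χ.source) (hc : MDifferentiableAt 𝓘(ℝ, ℝ) I c t) :
    Χ.d (c t) (jet I c t).2 = deriv (fun s => Χ (c s)) t :=
  (hasDerivAt_comp hx hc).deriv.symm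

lemma contDiffAt_comp (hx : c t ∈ Χ.source) (hc : ContMDiffAt 𝓘(ℝ, ℝ) I ∞ c t) :
    ContDiffAt ℝ ∞ (fun s => Χ (c s)) t :=
  ((contMDiffAt hx).comp t hc).contDiffAt

lemma contMDiffAt_symm_comp {c : ℝ → F} (hx : c t ∈ Χ.target) (hc : ContDiffAt ℝ ∞ c t) :
    ContMDiffAt 𝓘(ℝ, ℝ) I ∞ (fun s => Χ.symm (c s)) t :=
  (contMDiffAt_symm hx).comp t hc.contMDiffAt

lemma contMDiffAt_of_comp_curve (hx : c t ∈ Χ.source) (hc : ∀ᶠ s in 𝓝 t, c s ∈ Χ.source)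
    (h : ContDiffAt ℝ ∞ (fun s => Χ (c s)) t) : ContMDiffAt 𝓘(ℝ, ℝ) I ∞ c t :=
  (contMDiffAt_symm_comp (Χ := Χ) (Χ.map_source hx) h).congr_of_eventuallyEq
    (hc.mono fun _ hs => (Χ.left_inv hs).symm)

end Curves

/-! ### Charts of the tangent bundle -/

section Tangent

variable (Χ) [IsManifold I ∞ N]

lemma contMDiffOn_tangentMap {E' : Type*} [NormedAddCommGroup E'] [NormedSpace ℝ E'] {H' : Type*}
    [TopologicalSpace H'] {I' : ModelWithCorners ℝ E' H'} {N' : Type*} [TopologicalSpace N']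
    [ChartedSpace H' N'] [IsManifold I' ∞ N'] {f : N → N'} {s : Set N} (hs : IsOpen s)
    (hf : ContMDiffOn I I' ∞ f s) :
    ContMDiffOn I.tangent I'.tangent ∞ (tangentMap I I' f) {v | v.proj ∈ s} := by
  refine (hf.contMDiffOn_tangentMapWithin (m := ∞) (by simp) hs.uniqueMDiffOn).congr ?_
  intro v hv
  exact (tangentMapWithin_eq_tangentMap (hs.uniqueMDiffOn _ hv)
    ((hf.contMDiffAt (hs.mem_nhds hv)).mdifferentiableAt (by simp))).symm

lemma contMDiff_proj_tangent : ContMDiff I.tangent I ∞ (fun v : TangentBundle I N => v.proj) :=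
  Bundle.contMDiff_proj (TangentSpace I)

lemma contMDiff_mk_tangent_modelSpace :
    ContMDiff 𝓘(ℝ, F × F) 𝓘(ℝ, F).tangent ∞
      (fun p : F × F => (⟨p.1, p.2⟩ : TangentBundle 𝓘(ℝ, F) F)) := by
  intro p
  rw [Bundle.contMDiffAt_totalSpace]
  refine ⟨contDiff_fst.contMDiff.contMDiffAt, ?_⟩
  simpa using contDiff_snd.contMDiff.contMDiffAt

/-- The chart `v ↦ (x, ẋ)` of the tangent bundle induced by a chart. -/
def tangent : SmoothChart I.tangent (TangentBundle I N) (F × F) where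
  toFun v := (Χ v.proj, Χ.d v.proj v.2)
  invFun p := ⟨Χ.symm p.1, Χ.e p.1 p.2⟩
  source := {v | v.proj ∈ Χ.source}
  target := {p | p.1 ∈ Χ.target}
  map_source' _ hv := Χ.map_source hv
  map_target' _ hp := Χ.map_target hp
  left_inv' := by
    rintro ⟨x, u⟩ hv
    have h2 : Χ.e (Χ x) (Χ.d x u) = u := e_d hv u
    have h1 : Χ.symm (Χ x) = x := Χ.left_inv hv
    exact Bundle.TotalSpace.ext h1 (heq_of_eq h2)
  right_inv' := by
    rintro ⟨y, a⟩ hp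
    exact Prod.ext (Χ.right_inv hp) (d_e hp a)
  open_source := Χ.open_source.preimage (contMDiff_proj_tangent (I := I)).continuous
  open_target := Χ.open_target.preimage continuous_fst
  smooth := by
    have h := contMDiffOn_tangentMap Χ.open_source Χ.smooth
    have h1 := (contMDiff_proj_tangent (I := 𝓘(ℝ, F)) (N := F)).comp_contMDiffOn h
    have h2 := (contMDiff_snd_tangentBundle_modelSpace F 𝓘(ℝ, F)).comp_contMDiffOn h
    exact h1.prodMk_space h2
  smooth_symm := by
    have h := contMDiffOn_tangentMap Χ.open_target Χ.smooth_symm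
    exact h.comp contMDiff_mk_tangent_modelSpace.contMDiffOn (fun p hp => hp)

lemma tangent_apply (v : TangentBundle I N) : Χ.tangent v = (Χ v.proj, Χ.d v.proj v.2) := rfl

lemma mem_tangent_source {v : TangentBundle I N} : v ∈ Χ.tangent.source ↔ v.proj ∈ Χ.source :=
  Iff.rfl

end Tangent

end SmoothChart

end SmoothChart

namespace SmoothChart
section Cotangent

variable {E : Type*} [NormedAddCommGroup E] [NormedSpace ℝ E] {H : Type*} [TopologicalSpace H]
  {I : ModelWithCorners ℝ E H} {N : Type*} [TopologicalSpace N] [ChartedSpace H N]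
  {F : Type*} [NormedAddCommGroup F] [NormedSpace ℝ F]

variable (I) in
/-- The preferred charts of a boundaryless manifold. -/
def ofExtChartAt [IsManifold I ∞ N] [I.Boundaryless] (x₀ : N) : SmoothChart I N E where
  toPartialEquiv := extChartAt I x₀
  open_source := isOpen_extChartAt_source x₀
  open_target := isOpen_extChartAt_target x₀
  smooth := by
    simpa [extChartAt_source] using contMDiffOn_extChartAt (I := I) (x := x₀) (n := ∞)
  smooth_symm := contMDiffOn_extChartAt_symm x₀

/-- The charts of the maximal atlas of a manifold modelled on a normed space. -/
def ofMaximalAtlas {N : Type*} [TopologicalSpace N] [ChartedSpace E N]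
    {φ : OpenPartialHomeomorph N E} (hφ : φ ∈ IsManifold.maximalAtlas 𝓘(ℝ, E) ∞ N) :
    SmoothChart 𝓘(ℝ, E) N E where
  toPartialEquiv := φ.toPartialEquiv
  open_source := φ.open_source
  open_target := φ.open_target
  smooth := contMDiffOn_of_mem_maximalAtlas hφ
  smooth_symm := contMDiffOn_symm_of_mem_maximalAtlas hφ

/-- The transition map between two charts. -/
lemma contDiffAt_transition {Χ : SmoothChart I N F} {G : Type*} [NormedAddCommGroup G]
    [NormedSpace ℝ G] {Ψ : SmoothChart I N G} {y : F} (hy : y ∈ Χ.target)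
    (hy' : Χ.symm y ∈ Ψ.source) : ContDiffAt ℝ ∞ (fun y' => Ψ (Χ.symm y')) y :=
  ((contMDiffAt hy').comp y (contMDiffAt_symm hy)).contDiffAt

lemma fderiv_transition {Χ : SmoothChart I N F} {G : Type*} [NormedAddCommGroup G]
    [NormedSpace ℝ G] {Ψ : SmoothChart I N G} {y : F} (hy : y ∈ Χ.target)
    (hy' : Χ.symm y ∈ Ψ.source) (a : F) :
    fderiv ℝ (fun y' => Ψ (Χ.symm y')) y a = Ψ.d (Χ.symm y) (Χ.e y a) := by
  have h := (mdifferentiableAt hy').hasMFDerivAt.comp y (mdifferentiableAt_symm hy).hasMFDerivAt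
  have h' : HasFDerivAt (fun y' => Ψ (Χ.symm y'))
      ((Ψ.d (Χ.symm y)).comp (Χ.e y) : F →L[ℝ] G) y := h.hasFDerivAt
  rw [h'.fderiv]; rfl

/-- The derivatives of two charts differ by the derivative of the transition map. -/
lemma d_transition {Χ : SmoothChart I N F} {G : Type*} [NormedAddCommGroup G]
    [NormedSpace ℝ G] {Ψ : SmoothChart I N G} {x : N} (hx : x ∈ Χ.source)
    (hx' : x ∈ Ψ.source) (u : TangentSpace I x) :
    Ψ.d x u = fderiv ℝ (fun y' => Ψ (Χ.symm y')) (Χ x) (Χ.d x u) := by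
  refine mvfderiv_of_factor (h := fun y' => Ψ (Χ.symm y')) hx
    ((eventually_left_inv hx).mono fun x' h => by rw [h]) ?_ u
  have hy' : Χ.symm (Χ x) ∈ Ψ.source := by rwa [Χ.left_inv hx]
  exact ((contDiffAt_transition (Χ.map_source hx) hy').differentiableAt (by simp)).hasFDerivAt

lemma e_transition {Χ : SmoothChart I N F} {G : Type*} [NormedAddCommGroup G]
    [NormedSpace ℝ G] {Ψ : SmoothChart I N G} {y : F} (hy : y ∈ Χ.target)
    (hy' : Χ.symm y ∈ Ψ.source) (a : F) :
    Ψ.e (Ψ (Χ.symm y)) (fderiv ℝ (fun y' => Ψ (Χ.symm y')) y a) = Χ.e y a := by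
  rw [fderiv_transition hy hy']
  exact e_d hy' _

lemma e_transition' {Χ : SmoothChart I N F} {G : Type*} [NormedAddCommGroup G]
    [NormedSpace ℝ G] {Ψ : SmoothChart I N G} {x : N} (hx : x ∈ Χ.source)
    (hx' : x ∈ Ψ.source) (a : F) :
    (Ψ.e (Ψ x) (fderiv ℝ (fun y' => Ψ (Χ.symm y')) (Χ x) a) : E) = Χ.e (Χ x) a := by
  have h := e_transition (Χ := Χ) (Ψ := Ψ) (Χ.map_source hx) (by rwa [Χ.left_inv hx]) a
  rw [Χ.left_inv hx] at h
  exact h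

variable [IsManifold I ∞ N]

lemma contMDiff_proj_cotangent :
    ContMDiff (cotModel I) I ∞ (fun α : CotangentBundle I N => α.proj) :=
  Bundle.contMDiff_proj (fun x : N => TangentSpace I x →L[ℝ] Bundle.Trivial N ℝ x)

variable [I.Boundaryless]

lemma inCoordinates_cot {x₀ x : N} (hx : x ∈ (chartAt H x₀).source)
    (α : TangentSpace I x →L[ℝ] Bundle.Trivial N ℝ x) :
    ContinuousLinearMap.inCoordinates E (TangentSpace I) ℝ (Bundle.Trivial N ℝ) x₀ x x₀ x α
      = (α ∘L (ofExtChartAt I x₀).e (extChartAt I x₀ x) : E →L[ℝ] ℝ) := by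
  have h := TangentBundle.symmL_trivializationAt (I := I) hx
  have hr : Set.range I = Set.univ := I.range_eq_univ
  rw [hr, mfderivWithin_univ] at h
  ext a
  simp only [ContinuousLinearMap.inCoordinates, ContinuousLinearMap.comp_apply]
  rw [h]
  simp
  rfl


variable (φ : SmoothChart I N E)

lemma contMDiffAt_cotMom {α : CotangentBundle I N} (hα : α.proj ∈ φ.source) :
    ContMDiffAt (cotModel I) 𝓘(ℝ, E →L[ℝ] ℝ) ∞ (cotMom I φ.toPartialEquiv) α := by
  set K := ofExtChartAt I α.proj with hK
  have h0 := ((contMDiffAt_hom_bundle (IB := I) (IM := cotModel I) (n := ∞)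
    (fun β : CotangentBundle I N => β) (x₀ := α)).1 contMDiffAt_id).2
  have hp : ContMDiffAt (cotModel I) I ∞ (fun β : CotangentBundle I N => β.proj) α :=
    contMDiff_proj_cotangent.contMDiffAt
  have hmem : α.proj ∈ K.source := mem_extChartAt_source α.proj
  have h1 : ContDiffAt ℝ ∞ (fderiv ℝ (fun y => K (φ.symm y))) (φ α.proj) :=
    (contDiffAt_transition (φ.map_source hα) (by rwa [φ.left_inv hα])).fderiv_right (by simp)
  have h2 : ContMDiffAt (cotModel I) 𝓘(ℝ, E →L[ℝ] E) ∞
      (fun β : CotangentBundle I N => fderiv ℝ (fun y => K (φ.symm y)) (φ β.proj)) α :=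
    (h1.contMDiffAt.comp α.proj (contMDiffAt hα)).comp α hp
  refine (h0.clm_comp h2).congr_of_eventuallyEq ?_
  have hev : ∀ᶠ β : CotangentBundle I N in 𝓝 α, β.proj ∈ φ.source ∩ K.source :=
    hp.continuousAt.eventually
      (Filter.inter_mem (source_mem_nhds hα) (source_mem_nhds hmem))
  filter_upwards [hev] with β hβ
  have hβ' : β.proj ∈ (chartAt H α.proj).source := by
    have := hβ.2
    rwa [hK, show (ofExtChartAt I α.proj).source = (extChartAt I α.proj).source from rfl,
      extChartAt_source] at this
  refine ContinuousLinearMap.ext fun a => ?_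
  rw [inCoordinates_cot hβ']
  exact congrArg β.2 (e_transition' (Χ := φ) (Ψ := K) hβ.1 hβ.2 a).symm

lemma contMDiffAt_mk_cotangent {p : E × (E →L[ℝ] ℝ)} (hp : p.1 ∈ φ.target) :
    ContMDiffAt 𝓘(ℝ, E × (E →L[ℝ] ℝ)) (cotModel I) ∞
      (fun p : E × (E →L[ℝ] ℝ) =>
        (⟨φ.symm p.1, (p.2 ∘L φ.d (φ.symm p.1) : TangentSpace I (φ.symm p.1) →L[ℝ] ℝ)⟩ :
          CotangentBundle I N)) p := by
  have hfst : ContMDiffAt 𝓘(ℝ, E × (E →L[ℝ] ℝ)) I ∞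
      (fun p : E × (E →L[ℝ] ℝ) => φ.symm p.1) p :=
    (contMDiffAt_symm hp).comp p contDiff_fst.contMDiff.contMDiffAt
  refine (contMDiffAt_hom_bundle _).2 ⟨hfst, ?_⟩
  set K := ofExtChartAt I (φ.symm p.1) with hK
  have hmem : φ.symm p.1 ∈ K.source := mem_extChartAt_source _
  have hKp : K.symm (K (φ.symm p.1)) ∈ φ.source := by
    rw [K.left_inv hmem]; exact φ.map_target hp
  have h1 : ContDiffAt ℝ ∞ (fderiv ℝ (fun y => φ (K.symm y))) (K (φ.symm p.1)) :=
    (contDiffAt_transition (K.map_source hmem) hKp).fderiv_right (by simp)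
  have h2 : ContMDiffAt 𝓘(ℝ, E × (E →L[ℝ] ℝ)) 𝓘(ℝ, E →L[ℝ] E) ∞
      (fun p : E × (E →L[ℝ] ℝ) => fderiv ℝ (fun y => φ (K.symm y)) (K (φ.symm p.1))) p :=
    h1.contMDiffAt.comp p (ContMDiffAt.comp p (contMDiffAt hmem) hfst)
  have h3 : ContMDiffAt 𝓘(ℝ, E × (E →L[ℝ] ℝ)) 𝓘(ℝ, E →L[ℝ] ℝ) ∞
      (fun p : E × (E →L[ℝ] ℝ) => p.2) p := contDiff_snd.contMDiff.contMDiffAt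
  refine (h3.clm_comp h2).congr_of_eventuallyEq ?_
  have hev : ∀ᶠ q : E × (E →L[ℝ] ℝ) in 𝓝 p, q.1 ∈ φ.target ∧ φ.symm q.1 ∈ K.source :=
    (continuousAt_fst.eventually (target_mem_nhds hp)).and
      (hfst.continuousAt.eventually (source_mem_nhds hmem))
  filter_upwards [hev] with q hq
  have hq' : φ.symm q.1 ∈ (chartAt H (φ.symm p.1)).source := by
    have := hq.2
    rwa [hK, show (ofExtChartAt I (φ.symm p.1)).source = (extChartAt I (φ.symm p.1)).source
      from rfl, extChartAt_source] at this
  refine ContinuousLinearMap.ext fun a => ?_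
  rw [inCoordinates_cot hq']
  have h4 := fderiv_transition (Χ := K) (Ψ := φ) (K.map_source hq.2)
    (by rw [K.left_inv hq.2]; exact φ.map_target hq.1) a
  rw [K.left_inv hq.2] at h4
  exact congrArg q.2 h4.symm

/-- The chart `α ↦ (x, p)` of the cotangent bundle induced by a chart. -/
def cotangent : SmoothChart (cotModel I) (CotangentBundle I N) (E × (E →L[ℝ] ℝ)) where
  toFun α := (φ α.proj, cotMom I φ.toPartialEquiv α)
  invFun p := ⟨φ.symm p.1, (p.2 ∘L φ.d (φ.symm p.1) : TangentSpace I (φ.symm p.1) →L[ℝ] ℝ)⟩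
  source := {α | α.proj ∈ φ.source}
  target := {p | p.1 ∈ φ.target}
  map_source' _ hα := φ.map_source hα
  map_target' _ hp := φ.map_target hp
  left_inv' := by
    rintro ⟨x, a⟩ hα
    have h1 : φ.symm (φ x) = x := φ.left_inv hα
    have h2 : ∀ u : E, (φ.e (φ x) (φ.d (φ.symm (φ x)) u) : E) = u :=
      fun u => e_d' (φ.map_source hα) u
    refine Bundle.TotalSpace.ext h1 (heq_of_eq ?_)
    exact ContinuousLinearMap.ext fun u => congrArg a (h2 u)
  right_inv' := by
    rintro ⟨y, m⟩ hp
    refine Prod.ext (φ.right_inv hp) (ContinuousLinearMap.ext fun a => ?_)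
    have h1 : φ (φ.symm y) = y := φ.right_inv hp
    have h2 : φ.d (φ.symm y) (φ.e (φ (φ.symm y)) a) = a := by
      rw [h1]; exact d_e hp a
    exact congrArg m h2
  open_source := φ.open_source.preimage (contMDiff_proj_cotangent (I := I)).continuous
  open_target := φ.open_target.preimage continuous_fst
  smooth := fun α hα =>
    (((contMDiffAt hα).comp α contMDiff_proj_cotangent.contMDiffAt).prodMk_space
      (contMDiffAt_cotMom φ hα)).contMDiffWithinAt
  smooth_symm := fun p hp => (contMDiffAt_mk_cotangent φ hp).contMDiffWithinAt

lemma mem_cotangent_source {α : CotangentBundle I N} :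
    α ∈ φ.cotangent.source ↔ α.proj ∈ φ.source := Iff.rfl

end Cotangent
end SmoothChart

/-! ### Tangent spaces of embedded submanifolds -/

section TangentSpaceOf

variable {E : Type*} [NormedAddCommGroup E] [NormedSpace ℝ E] {H : Type*} [TopologicalSpace H]
  {I : ModelWithCorners ℝ E H} {N : Type*} [TopologicalSpace N] [ChartedSpace H N]
  {F : Type*} [NormedAddCommGroup F] [NormedSpace ℝ F]

/-- The chain rule along a curve. -/
lemma hasDerivAt_comp_jet {f : N → F} {c : ℝ → N} {t : ℝ}
    (hf : MDifferentiableAt I 𝓘(ℝ, F) f (c t)) (hc : MDifferentiableAt 𝓘(ℝ, ℝ) I c t) :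
    HasDerivAt (fun s => f (c s)) (mvfderiv I f (jet I c t).proj (jet I c t).2) t := by
  have h := hf.hasMFDerivAt.comp t hc.hasMFDerivAt
  have h' : HasFDerivAt (fun s => f (c s))
      ((mvfderiv I f (c t)).comp (mfderiv 𝓘(ℝ, ℝ) I c t) : ℝ →L[ℝ] F) t := h.hasFDerivAt
  exact h'.hasDerivAt

lemma SmoothChart.tangent_jet [IsManifold I ∞ N] (Χ : SmoothChart I N F) {c : ℝ → N} {t : ℝ}
    (hx : c t ∈ Χ.source) (hc : MDifferentiableAt 𝓘(ℝ, ℝ) I c t) :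
    Χ.tangent (jet I c t) = (Χ (c t), deriv (fun s => Χ (c s)) t) :=
  Prod.ext rfl (SmoothChart.d_jet hx hc)

/-- In a normed space, each tangent vector of the zero set of a submersion is the velocity of a
smooth curve in the zero set. -/
lemma exists_curve_of_mem_ker [FiniteDimensional ℝ E] {h : E → F} {y w : E}
    (hh : ContDiffAt ℝ ∞ h y) (hy : h y = 0) (hs : Function.Surjective (fderiv ℝ h y))
    (hw : fderiv ℝ h y w = 0) :
    ∃ c : ℝ → E, ContDiffAt ℝ ∞ c 0 ∧ c 0 = y ∧ HasDerivAt c w 0 ∧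
      ∀ᶠ s in 𝓝 (0 : ℝ), h (c s) = 0 := by
  have hF : FiniteDimensional ℝ F :=
    Module.Finite.of_surjective (fderiv ℝ h y).toLinearMap hs
  have hC : CompleteSpace (ℝ × F) := FiniteDimensional.complete ℝ _
  obtain ⟨R, hR⟩ := (fderiv ℝ h y).toLinearMap.exists_rightInverse_of_surjective
    (LinearMap.range_eq_top.2 hs)
  have hR' : ∀ r, fderiv ℝ h y (R r) = r := fun r => LinearMap.congr_fun hR r
  let ℓ : ℝ × F →L[ℝ] E := (ContinuousLinearMap.fst ℝ ℝ F).smulRight w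
    + R.toContinuousLinearMap ∘L ContinuousLinearMap.snd ℝ ℝ F
  -- The derivative of `T` at the origin is the identity, since `w` lies in the kernel of the
  -- derivative of `h` and `R` is a right inverse of it.
  let T : ℝ × F → ℝ × F := fun p => (p.1, h (y + ℓ p))
  have hin : ContDiffAt ℝ ∞ (fun p : ℝ × F => y + ℓ p) 0 :=
    contDiffAt_const.add ℓ.contDiff.contDiffAt
  have h0 : y + ℓ 0 = y := by simp
  have hT : ContDiffAt ℝ ∞ T 0 := by
    refine contDiffAt_fst.prodMk (ContDiffAt.comp (0 : ℝ × F) ?_ hin)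
    rwa [h0]
  have hT' : HasFDerivAt T ((ContinuousLinearEquiv.refl ℝ (ℝ × F) : ℝ × F →L[ℝ] ℝ × F)) 0 := by
    have h1 : HasFDerivAt (fun p : ℝ × F => y + ℓ p) ℓ 0 := ℓ.hasFDerivAt.const_add y
    have h2 : HasFDerivAt h (fderiv ℝ h y) (y + ℓ 0) := by
      rw [h0]; exact (hh.differentiableAt (by simp)).hasFDerivAt
    have h3 := (hasFDerivAt_fst (𝕜 := ℝ) (p := (0 : ℝ × F))).prodMk (h2.comp (0 : ℝ × F) h1)
    refine h3.congr_fderiv (ContinuousLinearMap.ext fun p => ?_)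
    refine Prod.ext (by simp) ?_
    simp [ℓ, hw, hR']
  have hT0 : T 0 = 0 := Prod.ext rfl (by simp [T, hy])
  let e := hT.toOpenPartialHomeomorph T hT' (by simp)
  have he : ∀ p, e p = T p := fun p => rfl
  have h0s : (0 : ℝ × F) ∈ e.source := hT.mem_toOpenPartialHomeomorph_source hT' (by simp)
  have h0t : (0 : ℝ × F) ∈ e.target := by
    have := e.map_source h0s
    rwa [he, hT0] at this
  have hs0 : e.symm 0 = 0 := by
    have := e.left_inv h0s
    rwa [he, hT0] at this
  have hsm : ContDiffAt ℝ ∞ e.symm 0 := by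
    refine e.contDiffAt_symm (f₀' := ContinuousLinearEquiv.refl ℝ (ℝ × F)) h0t ?_ ?_
    · rw [hs0]; exact hT'
    · rw [hs0]; exact hT
  have hsd : HasFDerivAt e.symm
      ((ContinuousLinearEquiv.refl ℝ (ℝ × F)).symm : ℝ × F →L[ℝ] ℝ × F) 0 :=
    e.hasFDerivAt_symm h0t (by rw [hs0]; exact hT')
  let i : ℝ →L[ℝ] ℝ × F := ContinuousLinearMap.inl ℝ ℝ F
  have hi0 : i 0 = 0 := map_zero i
  refine ⟨fun s => y + ℓ (e.symm (i s)), ?_, ?_, ?_, ?_⟩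
  · refine contDiffAt_const.add (ℓ.contDiff.contDiffAt.comp (0 : ℝ) ?_)
    refine ContDiffAt.comp (0 : ℝ) ?_ i.contDiff.contDiffAt
    rwa [hi0]
  · simp only [hi0, hs0, h0]
  · have h1 : HasFDerivAt (fun s => e.symm (i s)) _ 0 :=
      HasFDerivAt.comp (0 : ℝ) (g := e.symm) (by rw [hi0]; exact hsd) i.hasFDerivAt
    have h2 := (ℓ.hasFDerivAt.comp (0 : ℝ) h1).const_add y
    have h3 := h2.hasDerivAt
    simpa [ℓ, i] using h3
  · have hev : ∀ᶠ s in 𝓝 (0 : ℝ), i s ∈ e.target :=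
      i.continuous.continuousAt.eventually (by rw [hi0]; exact e.open_target.mem_nhds h0t)
    filter_upwards [hev] with s hs
    have := e.right_inv hs
    rw [he] at this
    exact congrArg Prod.snd this

/-- The tangent space of an embedded submanifold is the kernel of the derivative of each of its
local equations. -/
theorem tangentSpaceOf_eq_ker [FiniteDimensional ℝ E] [IsManifold I ∞ N] [I.Boundaryless]
    {f : N → F} {U C : Set N} (hf : DefinesSubmanifoldOn I f U C) {x : N} (hxU : x ∈ U)
    (hxC : x ∈ C) :
    tangentSpaceOf I C x = LinearMap.ker (mvfderiv I f x).toLinearMap := by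
  obtain ⟨hU, hfs, hC, hsub⟩ := hf
  have hfU : ∀ x' ∈ U, ContMDiffAt I 𝓘(ℝ, F) ∞ f x' := fun x' hx' =>
    hfs.contMDiffAt (hU.mem_nhds hx')
  refine le_antisymm (Submodule.span_le.2 ?_) fun u hu => Submodule.subset_span ?_
  · rintro u ⟨c, hc, hcC, hj⟩
    have h0 : c 0 = x := congrArg Bundle.TotalSpace.proj hj
    have hc' : MDifferentiableAt 𝓘(ℝ, ℝ) I c 0 := hc.mdifferentiableAt (by simp)
    have h1 := hasDerivAt_comp_jet (f := f) (c := c) (t := 0)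
      ((hfU (c 0) (h0 ▸ hxU)).mdifferentiableAt (by simp)) hc'
    rw [hj] at h1
    have hev : ∀ᶠ s in 𝓝 (0 : ℝ), c s ∈ U :=
      hc.continuousAt.eventually (hU.mem_nhds (h0 ▸ hxU))
    have h2 : (fun s => f (c s)) =ᶠ[𝓝 0] fun _ => 0 := by
      filter_upwards [hev, hcC] with s hs hs' using (hC _ hs).1 hs'
    exact (h1.congr_of_eventuallyEq h2.symm).unique (hasDerivAt_const (0 : ℝ) (0 : F))
  · set K := SmoothChart.ofExtChartAt I x
    have hx : x ∈ K.source := mem_extChartAt_source x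
    have hy : K x ∈ K.target := K.map_source hx
    have hxy : K.symm (K x) = x := K.left_inv hx
    let h : E → F := fun y => f (K.symm y)
    have hh : ContDiffAt ℝ ∞ h (K x) :=
      (ContMDiffAt.comp (K x) (by rw [hxy]; exact hfU x hxU)
        (SmoothChart.contMDiffAt_symm hy)).contDiffAt
    have hd : mvfderiv I f x = fderiv ℝ h (K x) ∘L K.d x :=
      SmoothChart.mvfderiv_of_factor' hx
        ((SmoothChart.eventually_left_inv hx).mono fun x' hx' => by simp only [h, hx'])
        (hh.differentiableAt (by simp)).hasFDerivAt
    have hsur : Function.Surjective (fderiv ℝ h (K x)) := by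
      have := hsub x hxU hxC
      rw [hd] at this
      exact Function.Surjective.of_comp this
    have hu' : fderiv ℝ h (K x) (K.d x u) = 0 := by
      have := LinearMap.mem_ker.1 hu
      rw [hd] at this
      exact this
    obtain ⟨c, hc, hc0, hcd, hcz⟩ := exists_curve_of_mem_ker hh
      (by simp only [h, hxy]; exact (hC x hxU).1 hxC) hsur hu'
    have hct : c 0 ∈ K.target := by rwa [hc0]
    have hcm := SmoothChart.contMDiffAt_symm_comp hct hc
    have hcx : K.symm (c 0) = x := by rw [hc0, hxy]
    refine ⟨fun s => K.symm (c s), hcm, ?_, ?_⟩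
    · have hev : ∀ᶠ s in 𝓝 (0 : ℝ), K.symm (c s) ∈ U :=
        hcm.continuousAt.eventually (hU.mem_nhds (by simpa only [hcx] using hxU))
      filter_upwards [hev, hcz] with s hs hs' using (hC _ hs).2 hs'
    · have hsrc : K.symm (c 0) ∈ K.source := K.map_target hct
      refine K.tangent.injOn (show _ ∈ K.source from hsrc) (show _ ∈ K.source from hx) ?_
      have h1 := K.tangent_jet (c := fun s => K.symm (c s)) (t := 0) hsrc
        (hcm.mdifferentiableAt (by simp))
      have h2 : (fun s => K (K.symm (c s))) =ᶠ[𝓝 0] c := by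
        filter_upwards [hc.continuousAt.eventually (SmoothChart.eventually_right_inv hct)]
          with s hs
        exact hs
      refine h1.trans ?_
      rw [h2.deriv_eq, hcd.deriv, hcx]
      rfl

lemma mem_tangentSpaceOf_iff [FiniteDimensional ℝ E] [IsManifold I ∞ N] [I.Boundaryless]
    {f : N → F} {U C : Set N} (hf : DefinesSubmanifoldOn I f U C) {x : N} (hxU : x ∈ U)
    (hxC : x ∈ C) (u : TangentSpace I x) : u ∈ tangentSpaceOf I C x ↔ mvfderiv I f x u = 0 := by
  rw [tangentSpaceOf_eq_ker hf hxU hxC]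
  exact Iff.rfl

instance finiteDimensional_tangentSpace [FiniteDimensional ℝ E] (x : N) :
    FiniteDimensional ℝ (TangentSpace I x) :=
  inferInstanceAs (FiniteDimensional ℝ E)

lemma finrank_tangentSpace (x : N) :
    Module.finrank ℝ (TangentSpace I x) = Module.finrank ℝ E := rfl

/-- The dimension of the tangent spaces of an embedded submanifold given by an equation with
values in `F`. -/
theorem finrank_tangentSpaceOf [FiniteDimensional ℝ E] [IsManifold I ∞ N] [I.Boundaryless]
    {f : N → F} {U C : Set N} (hf : DefinesSubmanifoldOn I f U C) {x : N} (hxU : x ∈ U)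
    (hxC : x ∈ C) :
    Module.finrank ℝ (tangentSpaceOf I C x) + Module.finrank ℝ F = Module.finrank ℝ E := by
  rw [tangentSpaceOf_eq_ker hf hxU hxC]
  have h := LinearMap.finrank_range_add_finrank_ker (mvfderiv I f x).toLinearMap
  rw [LinearMap.range_eq_top.2 (hf.2.2.2 x hxU hxC), finrank_top, add_comm,
    finrank_tangentSpace] at h
  exact h

lemma DefinesSubmanifoldOn.comp_equiv {f : N → F} {U C : Set N}
    (hf : DefinesSubmanifoldOn I f U C) {G : Type*} [NormedAddCommGroup G] [NormedSpace ℝ G]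
    (e : F ≃L[ℝ] G) : DefinesSubmanifoldOn I (fun x => e (f x)) U C := by
  obtain ⟨hU, hs, hC, hd⟩ := hf
  refine ⟨hU, e.contDiff.contMDiff.comp_contMDiffOn hs, fun x hx => by simp [hC x hx],
    fun x hx hxC => ?_⟩
  have h1 := (hs.contMDiffAt (hU.mem_nhds hx)).mdifferentiableAt (by simp)
  have h2 := (e.toContinuousLinearMap.hasFDerivAt (x := f x)).hasMFDerivAt.comp x h1.hasMFDerivAt
  have h3 : mvfderiv I (fun x => e (f x)) x = e.toContinuousLinearMap ∘L mvfderiv I f x :=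
    h2.mfderiv
  rw [h3]
  exact e.surjective.comp (hd x hx hxC)

/-- A set that is locally given by equations with values in `F` is an embedded submanifold of
codimension `dim F`. -/
lemma isEmbeddedSubmanifold_of_local [FiniteDimensional ℝ F] {C : Set N} {r : ℕ}
    (hr : r + Module.finrank ℝ F = Module.finrank ℝ E)
    (h : ∀ x ∈ C, ∃ (U : Set N) (f : N → F), x ∈ U ∧ DefinesSubmanifoldOn I f U C) :
    IsEmbeddedSubmanifold I C r := by
  refine ⟨Module.finrank ℝ F, hr, fun x hx => ?_⟩
  obtain ⟨U, f, hxU, hf⟩ := h x hx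
  have e : F ≃L[ℝ] EuclideanSpace ℝ (Fin (Module.finrank ℝ F)) :=
    ContinuousLinearEquiv.ofFinrankEq (by simp)
  exact ⟨U, _, hxU, hf.comp_equiv e⟩

/-- A submersive equation in a chart defines a submanifold of the manifold. -/
lemma SmoothChart.definesSubmanifoldOn (Χ : SmoothChart I N F) {G : Type*}
    [NormedAddCommGroup G] [NormedSpace ℝ G] {f : N → G} {h : F → G} {C : Set N}
    (hfac : ∀ x ∈ Χ.source, f x = h (Χ x)) (hh : ∀ y ∈ Χ.target, ContDiffAt ℝ ∞ h y)
    (hC : ∀ x ∈ Χ.source, x ∈ C ↔ f x = 0)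
    (hs : ∀ x ∈ Χ.source, x ∈ C → Function.Surjective (fderiv ℝ h (Χ x))) :
    DefinesSubmanifoldOn I f Χ.source C := by
  have hev : ∀ x ∈ Χ.source, ∀ᶠ x' in 𝓝 x, f x' = h (Χ x') := fun x hx =>
    Filter.eventually_of_mem (SmoothChart.source_mem_nhds hx) hfac
  refine ⟨Χ.open_source, fun x hx => (SmoothChart.contMDiffAt_of_factor hx (hev x hx)
    (hh _ (Χ.map_source hx))).contMDiffWithinAt, hC, fun x hx hxC => ?_⟩
  rw [SmoothChart.mvfderiv_of_factor' hx (hev x hx)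
    ((hh _ (Χ.map_source hx)).differentiableAt (by simp)).hasFDerivAt]
  exact (hs x hx hxC).comp (SmoothChart.d_surjective hx)

end TangentSpaceOf

/-! ### Second derivatives of transition maps -/

section Calculus

variable {E : Type*} [NormedAddCommGroup E] [NormedSpace ℝ E]
  {F : Type*} [NormedAddCommGroup F] [NormedSpace ℝ F]
  {G : Type*} [NormedAddCommGroup G] [NormedSpace ℝ G]

lemma fderiv_fderiv_comm {g : E → F} {y : E} (hg : ContDiffAt ℝ ∞ g y) (a b : E) :
    fderiv ℝ (fderiv ℝ g) y a b = fderiv ℝ (fderiv ℝ g) y b a :=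
  (hg.isSymmSndFDerivAt (by
    rw [minSmoothness_of_isRCLikeNormedField]; exact ENat.LEInfty.out)).eq a b

lemma hasFDerivAt_fderiv {g : E → F} {y : E} (hg : ContDiffAt ℝ ∞ g y) :
    HasFDerivAt (fderiv ℝ g) (fderiv ℝ (fderiv ℝ g) y) y :=
  ((hg.fderiv_right (m := ∞) (by simp)).differentiableAt (by simp)).hasFDerivAt

/-- The derivative of the pullback of a one-form by `g`. -/
lemma fderiv_comp_fderiv {θ : F → F →L[ℝ] G} {θ' : F →L[ℝ] F →L[ℝ] G} {g : E → F} {y : E}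
    (hg : ContDiffAt ℝ ∞ g y) (hθ : HasFDerivAt θ θ' (g y)) (a b : E) :
    fderiv ℝ (fun y' => θ (g y') ∘L fderiv ℝ g y') y a b
      = θ' (fderiv ℝ g y a) (fderiv ℝ g y b) + θ (g y) (fderiv ℝ (fderiv ℝ g) y a b) := by
  have h1 := hθ.comp y (hg.differentiableAt (by simp)).hasFDerivAt
  have h2 : HasFDerivAt (fun y' => θ (g y') ∘L fderiv ℝ g y') _ y :=
    h1.clm_comp (hasFDerivAt_fderiv hg)
  rw [h2.fderiv]
  simp [add_comm]

/-- The derivative of the tangent map of `g`. -/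
lemma hasFDerivAt_tangentMap {g : E → F} {p : E × E} (hg : ContDiffAt ℝ ∞ g p.1) :
    DifferentiableAt ℝ (fun q : E × E => (g q.1, fderiv ℝ g q.1 q.2)) p ∧
    ∀ u, fderiv ℝ (fun q : E × E => (g q.1, fderiv ℝ g q.1 q.2)) p u
      = (fderiv ℝ g p.1 u.1, fderiv ℝ (fderiv ℝ g) p.1 u.1 p.2 + fderiv ℝ g p.1 u.2) := by
  have h1 : HasFDerivAt (fun q : E × E => fderiv ℝ g q.1) _ p :=
    HasFDerivAt.comp (g := fderiv ℝ g) p (hasFDerivAt_fderiv hg) hasFDerivAt_fst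
  have h2 : HasFDerivAt (fun q : E × E => g q.1) _ p :=
    HasFDerivAt.comp (g := g) p (hg.differentiableAt (by simp)).hasFDerivAt hasFDerivAt_fst
  have h3 := h2.prodMk (h1.clm_apply hasFDerivAt_snd)
  refine ⟨h3.differentiableAt, fun u => ?_⟩
  rw [h3.fderiv]
  simp [add_comm]

/-- The derivative of a composition of linear maps that depend on a parameter. -/
lemma fderiv_clm_comp_apply {P : Type*} [NormedAddCommGroup P] [NormedSpace ℝ P]
    {m : P → F →L[ℝ] G} {l : P → E →L[ℝ] F} {p : P} (hm : DifferentiableAt ℝ m p)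
    (hl : DifferentiableAt ℝ l p) (u : P) (a : E) :
    fderiv ℝ (fun q => m q ∘L l q) p u a = fderiv ℝ m p u (l p a) + m p (fderiv ℝ l p u a) := by
  rw [(hm.hasFDerivAt.clm_comp hl.hasFDerivAt).fderiv]
  simp [add_comm]

/-- The derivative of the pullback of a bilinear form by `g`. -/
lemma hasFDerivAt_pullBilin {β : F → F →L[ℝ] F →L[ℝ] ℝ} {β' : F →L[ℝ] F →L[ℝ] F →L[ℝ] ℝ}
    {g : E → F} {y : E} (hg : ContDiffAt ℝ ∞ g y) (hβ : HasFDerivAt β β' (g y)) :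
    DifferentiableAt ℝ (fun y' => pullBilin (β (g y')) (fderiv ℝ g y') (fderiv ℝ g y')) y ∧
    ∀ c a b, fderiv ℝ (fun y' => pullBilin (β (g y')) (fderiv ℝ g y') (fderiv ℝ g y')) y c a b
      = β' (fderiv ℝ g y c) (fderiv ℝ g y a) (fderiv ℝ g y b)
        + β (g y) (fderiv ℝ (fderiv ℝ g) y c a) (fderiv ℝ g y b)
        + β (g y) (fderiv ℝ g y a) (fderiv ℝ (fderiv ℝ g) y c b) := by
  have h1 := HasFDerivAt.comp (g := β) y hβ (hg.differentiableAt (by simp)).hasFDerivAt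
  have hD := hasFDerivAt_fderiv hg
  have h2 := h1.clm_comp hD
  have hP : HasFDerivAt (fun y' => (ContinuousLinearMap.precomp ℝ (fderiv ℝ g y') :
      (F →L[ℝ] ℝ) →L[ℝ] E →L[ℝ] ℝ)) _ y := HasFDerivAt.comp
    (g := fun l => (ContinuousLinearMap.compL ℝ E F ℝ).flip l) y
      (ContinuousLinearMap.compL ℝ E F ℝ).flip.hasFDerivAt hD
  have h3 : HasFDerivAt (fun y' => pullBilin (β (g y')) (fderiv ℝ g y') (fderiv ℝ g y')) _ y :=
    hP.clm_comp h2
  refine ⟨h3.differentiableAt, fun c a b => ?_⟩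
  rw [h3.fderiv]
  simp [add_comm]

lemma contDiffAt_pullBilin {B : F →L[ℝ] F →L[ℝ] ℝ} {g : E → F} {y : E}
    (hg : ContDiffAt ℝ ∞ g y) :
    ContDiffAt ℝ ∞ (fun y' => pullBilin B (fderiv ℝ g y') (fderiv ℝ g y')) y := by
  have hD : ContDiffAt ℝ ∞ (fderiv ℝ g) y := hg.fderiv_right (by simp)
  exact ((ContinuousLinearMap.compL ℝ E F ℝ).flip.contDiff.contDiffAt.comp y hD).clm_comp
    (contDiffAt_const.clm_comp hD)

end Calculus

/-! ### Forms in arbitrary charts -/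

section Forms

variable {E : Type*} [NormedAddCommGroup E] [NormedSpace ℝ E] {H : Type*} [TopologicalSpace H]
  {I : ModelWithCorners ℝ E H} {N : Type*} [TopologicalSpace N] [ChartedSpace H N]
  {F : Type*} [NormedAddCommGroup F] [NormedSpace ℝ F]
  {G : Type*} [NormedAddCommGroup G] [NormedSpace ℝ G]

lemma pullBilin_apply {V W : Type*}
    [AddCommGroup V] [Module ℝ V] [TopologicalSpace V]
    [AddCommGroup W] [Module ℝ W] [TopologicalSpace W]
    (B : W →L[ℝ] W →L[ℝ] ℝ) (f g : V →L[ℝ] W) (u w : V) :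
    pullBilin B f g u w = B (f u) (g w) := rfl

namespace SmoothChart

variable (Χ : SmoothChart I N F)

/-- The expression of a one-form in a chart. -/
def oneForm (θ : OneForm I N) (y : F) : F →L[ℝ] ℝ := θ (Χ.symm y) ∘L Χ.e y

/-- The expression of a two-form in a chart. -/
def twoForm (Ω : TwoForm I N) (y : F) : F →L[ℝ] F →L[ℝ] ℝ :=
  pullBilin (Ω (Χ.symm y)) (Χ.e y) (Χ.e y)

variable {Χ} {Ψ : SmoothChart I N G}

lemma oneForm_apply (θ : OneForm I N) (y : F) (a : F) :
    Χ.oneForm θ y a = θ (Χ.symm y) (Χ.e y a) := rfl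

lemma twoForm_apply (Ω : TwoForm I N) (y : F) (a b : F) :
    Χ.twoForm Ω y a b = Ω (Χ.symm y) (Χ.e y a) (Χ.e y b) := rfl

lemma oneForm_d (θ : OneForm I N) {x : N} (hx : x ∈ Χ.source) (u : TangentSpace I x) :
    Χ.oneForm θ (Χ x) (Χ.d x u) = θ x u := by
  have key : ∀ x', x' = x → ∀ a : E, (θ x' : E →L[ℝ] ℝ) a = (θ x : E →L[ℝ] ℝ) a := by
    rintro _ rfl a; rfl
  rw [oneForm_apply, e_d hx]
  exact key _ (Χ.left_inv hx) u

lemma twoForm_d (Ω : TwoForm I N) {x : N} (hx : x ∈ Χ.source) (u w : TangentSpace I x) :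
    Χ.twoForm Ω (Χ x) (Χ.d x u) (Χ.d x w) = Ω x u w := by
  have key : ∀ x', x' = x → ∀ a b : E,
      (Ω x' : E →L[ℝ] E →L[ℝ] ℝ) a b = (Ω x : E →L[ℝ] E →L[ℝ] ℝ) a b := by
    rintro _ rfl a b; rfl
  rw [twoForm_apply, e_d hx, e_d hx]
  exact key _ (Χ.left_inv hx) u w

lemma oneForm_transition (θ : OneForm I N) {y : F} (hy : y ∈ Χ.target)
    (hy' : Χ.symm y ∈ Ψ.source) :
    Χ.oneForm θ y =
      Ψ.oneForm θ (Ψ (Χ.symm y)) ∘L fderiv ℝ (fun y' => Ψ (Χ.symm y')) y := by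
  ext a
  rw [ContinuousLinearMap.comp_apply, fderiv_transition hy hy', oneForm_d θ hy', oneForm_apply]

lemma twoForm_transition (Ω : TwoForm I N) {y : F} (hy : y ∈ Χ.target)
    (hy' : Χ.symm y ∈ Ψ.source) :
    Χ.twoForm Ω y = pullBilin (Ψ.twoForm Ω (Ψ (Χ.symm y)))
      (fderiv ℝ (fun y' => Ψ (Χ.symm y')) y) (fderiv ℝ (fun y' => Ψ (Χ.symm y')) y) := by
  ext a b
  rw [pullBilin_apply, fderiv_transition hy hy', fderiv_transition hy hy', twoForm_d Ω hy',
    twoForm_apply]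

lemma inChart_eq_twoForm [IsManifold I ∞ N] [I.Boundaryless] (Ω : TwoForm I N) (x : N) :
    TwoForm.inChart I Ω x = (ofExtChartAt I x).twoForm Ω := rfl

lemma eventually_mem_transition {y : F} (hy : y ∈ Χ.target) (hy' : Χ.symm y ∈ Ψ.source) :
    ∀ᶠ y' in 𝓝 y, y' ∈ Χ.target ∧ Χ.symm y' ∈ Ψ.source :=
  (Filter.Eventually.and (target_mem_nhds hy)
    ((contMDiffAt_symm hy).continuousAt.eventually (source_mem_nhds hy')))

/-- The exterior derivative can be computed in any chart. -/
theorem exteriorDeriv_eq [IsManifold I ∞ N] [I.Boundaryless] (θ : OneForm I N) {x : N}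
    (hx : x ∈ Χ.source) {D : F →L[ℝ] F →L[ℝ] ℝ} (hθ : HasFDerivAt (Χ.oneForm θ) D (Χ x))
    (u w : TangentSpace I x) :
    exteriorDeriv I θ x u w = D (Χ.d x u) (Χ.d x w) - D (Χ.d x w) (Χ.d x u) := by
  set K := ofExtChartAt I x
  have hK : x ∈ K.source := mem_extChartAt_source x
  have hy : K x ∈ K.target := K.map_source hK
  have hxK : K.symm (K x) = x := K.left_inv hK
  have hy' : K.symm (K x) ∈ Χ.source := by rwa [hxK]
  have hg := contDiffAt_transition (Ψ := Χ) hy hy'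
  have hev : OneForm.inChart I θ x =ᶠ[𝓝 (K x)] fun y =>
      Χ.oneForm θ (Χ (K.symm y)) ∘L fderiv ℝ (fun y' => Χ (K.symm y')) y :=
    (eventually_mem_transition hy hy').mono fun y h => oneForm_transition θ h.1 h.2
  have hD := fun a b => fderiv_comp_fderiv hg (by rw [hxK]; exact hθ) a b
  have h0 : exteriorDeriv I θ x u w =
      fderiv ℝ (OneForm.inChart I θ x) (K x) (K.d x u) (K.d x w)
        - fderiv ℝ (OneForm.inChart I θ x) (K x) (K.d x w) (K.d x u) := rfl
  rw [h0, hev.fderiv_eq, hD, hD, fderiv_fderiv_comm hg (K.d x u), d_transition hK hx u,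
    d_transition hK hx w]
  ring

/-- A two-form that has locally constant coefficients in suitable charts is closed. -/
theorem isClosedTwoForm_of_const [IsManifold I ∞ N] [I.Boundaryless] (Ω : TwoForm I N)
    (B : F →L[ℝ] F →L[ℝ] ℝ) (hB : ∀ a, B a a = 0)
    (h : ∀ x, ∃ Χ : SmoothChart I N F, x ∈ Χ.source ∧ ∀ y ∈ Χ.target, Χ.twoForm Ω y = B) :
    IsClosedTwoForm I Ω := by
  have hB' : ∀ a b, B a b = - B b a := by
    intro a b
    have := hB (a + b)
    simp only [map_add, add_apply, hB] at this
    linarith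
  refine ⟨fun x u => ?_, fun x => ?_⟩
  · obtain ⟨Χ, hx, hc⟩ := h x
    rw [← twoForm_d Ω hx, hc _ (Χ.map_source hx), hB]
  · obtain ⟨Χ, hx, hc⟩ := h x
    set K := ofExtChartAt I x
    have hK : x ∈ K.source := mem_extChartAt_source x
    have hy : K x ∈ K.target := K.map_source hK
    have hxK : K.symm (K x) = x := K.left_inv hK
    have hy' : K.symm (K x) ∈ Χ.source := by rwa [hxK]
    have hg := contDiffAt_transition (Ψ := Χ) hy hy'
    have hev : TwoForm.inChart I Ω x =ᶠ[𝓝 (K x)] fun y =>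
        pullBilin B (fderiv ℝ (fun y' => Χ (K.symm y')) y)
          (fderiv ℝ (fun y' => Χ (K.symm y')) y) :=
      (eventually_mem_transition hy hy').mono fun y h => by
        rw [← hc _ (Χ.map_source h.2), inChart_eq_twoForm]
        exact twoForm_transition Ω h.1 h.2
    have hD := (hasFDerivAt_pullBilin (β := fun _ => B) hg (hasFDerivAt_const B _)).2
    refine ⟨(contDiffAt_pullBilin hg).congr_of_eventuallyEq hev, fun a b c => ?_⟩
    rw [show extChartAt I x x = K x from rfl, hev.fderiv_eq, hD, hD, hD,
      fderiv_fderiv_comm hg b a, fderiv_fderiv_comm hg c a, fderiv_fderiv_comm hg c b]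
    simp only [zero_apply, zero_add]
    -- `B (Dg a) (D²g b c)` and its like cancel in pairs, as `B` is alternating.
    rw [hB' (fderiv ℝ (fderiv ℝ fun y' => Χ (K.symm y')) (K x) a b),
      hB' (fderiv ℝ (fderiv ℝ fun y' => Χ (K.symm y')) (K x) b c),
      hB' (fderiv ℝ (fderiv ℝ fun y' => Χ (K.symm y')) (K x) a c)]
    ring

end SmoothChart

end Forms

/-! ### Complete lifts and the Tulczyjew map in arbitrary charts -/

section Lifts

variable {E : Type*} [NormedAddCommGroup E] [NormedSpace ℝ E] {H : Type*} [TopologicalSpace H]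
  {I : ModelWithCorners ℝ E H} {N : Type*} [TopologicalSpace N] [ChartedSpace H N]
  {F : Type*} [NormedAddCommGroup F] [NormedSpace ℝ F]
  {G : Type*} [NormedAddCommGroup G] [NormedSpace ℝ G]

namespace SmoothChart

section TangentCharts

variable [IsManifold I ∞ N] {Χ : SmoothChart I N F} {Ψ : SmoothChart I N G}

lemma mvfderiv_tanPos (φ : SmoothChart I N E) {z : TangentBundle I N} (hz : z.proj ∈ φ.source)
    (u : TangentSpace I.tangent z) :
    mvfderiv I.tangent (tanPos I φ.toPartialEquiv) z u = (φ.tangent.d z u).1 :=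
  mvfderiv_of_factor (Χ := φ.tangent) (h := Prod.fst) hz (Filter.Eventually.of_forall fun _ => rfl)
    hasFDerivAt_fst u

lemma mvfderiv_tanVel (φ : SmoothChart I N E) {z : TangentBundle I N} (hz : z.proj ∈ φ.source)
    (u : TangentSpace I.tangent z) :
    mvfderiv I.tangent (tanVel I φ.toPartialEquiv) z u = (φ.tangent.d z u).2 :=
  mvfderiv_of_factor (Χ := φ.tangent) (h := Prod.snd) hz (Filter.Eventually.of_forall fun _ => rfl)
    hasFDerivAt_snd u

/-- The transition map between two charts of the tangent bundle is `(y, w) ↦ (g y, Dg(y) w)`; its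
derivative involves the second derivative of `g`. -/
lemma tangent_d_transition {z : TangentBundle I N} (hz : z.proj ∈ Χ.source)
    (hz' : z.proj ∈ Ψ.source) (u : TangentSpace I.tangent z) :
    Ψ.tangent.d z u =
      (fderiv ℝ (fun y => Ψ (Χ.symm y)) (Χ z.proj) (Χ.tangent.d z u).1,
        fderiv ℝ (fderiv ℝ (fun y => Ψ (Χ.symm y))) (Χ z.proj) (Χ.tangent.d z u).1
            (Χ.tangent z).2
          + fderiv ℝ (fun y => Ψ (Χ.symm y)) (Χ z.proj) (Χ.tangent.d z u).2) := by
  have hy : Χ z.proj ∈ Χ.target := Χ.map_source hz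
  have hg := contDiffAt_transition (Ψ := Ψ) hy (by rwa [Χ.left_inv hz])
  have hT := hasFDerivAt_tangentMap (p := Χ.tangent z) hg
  rw [mvfderiv_of_factor (Χ := Χ.tangent) (x := z) (f := Ψ.tangent)
    (h := fun p => (Ψ (Χ.symm p.1), fderiv ℝ (fun y => Ψ (Χ.symm y)) p.1 p.2)) hz ?_
    hT.1.hasFDerivAt u, hT.2]
  · rfl
  · have hev : ∀ᶠ v : TangentBundle I N in 𝓝 z, v.proj ∈ Χ.source ∩ Ψ.source :=
      (contMDiff_proj_tangent (I := I)).continuous.continuousAt.eventually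
        (Filter.inter_mem (source_mem_nhds hz) (source_mem_nhds hz'))
    filter_upwards [hev] with v hv
    refine Prod.ext ?_ ?_
    · simp only [tangent_apply]
      rw [Χ.left_inv hv.1]
    · exact d_transition hv.1 hv.2 v.2

/-- The complete lift of a two-form can be computed in any chart. -/
theorem completeLift_eq [I.Boundaryless] (Ω : TwoForm I N) {z : TangentBundle I N}
    (hz : z.proj ∈ Χ.source) {D : F →L[ℝ] F →L[ℝ] F →L[ℝ] ℝ}
    (hΩ : HasFDerivAt (Χ.twoForm Ω) D (Χ z.proj)) (u w : TangentSpace I.tangent z) :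
    completeLift I Ω z u w =
      D (Χ.tangent z).2 (Χ.tangent.d z u).1 (Χ.tangent.d z w).1
        + Χ.twoForm Ω (Χ z.proj) (Χ.tangent.d z u).2 (Χ.tangent.d z w).1
        + Χ.twoForm Ω (Χ z.proj) (Χ.tangent.d z u).1 (Χ.tangent.d z w).2 := by
  set K := ofExtChartAt I z.proj
  have hK : z.proj ∈ K.source := mem_extChartAt_source z.proj
  have hy : K z.proj ∈ K.target := K.map_source hK
  have hxK : K.symm (K z.proj) = z.proj := K.left_inv hK
  have hy' : K.symm (K z.proj) ∈ Χ.source := by rwa [hxK]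
  have hg := contDiffAt_transition (Ψ := Χ) hy hy'
  have hev : TwoForm.inChart I Ω z.proj =ᶠ[𝓝 (K z.proj)] fun y =>
      pullBilin (Χ.twoForm Ω (Χ (K.symm y))) (fderiv ℝ (fun y' => Χ (K.symm y')) y)
        (fderiv ℝ (fun y' => Χ (K.symm y')) y) :=
    (eventually_mem_transition hy hy').mono fun y h => by
      rw [inChart_eq_twoForm]; exact twoForm_transition Ω h.1 h.2
  have h0 : completeLift I Ω z u w =
      fderiv ℝ (TwoForm.inChart I Ω z.proj) (K z.proj) (K.tangent z).2
          (mvfderiv I.tangent (tanPos I K.toPartialEquiv) z u)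
          (mvfderiv I.tangent (tanPos I K.toPartialEquiv) z w)
        + TwoForm.inChart I Ω z.proj (K z.proj)
          (mvfderiv I.tangent (tanVel I K.toPartialEquiv) z u)
          (mvfderiv I.tangent (tanPos I K.toPartialEquiv) z w)
        + TwoForm.inChart I Ω z.proj (K z.proj)
          (mvfderiv I.tangent (tanPos I K.toPartialEquiv) z u)
          (mvfderiv I.tangent (tanVel I K.toPartialEquiv) z w) := rfl
  have hvel : (Χ.tangent z).2
      = fderiv ℝ (fun y' => Χ (K.symm y')) (K z.proj) (K.tangent z).2 :=
    d_transition hK hz z.2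
  have hD := (hasFDerivAt_pullBilin hg (by rw [hxK]; exact hΩ)).2
  rw [h0, hev.fderiv_eq, hD, hev.eq_of_nhds, mvfderiv_tanPos K hK, mvfderiv_tanPos K hK,
    mvfderiv_tanVel K hK, mvfderiv_tanVel K hK, hvel, tangent_d_transition hK hz u,
    tangent_d_transition hK hz w]
  simp only [pullBilin_apply, hxK, map_add, add_apply]
  rw [fderiv_fderiv_comm hg (K.tangent z).2 (K.tangent.d z u).1,
    fderiv_fderiv_comm hg (K.tangent z).2 (K.tangent.d z w).1]
  ring

variable (F) in
/-- The complete lift of a bilinear form with constant coefficients. -/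
def liftBilin (B : F →L[ℝ] F →L[ℝ] ℝ) : F × F →L[ℝ] F × F →L[ℝ] ℝ :=
  pullBilin B (ContinuousLinearMap.snd ℝ F F) (ContinuousLinearMap.fst ℝ F F)
    + pullBilin B (ContinuousLinearMap.fst ℝ F F) (ContinuousLinearMap.snd ℝ F F)

lemma liftBilin_apply (B : F →L[ℝ] F →L[ℝ] ℝ) (a b : F × F) :
    liftBilin F B a b = B a.2 b.1 + B a.1 b.2 := rfl

/-- If a two-form has constant coefficients in a chart, then so does its complete lift. -/
lemma completeLift_of_const [I.Boundaryless] {Ω : TwoForm I N} {B : F →L[ℝ] F →L[ℝ] ℝ}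
    (hB : ∀ y ∈ Χ.target, Χ.twoForm Ω y = B) {z : TangentBundle I N} (hz : z.proj ∈ Χ.source)
    (u w : TangentSpace I.tangent z) :
    completeLift I Ω z u w = liftBilin F B (Χ.tangent.d z u) (Χ.tangent.d z w) := by
  have hy : Χ z.proj ∈ Χ.target := Χ.map_source hz
  have hev : Χ.twoForm Ω =ᶠ[𝓝 (Χ z.proj)] fun _ => B :=
    Filter.eventually_of_mem (target_mem_nhds hy) hB
  rw [completeLift_eq Ω hz ((hasFDerivAt_const B _).congr_of_eventuallyEq hev), hB _ hy,
    liftBilin_apply]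
  simp

lemma completeLift_twoForm_of_const [I.Boundaryless] {Ω : TwoForm I N} {B : F →L[ℝ] F →L[ℝ] ℝ}
    (hB : ∀ y ∈ Χ.target, Χ.twoForm Ω y = B) {p : F × F} (hp : p ∈ Χ.tangent.target) :
    Χ.tangent.twoForm (completeLift I Ω) p = liftBilin F B := by
  refine ContinuousLinearMap.ext fun a => ContinuousLinearMap.ext fun b => ?_
  rw [twoForm_apply, completeLift_of_const hB (Χ.tangent.map_target hp), d_e hp, d_e hp]

end TangentCharts

/-! ### The canonical forms of the cotangent bundle -/

section CotangentCharts

variable [IsManifold I ∞ N] (φ : SmoothChart I N E)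

/-- A covector is evaluated on a tangent vector by pairing momenta and velocities. -/
lemma cotMom_d {α : CotangentBundle I N} (hα : α.proj ∈ φ.source) (u : TangentSpace I α.proj) :
    cotMom I φ.toPartialEquiv α (φ.d α.proj u) = α.2 u :=
  congrArg α.2 (e_d hα u)

lemma cotMom_transition {ψ : SmoothChart I N E} {α : CotangentBundle I N}
    (hα : α.proj ∈ φ.source) (hα' : α.proj ∈ ψ.source) :
    cotMom I φ.toPartialEquiv α = cotMom I ψ.toPartialEquiv α ∘L
      fderiv ℝ (fun y => ψ (φ.symm y)) (φ α.proj) :=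
  ContinuousLinearMap.ext fun a => congrArg α.2 (e_transition' hα hα' a).symm

variable [I.Boundaryless]

lemma d_mfderiv_proj {α : CotangentBundle I N} (hα : α.proj ∈ φ.source)
    (u : TangentSpace (cotModel I) α) :
    φ.d α.proj (mfderiv (cotModel I) I Bundle.TotalSpace.proj α u) = (φ.cotangent.d α u).1 := by
  have h1 := (mdifferentiableAt hα).hasMFDerivAt.comp α
    (contMDiff_proj_cotangent.contMDiffAt.mdifferentiableAt (by simp)).hasMFDerivAt
  have h2 := hasMFDerivAt_of_factor (Χ := φ.cotangent) (x := α) (f := fun β => φ β.proj)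
    (h := Prod.fst) hα (Filter.Eventually.of_forall fun _ => rfl) hasFDerivAt_fst
  exact congrArg (fun l : E × (E →L[ℝ] ℝ) →L[ℝ] E => l u) (hasMFDerivAt_unique h1 h2)

lemma mvfderiv_cotMom {α : CotangentBundle I N} (hα : α.proj ∈ φ.source)
    (u : TangentSpace (cotModel I) α) :
    mvfderiv (cotModel I) (cotMom I φ.toPartialEquiv) α u = (φ.cotangent.d α u).2 :=
  mvfderiv_of_factor (Χ := φ.cotangent) (h := Prod.snd) hα
    (Filter.Eventually.of_forall fun _ => rfl) hasFDerivAt_snd u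

variable (E) in
/-- The derivative of the Liouville form: the bilinear form `dp ⊗ dq` on `E × E^*`. -/
def momPos : E × (E →L[ℝ] ℝ) →L[ℝ] E × (E →L[ℝ] ℝ) →L[ℝ] ℝ :=
  (ContinuousLinearMap.precomp ℝ (ContinuousLinearMap.fst ℝ E (E →L[ℝ] ℝ))) ∘L
    ContinuousLinearMap.snd ℝ E (E →L[ℝ] ℝ)

lemma momPos_apply (a b : E × (E →L[ℝ] ℝ)) : momPos E a b = a.2 b.1 := rfl

variable (E) in
/-- The canonical symplectic form `dq ∧ dp` on `E × E^*`. -/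
def symplectic : E × (E →L[ℝ] ℝ) →L[ℝ] E × (E →L[ℝ] ℝ) →L[ℝ] ℝ :=
  (momPos E).flip - momPos E

lemma symplectic_apply (a b : E × (E →L[ℝ] ℝ)) :
    symplectic E a b = b.2 a.1 - a.2 b.1 := rfl

variable {φ}

lemma oneForm_liouville {p : E × (E →L[ℝ] ℝ)} (hp : p ∈ φ.cotangent.target) :
    φ.cotangent.oneForm (liouvilleForm I) p = momPos E p := by
  refine ContinuousLinearMap.ext fun a => ?_
  have hα : (φ.cotangent.symm p).proj ∈ φ.source := φ.cotangent.map_target hp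
  have h1 := cotMom_d φ hα (mfderiv (cotModel I) I Bundle.TotalSpace.proj _
    (φ.cotangent.e p a))
  rw [d_mfderiv_proj φ hα, d_e hp] at h1
  refine Eq.trans ?_ (h1.symm.trans ?_)
  · rfl
  · rw [momPos_apply]
    exact congrArg (fun q : E × (E →L[ℝ] ℝ) => q.2 a.1) (φ.cotangent.right_inv hp)

lemma canonicalForm_eq {α : CotangentBundle I N} (hα : α.proj ∈ φ.source)
    (u w : TangentSpace (cotModel I) α) :
    canonicalForm I α u w = symplectic E (φ.cotangent.d α u) (φ.cotangent.d α w) := by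
  have hy : φ.cotangent α ∈ φ.cotangent.target :=
    φ.cotangent.map_source (x := α) hα
  have hev : φ.cotangent.oneForm (liouvilleForm I) =ᶠ[𝓝 (φ.cotangent α)] momPos E :=
    Filter.eventually_of_mem (target_mem_nhds hy) fun p hp => oneForm_liouville hp
  have h := exteriorDeriv_eq (Χ := φ.cotangent) (liouvilleForm I) (x := α) hα
    ((momPos E).hasFDerivAt.congr_of_eventuallyEq hev) u w
  have h' : canonicalForm I α u w = -(exteriorDeriv (cotModel I) (liouvilleForm I) α u w) := rfl
  rw [h', h, symplectic_apply, momPos_apply, momPos_apply]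
  ring

/-- Charts of the cotangent bundle that are induced by charts of the base are canonical. -/
lemma twoForm_canonicalForm {p : E × (E →L[ℝ] ℝ)} (hp : p ∈ φ.cotangent.target) :
    φ.cotangent.twoForm (canonicalForm I) p = symplectic E := by
  refine ContinuousLinearMap.ext fun a => ContinuousLinearMap.ext fun b => ?_
  rw [twoForm_apply, canonicalForm_eq (φ.cotangent.map_target hp), d_e hp, d_e hp]

/-- The complete lift of the canonical symplectic form, in a chart. -/
lemma completeLift_canonicalForm {z : TangentBundle (cotModel I) (CotangentBundle I N)}
    (hz : z.proj.proj ∈ φ.source) (u w : TangentSpace (cotModel I).tangent z) :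
    completeLift (cotModel I) (canonicalForm I) z u w =
      liftBilin _ (symplectic E) (φ.cotangent.tangent.d z u) (φ.cotangent.tangent.d z w) :=
  completeLift_of_const (Χ := φ.cotangent) (fun _ hp => twoForm_canonicalForm hp) hz u w

/-- The complete lift of the canonical symplectic form is closed. -/
theorem isClosedTwoForm_completeLift :
    IsClosedTwoForm (cotModel I).tangent
      (completeLift (cotModel I) (canonicalForm (I := I) (N := N))) := by
  refine isClosedTwoForm_of_const _ (liftBilin _ (symplectic E)) (fun a => ?_) fun z => ?_
  · simp only [liftBilin_apply, symplectic_apply]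
    ring
  · exact ⟨(ofExtChartAt I z.proj.proj).cotangent.tangent,
      mem_extChartAt_source z.proj.proj,
      fun p hp => completeLift_twoForm_of_const (fun _ hq => twoForm_canonicalForm hq) hp⟩

/-- The velocities of the projection to `TN` of a tangent vector of `T^*N`. -/
lemma tangent_tangentProj {z : TangentBundle (cotModel I) (CotangentBundle I N)}
    (hz : z.proj.proj ∈ φ.source) :
    φ.tangent (tangentProj I z)
      = ((φ.cotangent.tangent z).1.1, (φ.cotangent.tangent z).2.1) :=
  Prod.ext rfl (d_mfderiv_proj φ hz z.2)

/-- The derivative of the momenta in one chart, in terms of another chart. -/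
lemma cotangent_d_transition {ψ : SmoothChart I N E} {α : CotangentBundle I N}
    (hα : α.proj ∈ φ.source) (hα' : α.proj ∈ ψ.source) (u : TangentSpace (cotModel I) α) (a : E) :
    (φ.cotangent.d α u).2 a =
      (ψ.cotangent.d α u).2 (fderiv ℝ (fun y => ψ (φ.symm y)) (φ α.proj) a)
        + cotMom I ψ.toPartialEquiv α (fderiv ℝ (fderiv ℝ (fun y => ψ (φ.symm y))) (φ α.proj)
          (φ.cotangent.d α u).1 a) := by
  set Θ := φ.cotangent
  have hy : φ α.proj ∈ φ.target := φ.map_source hα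
  have hθ : Θ α ∈ Θ.target := Θ.map_source (x := α) hα
  have hback : Θ.symm (Θ α) = α := Θ.left_inv (x := α) hα
  have hg := contDiffAt_transition (Ψ := ψ) hy (by rwa [φ.left_inv hα])
  let m : E × (E →L[ℝ] ℝ) → (E →L[ℝ] ℝ) := fun p => cotMom I ψ.toPartialEquiv (Θ.symm p)
  have hm : DifferentiableAt ℝ m (Θ α) :=
    (((contMDiffAt_cotMom ψ (α := Θ.symm (Θ α)) (by rwa [hback])).comp (Θ α)
      (contMDiffAt_symm hθ)).contDiffAt).differentiableAt (by simp)
  have hmα : m (Θ α) = cotMom I ψ.toPartialEquiv α := by simp only [m, hback]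
  have hmd : fderiv ℝ m (Θ α) (Θ.d α u) = (ψ.cotangent.d α u).2 := by
    rw [← mvfderiv_cotMom ψ hα', mvfderiv_of_factor (Χ := Θ) (h := m) hα
      ((eventually_left_inv (Χ := Θ) hα).mono fun β hβ => by simp only [m, hβ]) hm.hasFDerivAt]
  have h1 : HasFDerivAt (fun p : E × (E →L[ℝ] ℝ) =>
      fderiv ℝ (fun y => ψ (φ.symm y)) p.1) _ (Θ α) :=
    HasFDerivAt.comp (g := fderiv ℝ (fun y => ψ (φ.symm y))) (Θ α)
      (hasFDerivAt_fderiv hg) hasFDerivAt_fst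
  have h2 := fderiv_clm_comp_apply hm h1.differentiableAt (Θ.d α u) a
  have hev : ∀ᶠ p in 𝓝 (Θ α), p.2 = m p ∘L fderiv ℝ (fun y => ψ (φ.symm y)) p.1 := by
    have hs : ∀ᶠ p in 𝓝 (Θ α), (Θ.symm p).proj ∈ ψ.source :=
      ((contMDiff_proj_cotangent (I := I)).continuous.continuousAt.comp
        (contMDiffAt_symm hθ).continuousAt).eventually
        (source_mem_nhds (by simpa [hback] using hα'))
    filter_upwards [target_mem_nhds hθ, hs] with p hp hps
    have h3 := cotMom_transition φ (ψ := ψ) (α := Θ.symm p) (Θ.map_target hp) hps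
    have h4 : (φ (Θ.symm p).proj, cotMom I φ.toPartialEquiv (Θ.symm p)) = p := Θ.right_inv hp
    rw [← h4]
    simpa only [m, h4] using h3
  have hsnd : fderiv ℝ (fun p : E × (E →L[ℝ] ℝ) => p.2) (Θ α) (Θ.d α u) = (Θ.d α u).2 := by
    rw [hasFDerivAt_snd.fderiv]; rfl
  rw [h1.fderiv, Filter.EventuallyEq.fderiv_eq (hev.mono fun _ h => h.symm), hsnd, hmd, hmα] at h2
  exact h2

/-- The Tulczyjew map `(q, p; q̇, ṗ) ↦ ṗ dq + p dq̇` can be computed in any chart. -/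
theorem tulczyjew_eq {z : TangentBundle (cotModel I) (CotangentBundle I N)}
    (hz : z.proj.proj ∈ φ.source) (u : TangentSpace I.tangent (tangentProj I z)) :
    tulczyjew I z u =
      (φ.cotangent.tangent z).2.2 (φ.tangent.d (tangentProj I z) u).1
        + (φ.cotangent.tangent z).1.2 (φ.tangent.d (tangentProj I z) u).2 := by
  set K := ofExtChartAt I z.proj.proj
  have hK : z.proj.proj ∈ K.source := mem_extChartAt_source z.proj.proj
  have hy : K z.proj.proj ∈ K.target := K.map_source hK
  have hg := contDiffAt_transition (Ψ := φ) hy (by rwa [K.left_inv hK])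
  have h0 : tulczyjew I z u =
      mvfderiv (cotModel I) (cotMom I K.toPartialEquiv) z.proj z.2
          (mvfderiv I.tangent (tanPos I K.toPartialEquiv) (tangentProj I z) u)
        + cotMom I K.toPartialEquiv z.proj
          (mvfderiv I.tangent (tanVel I K.toPartialEquiv) (tangentProj I z) u) := rfl
  have h1 := tangent_d_transition (Χ := K) (Ψ := φ) (z := tangentProj I z) hK hz u
  have h2 : (K.tangent (tangentProj I z)).2 = (K.cotangent.d z.proj z.2).1 :=
    congrArg Prod.snd (tangent_tangentProj (φ := K) hK)
  have h3 : (tangentProj I z).proj = z.proj.proj := rfl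
  rw [h0, mvfderiv_cotMom K hK, mvfderiv_tanPos K (z := tangentProj I z) hK,
    mvfderiv_tanVel K (z := tangentProj I z) hK,
    cotangent_d_transition (φ := K) (ψ := φ) hK hz, h1, cotMom_transition K hK hz, h2,
    h3, fderiv_fderiv_comm hg (K.tangent.d (tangentProj I z) u).1]
  simp only [ContinuousLinearMap.comp_apply, map_add]
  rw [show (φ.cotangent.tangent z).2.2 = (φ.cotangent.d z.proj z.2).2 from rfl,
    show (φ.cotangent.tangent z).1.2 = cotMom I φ.toPartialEquiv z.proj from rfl]
  ring

end CotangentCharts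

end SmoothChart

end Lifts

/-! ### Splitting of the model space into time and space -/

section Splitting

variable {n : ℕ}

/-- The time coordinate on `ℝ^{n+1}`. -/
def time (n : ℕ) : EuclideanSpace ℝ (Fin (n + 1)) →L[ℝ] ℝ := EuclideanSpace.proj 0

/-- The space coordinates on `ℝ^{n+1}`. -/
def space (n : ℕ) : EuclideanSpace ℝ (Fin (n + 1)) →L[ℝ] (Fin n → ℝ) :=
  ContinuousLinearMap.pi fun k => EuclideanSpace.proj k.succ

/-- The inclusion `w ↦ (0, w)` of `ℝ^n` in `ℝ^{n+1}`. -/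
def vert (n : ℕ) : (Fin n → ℝ) →L[ℝ] EuclideanSpace ℝ (Fin (n + 1)) :=
  ∑ k : Fin n, (ContinuousLinearMap.proj k : (Fin n → ℝ) →L[ℝ] ℝ).smulRight
    (EuclideanSpace.single k.succ (1 : ℝ))

/-- The unit vector in the time direction. -/
def timeUnit (n : ℕ) : EuclideanSpace ℝ (Fin (n + 1)) := EuclideanSpace.single 0 1

lemma time_apply (y : EuclideanSpace ℝ (Fin (n + 1))) : time n y = y 0 := rfl

lemma space_apply (y : EuclideanSpace ℝ (Fin (n + 1))) (k : Fin n) : space n y k = y k.succ := rfl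

lemma vert_zero (w : Fin n → ℝ) : vert n w 0 = 0 := by
  simp [vert, Ne.symm (Fin.succ_ne_zero _)]

lemma vert_succ (w : Fin n → ℝ) (k : Fin n) : vert n w k.succ = w k := by
  simp [vert, Finset.sum_apply, Pi.single_apply]

@[simp] lemma time_vert (w : Fin n → ℝ) : time n (vert n w) = 0 := vert_zero w

@[simp] lemma space_vert (w : Fin n → ℝ) : space n (vert n w) = w := funext (vert_succ w)

@[simp] lemma time_timeUnit : time n (timeUnit n) = 1 := by simp [time_apply, timeUnit]

@[simp] lemma space_timeUnit : space n (timeUnit n) = 0 := by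
  funext k
  simp [space_apply, timeUnit]

lemma ext_time_space {x y : EuclideanSpace ℝ (Fin (n + 1))} (h0 : time n x = time n y)
    (h1 : space n x = space n y) : x = y := by
  ext k
  refine Fin.cases h0 (fun k => congrFun h1 k) k

/-- The decomposition of a vector into its time and space parts. -/
lemma time_add_space (x : EuclideanSpace ℝ (Fin (n + 1))) :
    time n x • timeUnit n + vert n (space n x) = x :=
  ext_time_space (by simp) (by simp)

lemma vert_space {x : EuclideanSpace ℝ (Fin (n + 1))} (hx : time n x = 0) :
    vert n (space n x) = x :=
  ext_time_space (by simp [hx]) (by simp)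

lemma toLp_cons_one (w : Fin n → ℝ) :
    (WithLp.toLp 2 (Fin.cons 1 w : Fin (n + 1) → ℝ) : EuclideanSpace ℝ (Fin (n + 1)))
      = timeUnit n + vert n w := by
  refine ext_time_space ?_ ?_
  · simp [time_apply, vert_zero, timeUnit]
  · funext k
    simp [space_apply, vert_succ, timeUnit]

lemma vert_single (i : Fin n) : vert n (Pi.single i 1) = EuclideanSpace.single i.succ (1 : ℝ) := by
  refine ext_time_space ?_ ?_
  · simp [time_apply, vert_zero, Ne.symm (Fin.succ_ne_zero _)]
  · funext k
    simp [space_apply, vert_succ, Pi.single_apply]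

/-- Each nonzero linear function on `ℝ^{n+1}` is the time coordinate of a linear isomorphism. -/
lemma exists_equiv_time_eq {ℓ : EuclideanSpace ℝ (Fin (n + 1)) →L[ℝ] ℝ} (hℓ : ℓ ≠ 0) :
    ∃ A : EuclideanSpace ℝ (Fin (n + 1)) ≃L[ℝ] EuclideanSpace ℝ (Fin (n + 1)),
      ∀ a, time n (A a) = ℓ a := by
  have hℓ' : ℓ.toLinearMap ≠ 0 := fun h => hℓ (ContinuousLinearMap.coe_injective h)
  have hdim := Module.Dual.finrank_ker_add_one_of_ne_zero (f := ℓ.toLinearMap) hℓ'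
  have hk : Module.finrank ℝ (LinearMap.ker ℓ.toLinearMap) = Module.finrank ℝ (Fin n → ℝ) := by
    rw [finrank_euclideanSpace_fin] at hdim
    rw [Module.finrank_fin_fun]
    omega
  let κ := LinearEquiv.ofFinrankEq _ _ hk
  obtain ⟨ρ, hρ⟩ := κ.toLinearMap.exists_extend
  let A₀ : EuclideanSpace ℝ (Fin (n + 1)) →ₗ[ℝ] EuclideanSpace ℝ (Fin (n + 1)) :=
    (ℓ.toLinearMap.smulRight (timeUnit n)) + (vert n).toLinearMap ∘ₗ ρ
  have hA₀ : ∀ a, A₀ a = ℓ a • timeUnit n + vert n (ρ a) := fun a => rfl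
  have ht : ∀ a, time n (A₀ a) = ℓ a := fun a => by simp [hA₀]
  have hinj : Function.Injective A₀ := by
    rw [injective_iff_map_eq_zero]
    intro a ha
    have h1 : ℓ a = 0 := by rw [← ht, ha, map_zero]
    have h2 : ρ a = 0 := by
      have h3 : space n (A₀ a) = ρ a := by simp [hA₀]
      rw [← h3, ha, map_zero]
    have h4 : κ ⟨a, h1⟩ = 0 := (LinearMap.congr_fun hρ ⟨a, h1⟩).symm.trans h2
    have h5 := (LinearEquiv.map_eq_zero_iff κ).1 h4
    exact congrArg Subtype.val h5
  exact ⟨(LinearEquiv.ofInjectiveEndo A₀ hinj).toContinuousLinearEquiv, ht⟩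

end Splitting

/-! ### Adapted charts -/

section Adapted

variable {n : ℕ} {M : Type*} [TopologicalSpace M]
  [ChartedSpace (EuclideanSpace ℝ (Fin (n + 1))) M] [IsManifold (𝓡 (n + 1)) ∞ M]
  {π : M → ℝ}

/-- By the inverse function theorem, there are adapted charts around each point. -/
theorem IsFibration.exists_isAdaptedChart (hπ : IsFibration (𝓡 (n + 1)) π) (x : M) :
    ∃ φ : OpenPartialHomeomorph M (EuclideanSpace ℝ (Fin (n + 1))),
      IsAdaptedChart π φ ∧ x ∈ φ.source := by
  set K := chartAt (EuclideanSpace ℝ (Fin (n + 1))) x with hK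
  have hKm : K ∈ IsManifold.maximalAtlas (𝓡 (n + 1)) ∞ M := IsManifold.chart_mem_maximalAtlas x
  set Χ := SmoothChart.ofMaximalAtlas hKm
  have hx : x ∈ Χ.source := mem_chart_source _ x
  have hy : Χ x ∈ Χ.target := Χ.map_source hx
  let f : EuclideanSpace ℝ (Fin (n + 1)) → ℝ := fun y => π (Χ.symm y)
  have hf : ∀ y ∈ Χ.target, ContDiffAt ℝ ∞ f y := fun y hy =>
    (hπ.smooth.contMDiffAt.comp y (SmoothChart.contMDiffAt_symm hy)).contDiffAt
  have hπd : mvfderiv (𝓡 (n + 1)) π x = fderiv ℝ f (Χ x) ∘L Χ.d x :=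
    SmoothChart.mvfderiv_of_factor' hx
      ((SmoothChart.eventually_left_inv hx).mono fun x' hx' => by simp only [f, hx'])
      ((hf _ hy).differentiableAt (by simp)).hasFDerivAt
  have hℓ : fderiv ℝ f (Χ x) ≠ 0 := by
    intro h
    refine hπ.submersion x ?_
    rw [hπd, h, ContinuousLinearMap.zero_comp]
  obtain ⟨A, hA⟩ := exists_equiv_time_eq hℓ
  -- `T` has the time component `f`, and its derivative at the given point is `A`.
  let T : EuclideanSpace ℝ (Fin (n + 1)) → EuclideanSpace ℝ (Fin (n + 1)) :=
    fun y => A y + (f y - time n (A y)) • timeUnit n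
  have hT : ∀ y ∈ Χ.target, ContDiffAt ℝ ∞ T y := fun y hy =>
    A.contDiff.contDiffAt.add (((hf y hy).sub
      ((time n).contDiff.contDiffAt.comp y A.contDiff.contDiffAt)).smul contDiffAt_const)
  have hT0 : ∀ y, time n (T y) = f y := fun y => by simp [T]
  have hT' : HasFDerivAt T (A : EuclideanSpace ℝ (Fin (n + 1)) →L[ℝ] _) (Χ x) := by
    have h1 := ((hf _ hy).differentiableAt (by simp)).hasFDerivAt
    have h2 := A.toContinuousLinearMap.hasFDerivAt (x := Χ x)
    have h3 := (time n).hasFDerivAt.comp (Χ x) h2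
    refine (h2.add ((h1.sub h3).smul_const (timeUnit n))).congr_fderiv ?_
    refine ContinuousLinearMap.ext fun a => ?_
    simp [hA]
  let e := (hT _ hy).toOpenPartialHomeomorph T hT' (by simp)
  have he : ∀ p, e p = T p := fun p => rfl
  have hes : Χ x ∈ e.source := (hT _ hy).mem_toOpenPartialHomeomorph_source hT' (by simp)
  -- The part of the domain where the derivative of `T` is invertible.
  let s : Set (EuclideanSpace ℝ (Fin (n + 1))) := Χ.target ∩ fderiv ℝ T ⁻¹'
    Set.range ((↑) : (EuclideanSpace ℝ (Fin (n + 1)) ≃L[ℝ] EuclideanSpace ℝ (Fin (n + 1))) →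
      EuclideanSpace ℝ (Fin (n + 1)) →L[ℝ] EuclideanSpace ℝ (Fin (n + 1)))
  have hso : IsOpen s := by
    refine ContinuousOn.isOpen_inter_preimage (fun y hy => ?_) Χ.open_target
      ContinuousLinearEquiv.isOpen
    exact ((hT y hy).fderiv_right (m := 0) (by simp)).continuousAt.continuousWithinAt
  have hxs : Χ x ∈ s := ⟨hy, A, hT'.fderiv.symm⟩
  let φ := K.trans (e.restr s)
  have hφs : ∀ y ∈ φ.source, y ∈ K.source ∧ K y ∈ e.source ∧ K y ∈ s := by
    intro y hy
    have h1 : y ∈ K.source ∧ K y ∈ (e.restr s).source := by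
      simpa [φ, OpenPartialHomeomorph.trans_source] using hy
    rw [OpenPartialHomeomorph.restr_source, hso.interior_eq] at h1
    exact ⟨h1.1, h1.2.1, h1.2.2⟩
  refine ⟨φ, ⟨?_, fun y hy => ?_⟩, ?_⟩
  · refine OpenPartialHomeomorph.mem_maximalAtlas_of_contMDiffOn φ (fun y hy => ?_) fun y hy => ?_
    · obtain ⟨h1, -, h3⟩ := hφs y hy
      exact ((hT _ h3.1).contMDiffAt.comp y
        (SmoothChart.contMDiffAt (Χ := Χ) h1)).contMDiffWithinAt
    · obtain ⟨h1, h2, h3⟩ := hφs _ (φ.map_target hy)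
      have hKy : K (φ.symm y) = e.symm y := by
        have h4 : φ.symm y = K.symm (e.symm y) := rfl
        have h5 : y ∈ (e.restr s).target ∧ (e.restr s).symm y ∈ K.target := by
          simpa [φ, OpenPartialHomeomorph.trans_target] using hy
        rw [h4]
        exact K.right_inv h5.2
      have hyt : y ∈ e.target := by
        have h5 : y ∈ (e.restr s).target ∧ (e.restr s).symm y ∈ K.target := by
          simpa [φ, OpenPartialHomeomorph.trans_target] using hy
        have h6 := h5.1
        rw [OpenPartialHomeomorph.restr_target] at h6
        exact h6.1
      rw [hKy] at h2 h3
      obtain ⟨A', hA'⟩ := h3.2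
      have h7 : ContDiffAt ℝ ∞ e.symm y := by
        refine e.contDiffAt_symm (f₀' := A') hyt ?_ (hT _ h3.1)
        rw [hA']
        exact ((hT _ h3.1).differentiableAt (by simp)).hasFDerivAt
      exact ((SmoothChart.contMDiffAt_symm (Χ := Χ) h3.1).comp y
        h7.contMDiffAt).contMDiffWithinAt
  · obtain ⟨h1, -, -⟩ := hφs y hy
    have h2 : φ y 0 = f (K y) := hT0 (K y)
    rw [h2]
    exact congrArg π (K.left_inv h1)
  · have h1 : x ∈ K.source ∧ K x ∈ (e.restr s).source := by
      rw [OpenPartialHomeomorph.restr_source, hso.interior_eq]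
      exact ⟨hx, hes, hxs⟩
    simpa [φ, OpenPartialHomeomorph.trans_source] using h1

end Adapted

/-! ### Jet manifolds in adapted charts -/

section JetCharts

variable {n : ℕ} {M : Type*} [TopologicalSpace M]
  [ChartedSpace (EuclideanSpace ℝ (Fin (n + 1))) M]
  {π : M → ℝ} {φ : OpenPartialHomeomorph M (EuclideanSpace ℝ (Fin (n + 1)))}

/-- The values of the charts of `T(T^*M)` that are induced by charts of `M`. -/
abbrev TTCot (n : ℕ) : Type :=
  (EuclideanSpace ℝ (Fin (n + 1)) × (EuclideanSpace ℝ (Fin (n + 1)) →L[ℝ] ℝ)) ×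
    (EuclideanSpace ℝ (Fin (n + 1)) × (EuclideanSpace ℝ (Fin (n + 1)) →L[ℝ] ℝ))

/-- The coordinate `ṫ` on `TM`. -/
def velTime (n : ℕ) : EuclideanSpace ℝ (Fin (n + 1)) × EuclideanSpace ℝ (Fin (n + 1)) →L[ℝ] ℝ :=
  time n ∘L ContinuousLinearMap.snd ℝ _ _

/-- The coordinate `ṫ` on `T(T^*M)`. -/
def velTimeCot (n : ℕ) : TTCot n →L[ℝ] ℝ :=
  time n ∘L ContinuousLinearMap.fst ℝ _ _ ∘L ContinuousLinearMap.snd ℝ _ _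

lemma velTime_apply (p : EuclideanSpace ℝ (Fin (n + 1)) × EuclideanSpace ℝ (Fin (n + 1))) :
    velTime n p = time n p.2 := rfl

lemma velTimeCot_apply (p : TTCot n) : velTimeCot n p = time n p.2.1 := rfl

namespace IsAdaptedChart

/-- The smooth chart given by an adapted chart. -/
def chart (hφ : IsAdaptedChart π φ) :
    SmoothChart (𝓡 (n + 1)) M (EuclideanSpace ℝ (Fin (n + 1))) :=
  SmoothChart.ofMaximalAtlas hφ.1

variable (hφ : IsAdaptedChart π φ)

lemma mvfderiv_apply {x : M} (hx : x ∈ φ.source) (u : TangentSpace (𝓡 (n + 1)) x) :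
    mvfderiv (𝓡 (n + 1)) π x u = time n (hφ.chart.d x u) :=
  SmoothChart.mvfderiv_of_factor (Χ := hφ.chart) (h := time n) hx
    (Filter.eventually_of_mem (SmoothChart.source_mem_nhds (Χ := hφ.chart) hx)
      fun x' hx' => (hφ.2 x' hx').symm) (time n).hasFDerivAt u

variable [IsManifold (𝓡 (n + 1)) ∞ M]

lemma mem_J1 {v : TangentBundle (𝓡 (n + 1)) M} (hv : v.proj ∈ φ.source) :
    v ∈ J1 (𝓡 (n + 1)) π ↔ time n (hφ.chart.tangent v).2 = 1 := by
  rw [J1, Set.mem_ofPred_eq, hφ.mvfderiv_apply hv]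
  rfl

lemma definesSubmanifoldOn_J1 :
    DefinesSubmanifoldOn (𝓡 (n + 1)).tangent
      (fun v => velTime n (hφ.chart.tangent v) - 1) hφ.chart.tangent.source
      (J1 (𝓡 (n + 1)) π) := by
  refine hφ.chart.tangent.definesSubmanifoldOn (h := fun p => velTime n p - 1)
    (fun _ _ => rfl) (fun p _ => ?_) (fun v hv => ?_) fun v hv _ => ?_
  · exact (velTime n).contDiff.contDiffAt.sub contDiffAt_const
  · rw [hφ.mem_J1 hv, sub_eq_zero, velTime_apply]
  · rw [((velTime n).hasFDerivAt.sub_const 1).fderiv]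
    exact fun r => ⟨(0, r • timeUnit n), by simp [velTime_apply]⟩

/-- The tangent vectors of the jet manifold are those with `δṫ = 0`. -/
lemma mem_tangentSpaceOf_J1 {v : TangentBundle (𝓡 (n + 1)) M} (hv : v.proj ∈ φ.source)
    (hv1 : v ∈ J1 (𝓡 (n + 1)) π) (u : TangentSpace (𝓡 (n + 1)).tangent v) :
    u ∈ tangentSpaceOf (𝓡 (n + 1)).tangent (J1 (𝓡 (n + 1)) π) v ↔
      time n (hφ.chart.tangent.d v u).2 = 0 := by
  rw [mem_tangentSpaceOf_iff hφ.definesSubmanifoldOn_J1 hv hv1]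
  have h := SmoothChart.mvfderiv_of_factor (Χ := hφ.chart.tangent) (x := v)
    (f := fun v => velTime n (hφ.chart.tangent v) - 1) (h := fun p => velTime n p - 1) hv
    (Filter.Eventually.of_forall fun _ => rfl) ((velTime n).hasFDerivAt.sub_const 1) u
  exact Iff.of_eq (congrArg (· = 0) h)

/-- The chart of `T(T^*M)` induced by an adapted chart. -/
def tcot : SmoothChart (cotModel (𝓡 (n + 1))).tangent
    (TangentBundle (cotModel (𝓡 (n + 1))) (CotangentBundle (𝓡 (n + 1)) M))
    (TTCot n) :=
  hφ.chart.cotangent.tangent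

include hφ

lemma mem_tcot_source
    {z : TangentBundle (cotModel (𝓡 (n + 1))) (CotangentBundle (𝓡 (n + 1)) M)} :
    z ∈ hφ.tcot.source ↔ z.proj.proj ∈ φ.source := by
  rw [tcot, SmoothChart.mem_tangent_source, SmoothChart.mem_cotangent_source]
  rfl

lemma mvfderiv_cotFibration {α : CotangentBundle (𝓡 (n + 1)) M} (hα : α.proj ∈ φ.source)
    (u : TangentSpace (cotModel (𝓡 (n + 1))) α) :
    mvfderiv (cotModel (𝓡 (n + 1))) (cotFibration (𝓡 (n + 1)) π) α u
      = time n (hφ.chart.cotangent.d α u).1 := by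
  refine SmoothChart.mvfderiv_of_factor (Χ := hφ.chart.cotangent) (x := α)
    (h := fun p => time n p.1) hα
    (Filter.eventually_of_mem (SmoothChart.source_mem_nhds (Χ := hφ.chart.cotangent) hα)
      fun β hβ => (hφ.2 β.proj hβ).symm)
    ((time n ∘L ContinuousLinearMap.fst ℝ (EuclideanSpace ℝ (Fin (n + 1)))
      (EuclideanSpace ℝ (Fin (n + 1)) →L[ℝ] ℝ)).hasFDerivAt) u

lemma mem_J1Cot {z : TangentBundle (cotModel (𝓡 (n + 1))) (CotangentBundle (𝓡 (n + 1)) M)}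
    (hz : z.proj.proj ∈ φ.source) :
    z ∈ J1Cot (𝓡 (n + 1)) π ↔ time n (hφ.tcot z).2.1 = 1 := by
  rw [J1Cot, J1, Set.mem_ofPred_eq, hφ.mvfderiv_cotFibration hz]
  rfl

lemma tangentProj_mem_J1
    {z : TangentBundle (cotModel (𝓡 (n + 1))) (CotangentBundle (𝓡 (n + 1)) M)}
    (hz : z.proj.proj ∈ φ.source) :
    tangentProj (𝓡 (n + 1)) z ∈ J1 (𝓡 (n + 1)) π ↔ z ∈ J1Cot (𝓡 (n + 1)) π := by
  rw [hφ.mem_J1 (v := tangentProj (𝓡 (n + 1)) z) hz, hφ.mem_J1Cot hz,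
    SmoothChart.tangent_tangentProj (φ := hφ.chart) hz]
  rfl

lemma definesSubmanifoldOn_J1Cot :
    DefinesSubmanifoldOn (cotModel (𝓡 (n + 1))).tangent
      (fun z => velTimeCot n (hφ.tcot z) - 1) hφ.tcot.source (J1Cot (𝓡 (n + 1)) π) := by
  refine hφ.tcot.definesSubmanifoldOn (h := fun p => velTimeCot n p - 1)
    (fun _ _ => rfl) (fun p _ => ?_) (fun v hv => ?_) fun v hv _ => ?_
  · exact (velTimeCot n).contDiff.contDiffAt.sub contDiffAt_const
  · rw [hφ.mem_J1Cot hv, sub_eq_zero, velTimeCot_apply]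
  · rw [((velTimeCot n).hasFDerivAt.sub_const 1).fderiv]
    exact fun r => ⟨(0, (r • timeUnit n, 0)), by simp [velTimeCot_apply]⟩

lemma mem_tangentSpaceOf_J1Cot
    {z : TangentBundle (cotModel (𝓡 (n + 1))) (CotangentBundle (𝓡 (n + 1)) M)}
    (hz : z.proj.proj ∈ φ.source) (hz1 : z ∈ J1Cot (𝓡 (n + 1)) π)
    (u : TangentSpace (cotModel (𝓡 (n + 1))).tangent z) :
    u ∈ tangentSpaceOf (cotModel (𝓡 (n + 1))).tangent (J1Cot (𝓡 (n + 1)) π) z ↔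
      time n (hφ.tcot.d z u).2.1 = 0 := by
  rw [mem_tangentSpaceOf_iff hφ.definesSubmanifoldOn_J1Cot (hφ.mem_tcot_source.2 hz) hz1]
  have h := SmoothChart.mvfderiv_of_factor (Χ := hφ.tcot) (x := z)
    (f := fun v => velTimeCot n (hφ.tcot v) - 1) (h := fun p => velTimeCot n p - 1)
    (hφ.mem_tcot_source.2 hz)
    (Filter.Eventually.of_forall fun _ => rfl) ((velTimeCot n).hasFDerivAt.sub_const 1) u
  exact Iff.of_eq (congrArg (· = 0) h)

end IsAdaptedChart

end JetCharts

/-! ### The Lagrangian function in an adapted chart -/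

section LocalLagrangian

variable {n : ℕ} {M : Type*} [TopologicalSpace M]
  [ChartedSpace (EuclideanSpace ℝ (Fin (n + 1))) M] [IsManifold (𝓡 (n + 1)) ∞ M]
  {π : M → ℝ} {φ : OpenPartialHomeomorph M (EuclideanSpace ℝ (Fin (n + 1)))}
  {L : TangentBundle (𝓡 (n + 1)) M → ℝ}

/-- The Lagrangian function in a chart, as a function of `((t, q), q̇)`. -/
def lag (φ : OpenPartialHomeomorph M (EuclideanSpace ℝ (Fin (n + 1))))
    (L : TangentBundle (𝓡 (n + 1)) M → ℝ) (p : EuclideanSpace ℝ (Fin (n + 1)) × (Fin n → ℝ)) : ℝ :=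
  localLagrangian φ L p.1 p.2

/-- The base point and the space part of the velocity, the coordinates of a jet. -/
def jetCoord (n : ℕ) : EuclideanSpace ℝ (Fin (n + 1)) × EuclideanSpace ℝ (Fin (n + 1)) →L[ℝ]
    EuclideanSpace ℝ (Fin (n + 1)) × (Fin n → ℝ) :=
  (ContinuousLinearMap.id ℝ _).prodMap (space n)

lemma jetCoord_apply (p : EuclideanSpace ℝ (Fin (n + 1)) × EuclideanSpace ℝ (Fin (n + 1))) :
    jetCoord n p = (p.1, space n p.2) := rfl

namespace IsAdaptedChart

variable (hφ : IsAdaptedChart π φ)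
include hφ

lemma lag_apply (p : EuclideanSpace ℝ (Fin (n + 1)) × (Fin n → ℝ)) :
    lag φ L p = L (hφ.chart.tangent.symm (p.1, timeUnit n + vert n p.2)) := by
  rw [← toLp_cons_one]
  rfl

lemma lag_tangent {v : TangentBundle (𝓡 (n + 1)) M} (hv : v.proj ∈ φ.source)
    (hv1 : v ∈ J1 (𝓡 (n + 1)) π) : lag φ L (jetCoord n (hφ.chart.tangent v)) = L v := by
  rw [hφ.lag_apply, jetCoord_apply]
  have h := time_add_space (hφ.chart.tangent v).2
  rw [(hφ.mem_J1 hv).1 hv1, one_smul] at h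
  simp only [h]
  exact congrArg L (hφ.chart.tangent.left_inv (x := v) hv)

lemma contDiffAt_lag (hL : ContMDiffOn (𝓡 (n + 1)).tangent 𝓘(ℝ, ℝ) ∞ L (J1 (𝓡 (n + 1)) π))
    {p : EuclideanSpace ℝ (Fin (n + 1)) × (Fin n → ℝ)} (hp : p.1 ∈ φ.target) :
    ContDiffAt ℝ ∞ (lag φ L) p := by
  let i : EuclideanSpace ℝ (Fin (n + 1)) × (Fin n → ℝ) →
      EuclideanSpace ℝ (Fin (n + 1)) × EuclideanSpace ℝ (Fin (n + 1)) :=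
    fun p => (p.1, timeUnit n + vert n p.2)
  have hi : ContDiff ℝ ∞ i := contDiff_fst.prodMk
    (contDiff_const.add ((vert n).contDiff.comp contDiff_snd))
  have hT : IsOpen {p : EuclideanSpace ℝ (Fin (n + 1)) × (Fin n → ℝ) | p.1 ∈ φ.target} :=
    φ.open_target.preimage continuous_fst
  have h1 : ContMDiffOn 𝓘(ℝ, EuclideanSpace ℝ (Fin (n + 1)) × (Fin n → ℝ))
      (𝓡 (n + 1)).tangent ∞ (fun p => hφ.chart.tangent.symm (i p))
      {p : EuclideanSpace ℝ (Fin (n + 1)) × (Fin n → ℝ) | p.1 ∈ φ.target} :=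
    hφ.chart.tangent.smooth_symm.comp hi.contMDiff.contMDiffOn (fun q hq => hq)
  have h2 := hL.comp h1 fun q hq => by
    have h3 : i q ∈ hφ.chart.tangent.target := hq
    refine (hφ.mem_J1 (hφ.chart.tangent.map_target h3)).2 ?_
    have h4 : hφ.chart.tangent (hφ.chart.tangent.symm (i q)) = i q :=
      hφ.chart.tangent.right_inv h3
    rw [h4]
    simp [i]
  have h5 : lag φ L = L ∘ fun p => hφ.chart.tangent.symm (i p) := funext fun q => hφ.lag_apply q
  rw [h5]
  exact (h2.contMDiffAt (hT.mem_nhds hp)).contDiffAt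

lemma hasFDerivAt_lag
    (hL : ContMDiffOn (𝓡 (n + 1)).tangent 𝓘(ℝ, ℝ) ∞ L (J1 (𝓡 (n + 1)) π))
    {p : EuclideanSpace ℝ (Fin (n + 1)) × (Fin n → ℝ)} (hp : p.1 ∈ φ.target) :
    HasFDerivAt (lag φ L) (fderiv ℝ (lag φ L) p) p :=
  ((hφ.contDiffAt_lag hL hp).differentiableAt (by simp)).hasFDerivAt

lemma dLdv_eq (hL : ContMDiffOn (𝓡 (n + 1)).tangent 𝓘(ℝ, ℝ) ∞ L (J1 (𝓡 (n + 1)) π))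
    {p : EuclideanSpace ℝ (Fin (n + 1)) × (Fin n → ℝ)} (hp : p.1 ∈ φ.target) (i : Fin n) :
    dLdv φ L i p.1 p.2 = fderiv ℝ (lag φ L) p (0, Pi.single i 1) := by
  have h1 : HasFDerivAt (fun w' => localLagrangian φ L p.1 w') _ p.2 :=
    HasFDerivAt.comp (g := lag φ L) p.2 (hφ.hasFDerivAt_lag hL hp) (hasFDerivAt_prodMk_right _ _)
  rw [dLdv, h1.differentiableAt.lineDeriv_eq_fderiv, h1.fderiv]
  rfl

lemma dLdx_eq (hL : ContMDiffOn (𝓡 (n + 1)).tangent 𝓘(ℝ, ℝ) ∞ L (J1 (𝓡 (n + 1)) π))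
    {p : EuclideanSpace ℝ (Fin (n + 1)) × (Fin n → ℝ)} (hp : p.1 ∈ φ.target)
    (j : Fin (n + 1)) :
    dLdx φ L j p.1 p.2 = fderiv ℝ (lag φ L) p (EuclideanSpace.single j 1, 0) := by
  have h1 : HasFDerivAt (fun y' => localLagrangian φ L y' p.2) _ p.1 :=
    HasFDerivAt.comp (g := lag φ L) p.1 (hφ.hasFDerivAt_lag hL hp) (hasFDerivAt_prodMk_left _ _)
  rw [dLdx, h1.differentiableAt.lineDeriv_eq_fderiv, h1.fderiv]
  rfl

end IsAdaptedChart

/-- The chain rule along a curve in `C`, for a function that is differentiable within `C`. -/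
lemma hasDerivAt_comp_jet_within {E : Type*} [NormedAddCommGroup E] [NormedSpace ℝ E]
    {H : Type*} [TopologicalSpace H] {I : ModelWithCorners ℝ E H} {N : Type*}
    [TopologicalSpace N] [ChartedSpace H N] {f : N → ℝ} {C : Set N} {c : ℝ → N} {t : ℝ}
    (hf : MDifferentiableWithinAt I 𝓘(ℝ, ℝ) f C (c t))
    (hc : MDifferentiableAt 𝓘(ℝ, ℝ) I c t) (hC : ∀ᶠ s in 𝓝 t, c s ∈ C) :
    HasDerivAt (fun s => f (c s))
      (mvfderivWithin I f C (jet I c t).proj (jet I c t).2) t := by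
  have h := (HasMFDerivWithinAt.comp t hf.hasMFDerivWithinAt
    (hc.hasMFDerivAt.hasMFDerivWithinAt (s := c ⁻¹' C)) subset_rfl).hasMFDerivAt hC
  have h' : HasFDerivAt (fun s => f (c s))
      ((mvfderivWithin I f C (c t)).comp (mfderiv 𝓘(ℝ, ℝ) I c t) : ℝ →L[ℝ] ℝ) t :=
    h.hasFDerivAt
  exact h'.hasDerivAt

namespace IsAdaptedChart

variable (hφ : IsAdaptedChart π φ)
include hφ

/-- The differential of the Lagrangian function in an adapted chart. It suffices to evaluate it on
the velocities of curves in the jet manifold. -/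
lemma mvfderivWithin_J1
    (hL : ContMDiffOn (𝓡 (n + 1)).tangent 𝓘(ℝ, ℝ) ∞ L (J1 (𝓡 (n + 1)) π))
    {v : TangentBundle (𝓡 (n + 1)) M} (hv : v.proj ∈ φ.source) (hv1 : v ∈ J1 (𝓡 (n + 1)) π)
    {u : TangentSpace (𝓡 (n + 1)).tangent v}
    (hu : u ∈ tangentSpaceOf (𝓡 (n + 1)).tangent (J1 (𝓡 (n + 1)) π) v) :
    mvfderivWithin (𝓡 (n + 1)).tangent L (J1 (𝓡 (n + 1)) π) v u =
      fderiv ℝ (lag φ L) (jetCoord n (hφ.chart.tangent v))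
        (jetCoord n (hφ.chart.tangent.d v u)) := by
  have key : Set.EqOn (mvfderivWithin (𝓡 (n + 1)).tangent L (J1 (𝓡 (n + 1)) π) v).toLinearMap
      (fderiv ℝ (lag φ L) (jetCoord n (hφ.chart.tangent v)) ∘L
        (jetCoord n ∘L hφ.chart.tangent.d v)).toLinearMap
      {u | ∃ c : ℝ → TangentBundle (𝓡 (n + 1)) M,
        ContMDiffAt 𝓘(ℝ, ℝ) (𝓡 (n + 1)).tangent ∞ c 0 ∧
        (∀ᶠ s in 𝓝 (0 : ℝ), c s ∈ J1 (𝓡 (n + 1)) π) ∧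
          jet (𝓡 (n + 1)).tangent c 0 = ⟨v, u⟩} := by
    rintro u ⟨c, hc, hcJ, hj⟩
    have h0 : c 0 = v := congrArg Bundle.TotalSpace.proj hj
    have hc' := hc.mdifferentiableAt (n := ∞) (by simp)
    have h1 := hasDerivAt_comp_jet_within (f := L) (C := J1 (𝓡 (n + 1)) π) (c := c) (t := 0)
      ((hL (c 0) (h0 ▸ hv1)).mdifferentiableWithinAt (by simp)) hc' hcJ
    have hsrc : c 0 ∈ hφ.chart.tangent.source := h0 ▸ hv
    have h2 := hasDerivAt_comp_jet (f := hφ.chart.tangent) (c := c) (t := 0)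
      (SmoothChart.mdifferentiableAt hsrc) hc'
    rw [hj] at h1 h2
    have hy : (jetCoord n (hφ.chart.tangent (c 0))).1 ∈ φ.target :=
      hφ.chart.map_source (x := (c 0).proj) hsrc
    have h3 := ((jetCoord n).hasFDerivAt.comp_hasDerivAt (0 : ℝ) h2)
    have h4 := (hφ.hasFDerivAt_lag hL hy).comp_hasDerivAt (0 : ℝ) h3
    have hev : ∀ᶠ s in 𝓝 (0 : ℝ), L (c s) = lag φ L (jetCoord n (hφ.chart.tangent (c s))) := by
      filter_upwards [hcJ, hc.continuousAt.eventually (SmoothChart.source_mem_nhds hsrc)]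
        with s hs hs'
      exact (hφ.lag_tangent hs' hs).symm
    have h5 := h1.unique (h4.congr_of_eventuallyEq hev)
    rw [h0] at h5
    exact h5
  exact LinearMap.eqOn_span key hu

lemma extendedTulczyjew_eq_iff
    (hL : ContMDiffOn (𝓡 (n + 1)).tangent 𝓘(ℝ, ℝ) ∞ L (J1 (𝓡 (n + 1)) π))
    {z : TangentBundle (cotModel (𝓡 (n + 1))) (CotangentBundle (𝓡 (n + 1)) M)}
    (hz : z.proj.proj ∈ φ.source) (hz1 : z ∈ J1Cot (𝓡 (n + 1)) π) :
    extendedTulczyjew (𝓡 (n + 1)) π z =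
        diffOn (𝓡 (n + 1)).tangent (J1 (𝓡 (n + 1)) π) L (tangentProj (𝓡 (n + 1)) z) ↔
      ∀ a b, (hφ.tcot z).2.2 a + (hφ.tcot z).1.2 (vert n b) =
        fderiv ℝ (lag φ L) ((hφ.tcot z).1.1, space n (hφ.tcot z).2.1) (a, b) := by
  have hz' : (tangentProj (𝓡 (n + 1)) z).proj ∈ φ.source := hz
  have hv1 := (hφ.tangentProj_mem_J1 hz).2 hz1
  have hpos : jetCoord n (hφ.chart.tangent (tangentProj (𝓡 (n + 1)) z))
      = ((hφ.tcot z).1.1, space n (hφ.tcot z).2.1) := by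
    rw [SmoothChart.tangent_tangentProj (φ := hφ.chart) hz]
    rfl
  have hleft : extendedTulczyjew (𝓡 (n + 1)) π z =
        diffOn (𝓡 (n + 1)).tangent (J1 (𝓡 (n + 1)) π) L (tangentProj (𝓡 (n + 1)) z) ↔
      ∀ u ∈ tangentSpaceOf (𝓡 (n + 1)).tangent (J1 (𝓡 (n + 1)) π) (tangentProj (𝓡 (n + 1)) z),
        tulczyjew (𝓡 (n + 1)) z u =
          mvfderivWithin (𝓡 (n + 1)).tangent L (J1 (𝓡 (n + 1)) π)
            (tangentProj (𝓡 (n + 1)) z) u := by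
    constructor
    · intro h u hu
      exact LinearMap.congr_fun (eq_of_heq (Sigma.ext_iff.1 h).2) ⟨u, hu⟩
    · exact fun h => Sigma.ext rfl (heq_of_eq (LinearMap.ext fun u => h u.1 u.2))
  rw [hleft]
  constructor
  · intro h a b
    obtain ⟨u, hu⟩ := SmoothChart.d_surjective (Χ := hφ.chart.tangent)
      (x := tangentProj (𝓡 (n + 1)) z) hz' (a, vert n b)
    have huT : u ∈ tangentSpaceOf (𝓡 (n + 1)).tangent (J1 (𝓡 (n + 1)) π)
        (tangentProj (𝓡 (n + 1)) z) :=
      (hφ.mem_tangentSpaceOf_J1 hz' hv1 u).2 (by rw [hu]; simp)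
    have h1 := h u huT
    rw [SmoothChart.tulczyjew_eq (φ := hφ.chart) hz, hφ.mvfderivWithin_J1 hL hz' hv1 huT, hpos,
      hu, jetCoord_apply, space_vert] at h1
    exact h1
  · intro h u huT
    have h1 := h (hφ.chart.tangent.d (tangentProj (𝓡 (n + 1)) z) u).1
      (space n (hφ.chart.tangent.d (tangentProj (𝓡 (n + 1)) z) u).2)
    rw [vert_space ((hφ.mem_tangentSpaceOf_J1 hz' hv1 u).1 huT)] at h1
    have h2 := SmoothChart.tulczyjew_eq (φ := hφ.chart) hz u
    have h3 := hφ.mvfderivWithin_J1 hL hz' hv1 huT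
    rw [hpos] at h3
    exact (h2.trans h1).trans h3.symm

/-- The set `S_L` in an adapted chart. -/
theorem mem_lagrangianSet
    (hL : ContMDiffOn (𝓡 (n + 1)).tangent 𝓘(ℝ, ℝ) ∞ L (J1 (𝓡 (n + 1)) π))
    {z : TangentBundle (cotModel (𝓡 (n + 1))) (CotangentBundle (𝓡 (n + 1)) M)}
    (hz : z.proj.proj ∈ φ.source) :
    z ∈ lagrangianSet (𝓡 (n + 1)) π L ↔
      time n (hφ.tcot z).2.1 = 1 ∧ ∀ a b, (hφ.tcot z).2.2 a + (hφ.tcot z).1.2 (vert n b) =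
        fderiv ℝ (lag φ L) ((hφ.tcot z).1.1, space n (hφ.tcot z).2.1) (a, b) := by
  constructor
  · rintro ⟨hz1, v, hv, h⟩
    have hv' : tangentProj (𝓡 (n + 1)) z = v := congrArg Sigma.fst h
    subst hv'
    exact ⟨(hφ.mem_J1Cot hz).1 hz1, (hφ.extendedTulczyjew_eq_iff hL hz hz1).1 h⟩
  · rintro ⟨h1, h2⟩
    have hz1 := (hφ.mem_J1Cot hz).2 h1
    exact ⟨hz1, _, (hφ.tangentProj_mem_J1 hz).2 hz1,
      (hφ.extendedTulczyjew_eq_iff hL hz hz1).2 h2⟩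

end IsAdaptedChart

end LocalLagrangian

/-! ### Coordinates of covectors on `ℝ^{n+1} × ℝ^n` -/

section DualCoord

variable {n : ℕ}

/-- The coordinates of a covector on the space of the `((t, q), q̇)`, in the order of the local
equations: the components along `q̇^i`, along `t` and along `q^i`. -/
def dualCoord (n : ℕ) : (EuclideanSpace ℝ (Fin (n + 1)) × (Fin n → ℝ) →L[ℝ] ℝ) →L[ℝ]
    (Fin n → ℝ) × ℝ × (Fin n → ℝ) :=
  (ContinuousLinearMap.pi fun i => ContinuousLinearMap.apply ℝ ℝ (0, Pi.single i 1)).prod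
    ((ContinuousLinearMap.apply ℝ ℝ (EuclideanSpace.single 0 1, 0)).prod
      (ContinuousLinearMap.pi fun i =>
        ContinuousLinearMap.apply ℝ ℝ (EuclideanSpace.single i.succ 1, 0)))

lemma dualCoord_apply (l : EuclideanSpace ℝ (Fin (n + 1)) × (Fin n → ℝ) →L[ℝ] ℝ) :
    dualCoord n l = (fun i => l (0, Pi.single i 1), l (EuclideanSpace.single 0 1, 0),
      fun i => l (EuclideanSpace.single i.succ 1, 0)) := rfl

lemma dualCoord_injective : Function.Injective (dualCoord n) := by
  rw [injective_iff_map_eq_zero]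
  intro l hl
  rw [dualCoord_apply] at hl
  have h1 : l ∘L ContinuousLinearMap.inr ℝ _ _ = 0 := by
    refine ContinuousLinearMap.coe_injective (LinearMap.pi_ext' fun i => LinearMap.ext_ring ?_)
    exact congrFun (congrArg Prod.fst hl) i
  have h2 : l ∘L ContinuousLinearMap.inl ℝ _ _ ∘L vert n = 0 := by
    refine ContinuousLinearMap.coe_injective (LinearMap.pi_ext' fun i => LinearMap.ext_ring ?_)
    have h : l (EuclideanSpace.single i.succ 1, 0) = 0 :=
      congrFun (congrArg (fun p => p.2.2) hl) i
    rw [← vert_single] at h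
    simpa using h
  have h3 : l (timeUnit n, 0) = 0 := congrArg (fun p => p.2.1) hl
  refine ContinuousLinearMap.ext fun ⟨x, w⟩ => ?_
  have h4 : (x, w) = time n x • (timeUnit n, (0 : Fin n → ℝ)) + (vert n (space n x), 0)
      + (0, w) := by
    refine Prod.ext ?_ (by simp)
    simp [time_add_space]
  have h5 : l (0, w) = 0 := DFunLike.congr_fun h1 w
  have h6 : l (vert n (space n x), 0) = 0 := DFunLike.congr_fun h2 (space n x)
  rw [h4, map_add, map_add, map_smul, h3, h5, h6]
  simp

lemma dualCoord_surjective : Function.Surjective (dualCoord n) := by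
  rintro ⟨a, b, c⟩
  refine ⟨(∑ i, a i • (ContinuousLinearMap.proj i : (Fin n → ℝ) →L[ℝ] ℝ)).comp
      (ContinuousLinearMap.snd ℝ _ _)
    + (b • time n + ∑ i, c i • (ContinuousLinearMap.proj i : (Fin n → ℝ) →L[ℝ] ℝ).comp
      (space n)).comp (ContinuousLinearMap.fst ℝ _ _), ?_⟩
  rw [dualCoord_apply]
  refine Prod.ext (funext fun i => ?_) (Prod.ext ?_ (funext fun i => ?_))
  · simp [Pi.single_apply]
  · simp [time_apply, space_apply]
  · simp [time_apply, space_apply, Ne.symm (Fin.succ_ne_zero _)]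

/-- The covector `ṗ dx + p dq̇` that is given by the momenta and their derivatives. -/
def momCovector (n : ℕ) :
    TTCot n →L[ℝ] (EuclideanSpace ℝ (Fin (n + 1)) × (Fin n → ℝ) →L[ℝ] ℝ) :=
  ContinuousLinearMap.precomp ℝ (ContinuousLinearMap.fst ℝ _ _) ∘L
      (ContinuousLinearMap.snd ℝ _ _ ∘L ContinuousLinearMap.snd ℝ _ _)
    + ContinuousLinearMap.precomp ℝ (vert n ∘L ContinuousLinearMap.snd ℝ _ _) ∘L
      (ContinuousLinearMap.snd ℝ _ _ ∘L ContinuousLinearMap.fst ℝ _ _)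

lemma momCovector_apply (ξ : TTCot n) (p : EuclideanSpace ℝ (Fin (n + 1)) × (Fin n → ℝ)) :
    momCovector n ξ p = ξ.2.2 p.1 + ξ.1.2 (vert n p.2) := rfl

/-- The base point and the space part of the velocity, as functions on `T(T^*M)`. -/
def jetCoordCot (n : ℕ) : TTCot n →L[ℝ] EuclideanSpace ℝ (Fin (n + 1)) × (Fin n → ℝ) :=
  jetCoord n ∘L (ContinuousLinearMap.fst ℝ _ _).prodMap (ContinuousLinearMap.fst ℝ _ _)

lemma jetCoordCot_apply (ξ : TTCot n) : jetCoordCot n ξ = (ξ.1.1, space n ξ.2.1) := rfl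

end DualCoord

section LocalEquations

variable {n : ℕ} {M : Type*} [TopologicalSpace M]
  [ChartedSpace (EuclideanSpace ℝ (Fin (n + 1))) M]
  {π : M → ℝ} {φ : OpenPartialHomeomorph M (EuclideanSpace ℝ (Fin (n + 1)))}
  {L : TangentBundle (𝓡 (n + 1)) M → ℝ}

/-- The local equations, as a function of the coordinates. -/
def equationsInCoord (φ : OpenPartialHomeomorph M (EuclideanSpace ℝ (Fin (n + 1))))
    (L : TangentBundle (𝓡 (n + 1)) M → ℝ) (ξ : TTCot n) : ℝ × (Fin n → ℝ) × ℝ × (Fin n → ℝ) :=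
  (velTimeCot n ξ - 1,
    dualCoord n (momCovector n ξ - fderiv ℝ (lag φ L) (jetCoordCot n ξ)))

/-- The derivative of the local equations, computed with the second derivative of the Lagrangian
function. -/
def equationsDeriv (φ : OpenPartialHomeomorph M (EuclideanSpace ℝ (Fin (n + 1))))
    (L : TangentBundle (𝓡 (n + 1)) M → ℝ) (ξ : TTCot n) :
    TTCot n →L[ℝ] ℝ × (Fin n → ℝ) × ℝ × (Fin n → ℝ) :=
  (velTimeCot n).prod (dualCoord n ∘L
    (momCovector n - fderiv ℝ (fderiv ℝ (lag φ L)) (jetCoordCot n ξ) ∘L jetCoordCot n))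

/-- The momenta and their derivatives can be prescribed freely. -/
lemma equationsDeriv_surjective (ξ : TTCot n) : Function.Surjective (equationsDeriv φ L ξ) := by
  rintro ⟨s, r⟩
  obtain ⟨l, hl⟩ := dualCoord_surjective r
  let δ : TTCot n := ((0, (l ∘L ContinuousLinearMap.inr ℝ _ _) ∘L space n),
    (s • timeUnit n, l ∘L ContinuousLinearMap.inl ℝ _ _))
  have h1 : velTimeCot n δ = s := by simp [velTimeCot_apply, δ]
  have h2 : jetCoordCot n δ = 0 := by simp [jetCoordCot_apply, δ]
  have h3 : momCovector n δ = l := ContinuousLinearMap.ext fun p => by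
    have h4 : p = (p.1, 0) + (0, p.2) := by simp
    conv_rhs => rw [h4, map_add]
    simp [momCovector_apply, δ]
  refine ⟨δ, Prod.ext h1 ?_⟩
  refine Eq.trans (congrArg (dualCoord n) ?_) hl
  change momCovector n δ -
    fderiv ℝ (fderiv ℝ (lag φ L)) (jetCoordCot n ξ) (jetCoordCot n δ) = l
  rw [h2, h3, map_zero, sub_zero]

lemma equationsDeriv_eq_zero_iff (ξ δ : TTCot n) :
    equationsDeriv φ L ξ δ = 0 ↔ time n δ.2.1 = 0 ∧
      momCovector n δ = fderiv ℝ (fderiv ℝ (lag φ L)) (jetCoordCot n ξ) (jetCoordCot n δ) := by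
  rw [equationsDeriv, ContinuousLinearMap.prod_apply, Prod.mk_eq_zero,
    ContinuousLinearMap.comp_apply, map_eq_zero_iff _ dualCoord_injective, sub_apply, sub_eq_zero,
    velTimeCot_apply, ContinuousLinearMap.comp_apply]

namespace IsAdaptedChart

variable [IsManifold (𝓡 (n + 1)) ∞ M] (hφ : IsAdaptedChart π φ)
include hφ

lemma localEquations_eq (hL : ContMDiffOn (𝓡 (n + 1)).tangent 𝓘(ℝ, ℝ) ∞ L (J1 (𝓡 (n + 1)) π))
    {z : TangentBundle (cotModel (𝓡 (n + 1))) (CotangentBundle (𝓡 (n + 1)) M)}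
    (hz : z.proj.proj ∈ φ.source) :
    localEquations φ L z = equationsInCoord φ L (hφ.tcot z) := by
  have h1 : tanVel (𝓡 (n + 1)) φ.toPartialEquiv (tangentProj (𝓡 (n + 1)) z) = (hφ.tcot z).2.1 :=
    congrArg Prod.snd (SmoothChart.tangent_tangentProj (φ := hφ.chart) hz)
  have h2 : mvfderiv (cotModel (𝓡 (n + 1))) (cotMom (𝓡 (n + 1)) φ.toPartialEquiv) z.proj z.2
      = (hφ.tcot z).2.2 := SmoothChart.mvfderiv_cotMom hφ.chart hz z.2
  have hy : (jetCoordCot n (hφ.tcot z)).1 ∈ φ.target := φ.map_source hz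
  have h3 : ∀ i, dLdv φ L i (φ z.proj.proj) (space n (hφ.tcot z).2.1) = _ :=
    hφ.dLdv_eq hL (p := jetCoordCot n (hφ.tcot z)) hy
  have h4 : ∀ j, dLdx φ L j (φ z.proj.proj) (space n (hφ.tcot z).2.1) = _ :=
    hφ.dLdx_eq hL (p := jetCoordCot n (hφ.tcot z)) hy
  have h5 : localEquations φ L z = ((hφ.tcot z).2.1 0 - 1,
    fun i => (hφ.tcot z).1.2 (EuclideanSpace.single i.succ 1)
      - dLdv φ L i (φ z.proj.proj) (space n (hφ.tcot z).2.1),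
    (hφ.tcot z).2.2 (EuclideanSpace.single 0 1)
      - dLdx φ L 0 (φ z.proj.proj) (space n (hφ.tcot z).2.1),
    fun i => (hφ.tcot z).2.2 (EuclideanSpace.single i.succ 1)
      - dLdx φ L i.succ (φ z.proj.proj) (space n (hφ.tcot z).2.1)) := by
    rw [← h1, ← h2]
    rfl
  rw [h5, equationsInCoord, dualCoord_apply]
  refine Prod.ext rfl (Prod.ext (funext fun i => ?_) (Prod.ext ?_ (funext fun i => ?_)))
  · simp only [h3, sub_apply, momCovector_apply, vert_single, map_zero,
      zero_add]
  · simp only [h4, sub_apply, momCovector_apply, map_zero, add_zero]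
  · simp only [h4, sub_apply, momCovector_apply, map_zero, add_zero]

lemma hasFDerivAt_equationsInCoord
    (hL : ContMDiffOn (𝓡 (n + 1)).tangent 𝓘(ℝ, ℝ) ∞ L (J1 (𝓡 (n + 1)) π)) {ξ : TTCot n}
    (hξ : ξ.1.1 ∈ φ.target) :
    HasFDerivAt (equationsInCoord φ L) (equationsDeriv φ L ξ) ξ := by
  have h1 : HasFDerivAt (fun ξ => fderiv ℝ (lag φ L) (jetCoordCot n ξ)) _ ξ :=
    HasFDerivAt.comp (g := fderiv ℝ (lag φ L)) ξ
      (hasFDerivAt_fderiv (hφ.contDiffAt_lag hL (p := jetCoordCot n ξ) hξ))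
      (jetCoordCot n).hasFDerivAt
  exact ((velTimeCot n).hasFDerivAt.sub_const 1).prodMk
    ((dualCoord n).hasFDerivAt.comp ξ ((momCovector n).hasFDerivAt.sub h1))

lemma contDiffAt_equationsInCoord
    (hL : ContMDiffOn (𝓡 (n + 1)).tangent 𝓘(ℝ, ℝ) ∞ L (J1 (𝓡 (n + 1)) π)) {ξ : TTCot n}
    (hξ : ξ.1.1 ∈ φ.target) : ContDiffAt ℝ ∞ (equationsInCoord φ L) ξ := by
  have h1 : ContDiffAt ℝ ∞ (fun ξ => fderiv ℝ (lag φ L) (jetCoordCot n ξ)) ξ :=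
    ContDiffAt.comp (g := fderiv ℝ (lag φ L)) ξ
      ((hφ.contDiffAt_lag hL (p := jetCoordCot n ξ) hξ).fderiv_right (m := ∞) (by simp))
      (jetCoordCot n).contDiff.contDiffAt
  exact ((velTimeCot n).contDiff.contDiffAt.sub contDiffAt_const).prodMk
    ((dualCoord n).contDiff.contDiffAt.comp ξ ((momCovector n).contDiff.contDiffAt.sub h1))

lemma mem_lagrangianSet_iff_equationsInCoord
    (hL : ContMDiffOn (𝓡 (n + 1)).tangent 𝓘(ℝ, ℝ) ∞ L (J1 (𝓡 (n + 1)) π))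
    {z : TangentBundle (cotModel (𝓡 (n + 1))) (CotangentBundle (𝓡 (n + 1)) M)}
    (hz : z.proj.proj ∈ φ.source) :
    z ∈ lagrangianSet (𝓡 (n + 1)) π L ↔ equationsInCoord φ L (hφ.tcot z) = 0 := by
  rw [hφ.mem_lagrangianSet hL hz, equationsInCoord, Prod.mk_eq_zero, sub_eq_zero,
    map_eq_zero_iff _ dualCoord_injective, sub_eq_zero, velTimeCot_apply]
  refine and_congr_right fun _ => ⟨fun h => ContinuousLinearMap.ext fun p => h p.1 p.2,
    fun h a b => DFunLike.congr_fun h (a, b)⟩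

/-- The local equations define `S_L` as an embedded submanifold. -/
theorem definesSubmanifoldOn_lagrangianSet
    (hL : ContMDiffOn (𝓡 (n + 1)).tangent 𝓘(ℝ, ℝ) ∞ L (J1 (𝓡 (n + 1)) π)) :
    DefinesSubmanifoldOn (cotModel (𝓡 (n + 1))).tangent (localEquations φ L)
      {z | z.proj.proj ∈ φ.source} (lagrangianSet (𝓡 (n + 1)) π L) := by
  have hsrc : hφ.tcot.source = {z | z.proj.proj ∈ φ.source} :=
    Set.ext fun z => hφ.mem_tcot_source
  rw [← hsrc]
  refine hφ.tcot.definesSubmanifoldOn (h := equationsInCoord φ L) (fun z hz => ?_)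
    (fun ξ hξ => ?_) (fun z hz => ?_) fun z hz _ => ?_
  · exact hφ.localEquations_eq hL (hφ.mem_tcot_source.1 hz)
  · exact hφ.contDiffAt_equationsInCoord hL hξ
  · rw [hφ.mem_lagrangianSet_iff_equationsInCoord hL (hφ.mem_tcot_source.1 hz),
      hφ.localEquations_eq hL (hφ.mem_tcot_source.1 hz)]
  · rw [(hφ.hasFDerivAt_equationsInCoord hL (ξ := hφ.tcot z)
      (φ.map_source (hφ.mem_tcot_source.1 hz))).fderiv]
    exact equationsDeriv_surjective _

/-- The tangent vectors of `S_L` are given by the linearized local equations. -/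
lemma mem_tangentSpaceOf_lagrangianSet
    (hL : ContMDiffOn (𝓡 (n + 1)).tangent 𝓘(ℝ, ℝ) ∞ L (J1 (𝓡 (n + 1)) π))
    {z : TangentBundle (cotModel (𝓡 (n + 1))) (CotangentBundle (𝓡 (n + 1)) M)}
    (hz : z.proj.proj ∈ φ.source) (hzL : z ∈ lagrangianSet (𝓡 (n + 1)) π L)
    (u : TangentSpace (cotModel (𝓡 (n + 1))).tangent z) :
    u ∈ tangentSpaceOf (cotModel (𝓡 (n + 1))).tangent (lagrangianSet (𝓡 (n + 1)) π L) z ↔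
      time n (hφ.tcot.d z u).2.1 = 0 ∧
        momCovector n (hφ.tcot.d z u) =
          fderiv ℝ (fderiv ℝ (lag φ L)) (jetCoordCot n (hφ.tcot z))
            (jetCoordCot n (hφ.tcot.d z u)) := by
  have hU : z ∈ {z : TangentBundle (cotModel (𝓡 (n + 1))) (CotangentBundle (𝓡 (n + 1)) M) |
      z.proj.proj ∈ φ.source} := hz
  refine (mem_tangentSpaceOf_iff (hφ.definesSubmanifoldOn_lagrangianSet hL) hU hzL u).trans ?_
  have h := SmoothChart.mvfderiv_of_factor (Χ := hφ.tcot) (x := z)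
    (f := localEquations φ L) (h := equationsInCoord φ L) (hφ.mem_tcot_source.2 hz)
    (Filter.eventually_of_mem (SmoothChart.source_mem_nhds (hφ.mem_tcot_source.2 hz))
      fun z' hz' => hφ.localEquations_eq hL (hφ.mem_tcot_source.1 hz'))
    (hφ.hasFDerivAt_equationsInCoord hL (ξ := hφ.tcot z) (φ.map_source hz)) u
  exact (Iff.of_eq (congrArg (· = 0) h)).trans (equationsDeriv_eq_zero_iff _ _)

end IsAdaptedChart

end LocalEquations

/-! ### The Lagrangian submanifold -/

section Lagrangian

variable {n : ℕ} {M : Type*} [TopologicalSpace M]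
  [ChartedSpace (EuclideanSpace ℝ (Fin (n + 1))) M] [IsManifold (𝓡 (n + 1)) ∞ M]
  {π : M → ℝ} {φ : OpenPartialHomeomorph M (EuclideanSpace ℝ (Fin (n + 1)))}
  {L : TangentBundle (𝓡 (n + 1)) M → ℝ}

lemma finrank_TTCot : Module.finrank ℝ (TTCot n) = 4 * n + 4 := by
  have h : Module.finrank ℝ (EuclideanSpace ℝ (Fin (n + 1)) →L[ℝ] ℝ) = n + 1 := by
    have e : (EuclideanSpace ℝ (Fin (n + 1)) →ₗ[ℝ] ℝ) ≃ₗ[ℝ]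
      (EuclideanSpace ℝ (Fin (n + 1)) →L[ℝ] ℝ) := LinearMap.toContinuousLinearMap
    rw [← e.finrank_eq, Module.finrank_linearMap, finrank_euclideanSpace_fin,
      Module.finrank_self, mul_one]
  rw [Module.finrank_prod, Module.finrank_prod, h, finrank_euclideanSpace_fin]
  ring

/-- The complete lift of the canonical form, in coordinates. -/
def liftedForm (δ ε : TTCot n) : ℝ :=
  (ε.1.2 δ.2.1 - δ.2.2 ε.1.1) + (ε.2.2 δ.1.1 - δ.1.2 ε.2.1)

/-- On vectors with vanishing time component, the lifted form is the antisymmetric part of the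
bilinear form `(ε, δ) ↦ momCovector n ε (jetCoordCot n δ)`. -/
lemma liftedForm_eq {δ ε : TTCot n} (hδ : time n δ.2.1 = 0) (hε : time n ε.2.1 = 0) :
    liftedForm δ ε = momCovector n ε (jetCoordCot n δ) - momCovector n δ (jetCoordCot n ε) := by
  rw [momCovector_apply, momCovector_apply, jetCoordCot_apply, jetCoordCot_apply,
    vert_space hδ, vert_space hε, liftedForm]
  ring

/-- On the vectors with vanishing time component, the kernel of the lifted form is spanned by
`∂/∂p`, where `p` is the momentum conjugate to the time. -/
lemma liftedForm_eq_zero_iff {δ : TTCot n} :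
    (time n δ.2.1 = 0 ∧ ∀ ε : TTCot n, time n ε.2.1 = 0 → liftedForm δ ε = 0) ↔
      ∃ c : ℝ, δ = c • ((0, time n), (0, 0)) := by
  constructor
  · rintro ⟨-, key⟩
    obtain ⟨⟨q, p⟩, ⟨q', p'⟩⟩ := δ
    -- The form is tested on vectors `ε` in the directions of `p`, `ṗ`, `y` and `q̇`, in this order.
    have h1 : q' = 0 := by
      rw [← inner_self_eq_zero (𝕜 := ℝ)]
      simpa [liftedForm] using key ((0, innerSL ℝ q'), (0, 0)) (by simp)
    have h2 : q = 0 := by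
      rw [← inner_self_eq_zero (𝕜 := ℝ)]
      simpa [liftedForm] using key ((0, 0), (0, innerSL ℝ q)) (by simp)
    have h3 : p' = 0 := ContinuousLinearMap.ext fun a => by
      simpa [liftedForm] using key ((a, 0), (0, 0)) (by simp)
    have h4 : p = p (timeUnit n) • time n := ContinuousLinearMap.ext fun a => by
      have h5 : p (vert n (space n a)) = 0 := by
        simpa [liftedForm] using key ((0, 0), (vert n (space n a), 0)) (by simp)
      conv_lhs => rw [← time_add_space a]
      simp [h5, mul_comm]
    refine ⟨p (timeUnit n), ?_⟩
    rw [h1, h2, h3]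
    simp [← h4]
  · rintro ⟨c, rfl⟩
    refine ⟨by simp, fun ε hε => ?_⟩
    simp [liftedForm, hε]

/-- The vectors `c ∂/∂p` satisfy the linearized local equations. -/
lemma jetCoordCot_smul (c : ℝ) :
    jetCoordCot n (c • ((0, time n), (0, 0)) : TTCot n) = 0 := by
  simp [jetCoordCot_apply]

lemma momCovector_smul (c : ℝ) :
    momCovector n (c • ((0, time n), (0, 0)) : TTCot n) = 0 :=
  ContinuousLinearMap.ext fun p => by simp [momCovector_apply]

/-- A submodule is one-dimensional if, in coordinates, it consists of the multiples of a nonzero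
vector. -/
lemma finrank_eq_one_of_coord {V W : Type*} [AddCommGroup V] [Module ℝ V] [AddCommGroup W]
    [Module ℝ W] (d : V →ₗ[ℝ] W) (hi : Function.Injective d) (hs : Function.Surjective d)
    {w₀ : W} (hw₀ : w₀ ≠ 0) {K : Submodule ℝ V} (hK : ∀ u, u ∈ K ↔ ∃ c : ℝ, d u = c • w₀) :
    Module.finrank ℝ K = 1 := by
  obtain ⟨u₀, rfl⟩ := hs w₀
  have hne : u₀ ≠ 0 := by
    rintro rfl
    exact hw₀ (map_zero d)
  have hK' : K = Submodule.span ℝ {u₀} := Submodule.ext fun u => by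
    rw [hK, Submodule.mem_span_singleton]
    refine exists_congr fun c => ?_
    rw [← map_smul, hi.eq_iff, eq_comm]
  rw [hK', finrank_span_singleton hne]

lemma mem_map_ker_restrictedForm {E : Type*} [NormedAddCommGroup E] [NormedSpace ℝ E]
    {H : Type*} [TopologicalSpace H] {I : ModelWithCorners ℝ E H} {N : Type*}
    [TopologicalSpace N] [ChartedSpace H N] {P : Set N} {Ω : TwoForm I N} {x : N}
    (u : TangentSpace I x) :
    u ∈ (LinearMap.ker (restrictedForm I P Ω x)).map (tangentSpaceOf I P x).subtype ↔
      u ∈ tangentSpaceOf I P x ∧ ∀ w ∈ tangentSpaceOf I P x, Ω x u w = 0 := by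
  rw [Submodule.mem_map]
  constructor
  · rintro ⟨u, hu, rfl⟩
    exact ⟨u.2, fun w hw => LinearMap.congr_fun (LinearMap.mem_ker.1 hu) ⟨w, hw⟩⟩
  · rintro ⟨hu, h⟩
    exact ⟨⟨u, hu⟩, LinearMap.mem_ker.2 (LinearMap.ext fun w => h w.1 w.2), rfl⟩

/-- The kernel of the restriction of a form to a subspace can be computed in coordinates. -/
lemma mem_ker_iff_of_coord {V W : Type*} {d : V → W} (hs : Function.Surjective d) {T : V → Prop}
    {T' : W → Prop} (hT : ∀ u, T u ↔ T' (d u)) {Ω : V → V → ℝ} {B : W → W → ℝ}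
    (hΩ : ∀ u w, Ω u w = B (d u) (d w)) (u : V) :
    (T u ∧ ∀ w, T w → Ω u w = 0) ↔ (T' (d u) ∧ ∀ ε, T' ε → B (d u) ε = 0) := by
  simp only [hT, hΩ, hs.forall]

/-- The dimension condition for Lagrangian submanifolds, if the kernel is one-dimensional and
tangent to the submanifold. -/
lemma dim_eq_half_rank_add_of_ker {E : Type*} [NormedAddCommGroup E] [NormedSpace ℝ E]
    [FiniteDimensional ℝ E] {H : Type*} [TopologicalSpace H] {I : ModelWithCorners ℝ E H}
    [I.Boundaryless] {N : Type*} [TopologicalSpace N] [ChartedSpace H N] [IsManifold I ∞ N]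
    {F : Type*} [NormedAddCommGroup F] [NormedSpace ℝ F] {f : N → F} {U P C : Set N}
    (hf : DefinesSubmanifoldOn I f U P) {Ω : TwoForm I N} {x : N} (hxU : x ∈ U) (hxP : x ∈ P)
    (hk : Module.finrank ℝ ((LinearMap.ker (restrictedForm I P Ω x)).map
        (tangentSpaceOf I P x).subtype : Submodule ℝ (TangentSpace I x)) = 1)
    (hle : (LinearMap.ker (restrictedForm I P Ω x)).map
        (tangentSpaceOf I P x).subtype ≤ tangentSpaceOf I C x) {r : ℕ}
    (hr : 2 * r + Module.finrank ℝ F = Module.finrank ℝ E + 1) :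
    (r : ℚ) = (Module.finrank ℝ (LinearMap.range (restrictedForm I P Ω x)) : ℚ) / 2
        + Module.finrank ℝ ((tangentSpaceOf I C x ⊓
            (LinearMap.ker (restrictedForm I P Ω x)).map (tangentSpaceOf I P x).subtype :
              Submodule ℝ (TangentSpace I x))) := by
  rw [inf_eq_right.2 hle, hk]
  have h1 := finrank_tangentSpaceOf hf hxU hxP
  have h2 := LinearMap.finrank_range_add_finrank_ker (restrictedForm I P Ω x)
  rw [Submodule.finrank_map_subtype_eq] at hk
  have h3 : 2 * r = Module.finrank ℝ (LinearMap.range (restrictedForm I P Ω x)) + 2 := by omega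
  have h4 : (2 * r : ℚ) = Module.finrank ℝ (LinearMap.range (restrictedForm I P Ω x)) + 2 :=
    mod_cast h3
  push_cast
  linarith

namespace IsAdaptedChart

variable (hφ : IsAdaptedChart π φ)
include hφ

/-- The complete lift of the canonical form, in the coordinates of an adapted chart. -/
lemma completeLift_apply
    {z : TangentBundle (cotModel (𝓡 (n + 1))) (CotangentBundle (𝓡 (n + 1)) M)}
    (hz : z.proj.proj ∈ φ.source) (u w : TangentSpace (cotModel (𝓡 (n + 1))).tangent z) :
    completeLift (cotModel (𝓡 (n + 1))) (canonicalForm (𝓡 (n + 1))) z u w =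
      liftedForm (hφ.tcot.d z u) (hφ.tcot.d z w) :=
  SmoothChart.completeLift_canonicalForm (φ := hφ.chart) hz u w

/-- The form vanishes on `S_L` since the second derivative of the Lagrangian function is
symmetric. -/
lemma completeLift_eq_zero_of_mem
    (hL : ContMDiffOn (𝓡 (n + 1)).tangent 𝓘(ℝ, ℝ) ∞ L (J1 (𝓡 (n + 1)) π))
    {z : TangentBundle (cotModel (𝓡 (n + 1))) (CotangentBundle (𝓡 (n + 1)) M)}
    (hz : z.proj.proj ∈ φ.source) (hzL : z ∈ lagrangianSet (𝓡 (n + 1)) π L)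
    {u w : TangentSpace (cotModel (𝓡 (n + 1))).tangent z}
    (hu : u ∈ tangentSpaceOf (cotModel (𝓡 (n + 1))).tangent (lagrangianSet (𝓡 (n + 1)) π L) z)
    (hw : w ∈ tangentSpaceOf (cotModel (𝓡 (n + 1))).tangent (lagrangianSet (𝓡 (n + 1)) π L) z) :
    completeLift (cotModel (𝓡 (n + 1))) (canonicalForm (𝓡 (n + 1))) z u w = 0 := by
  have hu' := (hφ.mem_tangentSpaceOf_lagrangianSet hL hz hzL u).1 hu
  have hw' := (hφ.mem_tangentSpaceOf_lagrangianSet hL hz hzL w).1 hw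
  refine (hφ.completeLift_apply hz u w).trans ?_
  have hy : (jetCoordCot n (hφ.tcot z)).1 ∈ φ.target := φ.map_source hz
  have h3 := fderiv_fderiv_comm (hφ.contDiffAt_lag hL hy)
  generalize hφ.tcot.d z u = δ at hu' ⊢
  generalize hφ.tcot.d z w = ε at hw' ⊢
  rw [liftedForm_eq hu'.1 hw'.1, hu'.2, hw'.2, h3, sub_self]

/-- The kernel of the presymplectic form is spanned by `∂/∂p`, where `p` is the momentum conjugate
to the time. -/
lemma mem_ker_restrictedForm
    {z : TangentBundle (cotModel (𝓡 (n + 1))) (CotangentBundle (𝓡 (n + 1)) M)}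
    (hz : z.proj.proj ∈ φ.source) (hz1 : z ∈ J1Cot (𝓡 (n + 1)) π)
    (u : TangentSpace (cotModel (𝓡 (n + 1))).tangent z) :
    u ∈ (LinearMap.ker (restrictedForm (cotModel (𝓡 (n + 1))).tangent (J1Cot (𝓡 (n + 1)) π)
        (completeLift (cotModel (𝓡 (n + 1))) (canonicalForm (𝓡 (n + 1)))) z)).map
          (tangentSpaceOf (cotModel (𝓡 (n + 1))).tangent (J1Cot (𝓡 (n + 1)) π) z).subtype ↔
      ∃ c : ℝ, hφ.tcot.d z u = c • ((0, time n), (0, 0)) := by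
  exact (mem_map_ker_restrictedForm u).trans ((mem_ker_iff_of_coord
    (T' := fun δ => time n δ.2.1 = 0)
    (SmoothChart.d_surjective (Χ := hφ.tcot) (hφ.mem_tcot_source.2 hz))
    (hφ.mem_tangentSpaceOf_J1Cot hz hz1) (hφ.completeLift_apply hz) u).trans
      liftedForm_eq_zero_iff)

lemma finrank_ker_restrictedForm
    {z : TangentBundle (cotModel (𝓡 (n + 1))) (CotangentBundle (𝓡 (n + 1)) M)}
    (hz : z.proj.proj ∈ φ.source) (hz1 : z ∈ J1Cot (𝓡 (n + 1)) π) :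
    Module.finrank ℝ ((LinearMap.ker (restrictedForm (cotModel (𝓡 (n + 1))).tangent
        (J1Cot (𝓡 (n + 1)) π)
        (completeLift (cotModel (𝓡 (n + 1))) (canonicalForm (𝓡 (n + 1)))) z)).map
          (tangentSpaceOf (cotModel (𝓡 (n + 1))).tangent (J1Cot (𝓡 (n + 1)) π) z).subtype :
            Submodule ℝ (TangentSpace (cotModel (𝓡 (n + 1))).tangent z)) = 1 := by
  have hzt := hφ.mem_tcot_source.2 hz
  have hne : (((0, time n), (0, 0)) : TTCot n) ≠ 0 := fun h => by
    have h1 : time n (timeUnit n) = 0 :=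
      DFunLike.congr_fun (congrArg (fun δ : TTCot n => δ.1.2) h) (timeUnit n)
    simp at h1
  exact finrank_eq_one_of_coord (hφ.tcot.d z).toLinearMap
    (SmoothChart.d_injective (Χ := hφ.tcot) hzt) (SmoothChart.d_surjective (Χ := hφ.tcot) hzt)
    hne (hφ.mem_ker_restrictedForm hz hz1)

/-- The kernel of the presymplectic form is tangent to `S_L`. -/
lemma ker_restrictedForm_le
    (hL : ContMDiffOn (𝓡 (n + 1)).tangent 𝓘(ℝ, ℝ) ∞ L (J1 (𝓡 (n + 1)) π))
    {z : TangentBundle (cotModel (𝓡 (n + 1))) (CotangentBundle (𝓡 (n + 1)) M)}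
    (hz : z.proj.proj ∈ φ.source) (hzL : z ∈ lagrangianSet (𝓡 (n + 1)) π L) :
    (LinearMap.ker (restrictedForm (cotModel (𝓡 (n + 1))).tangent (J1Cot (𝓡 (n + 1)) π)
        (completeLift (cotModel (𝓡 (n + 1))) (canonicalForm (𝓡 (n + 1)))) z)).map
          (tangentSpaceOf (cotModel (𝓡 (n + 1))).tangent (J1Cot (𝓡 (n + 1)) π) z).subtype ≤
      tangentSpaceOf (cotModel (𝓡 (n + 1))).tangent (lagrangianSet (𝓡 (n + 1)) π L) z := by
  intro u hu
  refine Exists.elim ((hφ.mem_ker_restrictedForm hz hzL.1 u).1 hu) fun c hc => ?_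
  refine (hφ.mem_tangentSpaceOf_lagrangianSet hL hz hzL u).2 ?_
  generalize hφ.tcot.d z u = δ at hc
  subst hc
  rw [jetCoordCot_smul, momCovector_smul, map_zero]
  exact ⟨by simp, rfl⟩

end IsAdaptedChart

/-- The jet manifold `J¹(T^*M → ℝ)` has codimension one. -/
lemma isEmbeddedSubmanifold_J1Cot (hπ : IsFibration (𝓡 (n + 1)) π) :
    IsEmbeddedSubmanifold (cotModel (𝓡 (n + 1))).tangent (J1Cot (𝓡 (n + 1)) π) (4 * n + 3) := by
  refine isEmbeddedSubmanifold_of_local (F := ℝ) ?_ fun z _ => ?_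
  · exact (congrArg _ (Module.finrank_self ℝ)).trans finrank_TTCot.symm
  · refine Exists.elim (hπ.exists_isAdaptedChart z.proj.proj) fun φ h => ?_
    exact ⟨_, _, h.1.mem_tcot_source.2 h.2, h.1.definesSubmanifoldOn_J1Cot⟩

lemma isEmbeddedSubmanifold_lagrangianSet (hπ : IsFibration (𝓡 (n + 1)) π)
    (hL : ContMDiffOn (𝓡 (n + 1)).tangent 𝓘(ℝ, ℝ) ∞ L (J1 (𝓡 (n + 1)) π)) :
    IsEmbeddedSubmanifold (cotModel (𝓡 (n + 1))).tangent (lagrangianSet (𝓡 (n + 1)) π L)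
      (2 * n + 2) := by
  refine isEmbeddedSubmanifold_of_local (F := ℝ × (Fin n → ℝ) × ℝ × (Fin n → ℝ)) ?_
    fun z _ => ?_
  · refine Eq.trans ?_ (finrank_TTCot (n := n)).symm
    simp only [Module.finrank_prod, Module.finrank_self, Module.finrank_fin_fun]
    ring
  · refine Exists.elim (hπ.exists_isAdaptedChart z.proj.proj) fun φ h => ?_
    exact ⟨{z | z.proj.proj ∈ φ.source}, localEquations φ L, h.2,
      h.1.definesSubmanifoldOn_lagrangianSet hL⟩

/-- The set `S_L` is a Lagrangian submanifold: the presymplectic form has rank `4n + 2` and a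
one-dimensional kernel, which is tangent to `S_L`, and `S_L` has dimension `2n + 2`. -/
theorem isLagrangianSubmanifold_lagrangianSet (hπ : IsFibration (𝓡 (n + 1)) π)
    (hL : ContMDiffOn (𝓡 (n + 1)).tangent 𝓘(ℝ, ℝ) ∞ L (J1 (𝓡 (n + 1)) π)) :
    IsLagrangianSubmanifold (cotModel (𝓡 (n + 1))).tangent (J1Cot (𝓡 (n + 1)) π)
      (completeLift (cotModel (𝓡 (n + 1))) (canonicalForm (𝓡 (n + 1))))
      (lagrangianSet (𝓡 (n + 1)) π L) := by
  refine ⟨⟨⟨4 * n + 3, isEmbeddedSubmanifold_J1Cot hπ⟩,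
    SmoothChart.isClosedTwoForm_completeLift⟩, fun z hz => hz.1,
    2 * n + 2, isEmbeddedSubmanifold_lagrangianSet hπ hL, fun z hzL => ?_⟩
  refine Exists.elim (hπ.exists_isAdaptedChart z.proj.proj) fun φ h => ?_
  refine ⟨fun u hu w hw => h.1.completeLift_eq_zero_of_mem hL h.2 hzL hu hw, ?_⟩
  refine dim_eq_half_rank_add_of_ker h.1.definesSubmanifoldOn_J1Cot
    (h.1.mem_tcot_source.2 h.2) hzL.1 (h.1.finrank_ker_restrictedForm h.2 hzL.1)
    (h.1.ker_restrictedForm_le hL h.2 hzL) ?_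
  refine Eq.trans ?_ (congrArg (· + 1) (finrank_TTCot (n := n)).symm)
  rw [Module.finrank_self]
  ring

end Lagrangian

/-! ### Curves of momenta -/

section CurvesOfMomenta

variable {n : ℕ} {y : ℝ → EuclideanSpace ℝ (Fin (n + 1))}
  {m : ℝ → (EuclideanSpace ℝ (Fin (n + 1)) →L[ℝ] ℝ)}
  {Λ : EuclideanSpace ℝ (Fin (n + 1)) × (Fin n → ℝ) → ℝ} {t : ℝ}

lemma contDiffAt_deriv {F : Type*} [NormedAddCommGroup F] [NormedSpace ℝ F] {f : ℝ → F}
    (hf : ContDiffAt ℝ ∞ f t) : ContDiffAt ℝ ∞ (deriv f) t := by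
  have h : ContDiffAt ℝ ∞ (fun s => fderiv ℝ f s 1) t :=
    (hf.fderiv_right (m := ∞) (by simp)).clm_apply contDiffAt_const
  exact h

lemma time_deriv (hy : DifferentiableAt ℝ y t) (ht : ∀ᶠ s in 𝓝 t, time n (y s) = s) :
    time n (deriv y t) = 1 :=
  ((time n).hasFDerivAt.comp_hasDerivAt t hy.hasDerivAt).unique
    ((hasDerivAt_id t).congr_of_eventuallyEq ht)

lemma time_deriv_deriv (hy : ContDiffAt ℝ ∞ y t) (ht : ∀ᶠ s in 𝓝 t, time n (y s) = s) :
    time n (deriv (deriv y) t) = 0 := by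
  have h1 := ((contDiffAt_deriv hy).differentiableAt (by simp)).hasDerivAt
  have h2 : ∀ᶠ s in 𝓝 t, ContDiffAt ℝ 1 y s := (hy.of_le (by simp)).eventually (by simp)
  have h3 : (fun s => time n (deriv y s)) =ᶠ[𝓝 t] fun _ => 1 := by
    filter_upwards [ht.eventually_nhds, h2] with s hs hs'
    exact time_deriv (hs'.differentiableAt (by simp)) hs
  exact ((time n).hasFDerivAt.comp_hasDerivAt t h1).unique
    ((hasDerivAt_const t (1 : ℝ)).congr_of_eventuallyEq h3)

/-- The energy `p(ẏ) - L` changes by the defect of the equation `ṗ = ∂L/∂y` along the velocity, if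
the space components of the momentum are given by the Legendre transformation. -/
lemma hasDerivAt_energy (hy : ContDiffAt ℝ ∞ y t) (ht : ∀ᶠ s in 𝓝 t, time n (y s) = s)
    (hm : DifferentiableAt ℝ m t) (hΛ : DifferentiableAt ℝ Λ (y t, space n (deriv y t)))
    (h : ∀ b, m t (vert n b) = fderiv ℝ Λ (y t, space n (deriv y t)) (0, b)) :
    HasDerivAt (fun s => m s (deriv y s) - Λ (y s, space n (deriv y s)))
      (deriv m t (deriv y t) - fderiv ℝ Λ (y t, space n (deriv y t)) (deriv y t, 0)) t := by
  have h1 := (hy.differentiableAt (by simp)).hasDerivAt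
  have h2 := ((contDiffAt_deriv hy).differentiableAt (by simp)).hasDerivAt
  have h3 := hm.hasDerivAt.clm_apply h2
  have h4 := hΛ.hasFDerivAt.comp_hasDerivAt t
    (h1.prodMk ((space n).hasFDerivAt.comp_hasDerivAt t h2))
  refine (h3.sub h4).congr_deriv ?_
  have h5 := h (space n (deriv (deriv y) t))
  rw [vert_space (time_deriv_deriv hy ht)] at h5
  have h6 : (deriv y t, space n (deriv (deriv y) t))
      = (deriv y t, 0) + (0, space n (deriv (deriv y) t)) := by simp
  rw [h5, h6, map_add]
  ring

lemma hasDerivAt_momentum (hm : DifferentiableAt ℝ m t) (a : EuclideanSpace ℝ (Fin (n + 1))) :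
    HasDerivAt (fun s => m s a) (deriv m t a) t := by
  simpa using hm.hasDerivAt.clm_apply (hasDerivAt_const t a)

end CurvesOfMomenta

/-! ### The extended Legendre transformation -/

section Legendre

variable {n : ℕ} {M : Type*} [TopologicalSpace M]
  [ChartedSpace (EuclideanSpace ℝ (Fin (n + 1))) M] [IsManifold (𝓡 (n + 1)) ∞ M]
  {π : M → ℝ} {φ : OpenPartialHomeomorph M (EuclideanSpace ℝ (Fin (n + 1)))}
  {L : TangentBundle (𝓡 (n + 1)) M → ℝ}

/-- The Legendre transformation of the Lagrangian function `Λ`, at a jet with coordinates `p`. -/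
def legendreInCoord (Λ : EuclideanSpace ℝ (Fin (n + 1)) × (Fin n → ℝ) → ℝ)
    (p : EuclideanSpace ℝ (Fin (n + 1)) × (Fin n → ℝ)) : EuclideanSpace ℝ (Fin (n + 1)) →L[ℝ] ℝ :=
  Λ p • time n + (fderiv ℝ Λ p ∘L ContinuousLinearMap.inr ℝ _ _) ∘L
    (space n - (time n).smulRight p.2)

lemma legendreInCoord_apply (Λ : EuclideanSpace ℝ (Fin (n + 1)) × (Fin n → ℝ) → ℝ)
    (p : EuclideanSpace ℝ (Fin (n + 1)) × (Fin n → ℝ)) (a : EuclideanSpace ℝ (Fin (n + 1))) :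
    legendreInCoord Λ p a = Λ p * time n a + fderiv ℝ Λ p (0, space n a - time n a • p.2) := rfl

lemma contDiffAt_legendreInCoord {Λ : EuclideanSpace ℝ (Fin (n + 1)) × (Fin n → ℝ) → ℝ}
    {p : EuclideanSpace ℝ (Fin (n + 1)) × (Fin n → ℝ)} (hΛ : ContDiffAt ℝ ∞ Λ p) :
    ContDiffAt ℝ ∞ (legendreInCoord Λ) p := by
  have h1 : ContDiffAt ℝ ∞ (fun p : EuclideanSpace ℝ (Fin (n + 1)) × (Fin n → ℝ) =>
      (time n).smulRight p.2) p :=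
    (ContinuousLinearMap.smulRightL ℝ _ _ (time n)).contDiff.contDiffAt.comp p contDiffAt_snd
  exact (hΛ.smul contDiffAt_const).add
    (((hΛ.fderiv_right (m := ∞) (by simp)).clm_comp contDiffAt_const).clm_comp
      (contDiffAt_const.sub h1))

/-- A covector is determined by its value on a vector with time component `1` and its values on
the vectors with vanishing time component. -/
lemma eq_legendreInCoord_add_iff {Λ : EuclideanSpace ℝ (Fin (n + 1)) × (Fin n → ℝ) → ℝ}
    {y ydot : EuclideanSpace ℝ (Fin (n + 1))} (h1 : time n ydot = 1) (c : ℝ)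
    (m : EuclideanSpace ℝ (Fin (n + 1)) →L[ℝ] ℝ) :
    (∀ a, m a = legendreInCoord Λ (y, space n ydot) a + c * time n a) ↔
      (∀ b, m (vert n b) = fderiv ℝ Λ (y, space n ydot) (0, b)) ∧
        m ydot - Λ (y, space n ydot) = c := by
  constructor
  · intro h
    refine ⟨fun b => ?_, ?_⟩
    · rw [h, legendreInCoord_apply]
      simp
    · rw [h, legendreInCoord_apply, h1, one_smul, sub_self, Prod.mk_zero_zero, map_zero]
      ring
  · rintro ⟨h, rfl⟩ a
    have h2 : a = time n a • ydot + vert n (space n a - time n a • space n ydot) :=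
      ext_time_space (by simp [h1]) (by simp)
    conv_lhs => rw [h2, map_add, h, map_smul]
    rw [legendreInCoord_apply, smul_eq_mul]
    ring

namespace IsAdaptedChart

variable (hφ : IsAdaptedChart π φ)
include hφ

/-- The extended Legendre transformation in an adapted chart. -/
lemma legendre_apply (hL : ContMDiffOn (𝓡 (n + 1)).tangent 𝓘(ℝ, ℝ) ∞ L (J1 (𝓡 (n + 1)) π))
    {x : M} (hx : x ∈ φ.source) {v : TangentSpace (𝓡 (n + 1)) x}
    (hv : (⟨x, v⟩ : TangentBundle (𝓡 (n + 1)) M) ∈ J1 (𝓡 (n + 1)) π)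
    (X : TangentSpace (𝓡 (n + 1)) x) :
    (legendre (𝓡 (n + 1)) π L ⟨x, v⟩).2 X =
      legendreInCoord (lag φ L) (φ x, space n (hφ.chart.d x v)) (hφ.chart.d x X) := by
  have hη : mvfderiv (𝓡 (n + 1)) π x v = 1 := hv
  have hfun : ∀ Y : TangentSpace (𝓡 (n + 1)) x,
      L ⟨x, v + (Y - mvfderiv (𝓡 (n + 1)) π x Y • v)⟩ =
        lag φ L (φ x, space n (hφ.chart.d x v) + (space n (hφ.chart.d x Y)
          - time n (hφ.chart.d x Y) • space n (hφ.chart.d x v))) := by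
    intro Y
    have hw : (⟨x, v + (Y - mvfderiv (𝓡 (n + 1)) π x Y • v)⟩ : TangentBundle (𝓡 (n + 1)) M)
        ∈ J1 (𝓡 (n + 1)) π := by
      change mvfderiv (𝓡 (n + 1)) π x (v + (Y - mvfderiv (𝓡 (n + 1)) π x Y • v)) = 1
      rw [map_add, map_sub, map_smul, hη, smul_eq_mul, mul_one, sub_self, add_zero]
    refine (hφ.lag_tangent hx hw).symm.trans (congrArg (lag φ L) (Prod.ext rfl ?_))
    change space n (hφ.chart.d x (v + (Y - mvfderiv (𝓡 (n + 1)) π x Y • v))) = _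
    rw [map_add, map_sub, map_smul, map_add, map_sub, map_smul, hφ.mvfderiv_apply hx]
  -- In the chart, the function that is differentiated in the definition of the Legendre
  -- transformation is the composition of the Lagrangian function with an affine map.
  let A : EuclideanSpace ℝ (Fin (n + 1)) →L[ℝ] (Fin n → ℝ) :=
    (space n - (time n).smulRight (space n (hφ.chart.d x v))) ∘L hφ.chart.d x
  have hA : HasFDerivAt (fun Y : EuclideanSpace ℝ (Fin (n + 1)) =>
      (φ x, space n (hφ.chart.d x v) + A Y)) (ContinuousLinearMap.inr ℝ _ _ ∘L A) 0 :=
    ((hasFDerivAt_const (φ x) _).prodMk (A.hasFDerivAt.const_add _)).congr_fderiv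
      (ContinuousLinearMap.ext fun _ => rfl)
  have hp : (φ x, space n (hφ.chart.d x v) + A 0) = (φ x, space n (hφ.chart.d x v)) := by
    rw [map_zero, add_zero]
  have h1 : HasFDerivAt (fun Y : EuclideanSpace ℝ (Fin (n + 1)) =>
      lag φ L (φ x, space n (hφ.chart.d x v) + A Y)) _ 0 :=
    HasFDerivAt.comp (g := lag φ L) 0
      (by rw [hp]; exact hφ.hasFDerivAt_lag hL (φ.map_source hx)) hA
  have h2 : fderiv ℝ (fun Y : TangentSpace (𝓡 (n + 1)) x =>
      L ⟨x, v + (Y - mvfderiv (𝓡 (n + 1)) π x Y • v)⟩) 0 = _ :=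
    (congrArg (fun f => fderiv ℝ f 0) (funext hfun)).trans h1.fderiv
  have h3 : (legendre (𝓡 (n + 1)) π L ⟨x, v⟩).2 X = L ⟨x, v⟩ * mvfderiv (𝓡 (n + 1)) π x X
      + fderiv ℝ (fun Y : TangentSpace (𝓡 (n + 1)) x =>
        L ⟨x, v + (Y - mvfderiv (𝓡 (n + 1)) π x Y • v)⟩) 0 X := rfl
  have h4 : lag φ L (φ x, space n (hφ.chart.d x v)) = L ⟨x, v⟩ := hφ.lag_tangent hx hv
  rw [h3, h2, legendreInCoord_apply, h4, hφ.mvfderiv_apply hx]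
  rfl

lemma cotMom_legendre (hL : ContMDiffOn (𝓡 (n + 1)).tangent 𝓘(ℝ, ℝ) ∞ L (J1 (𝓡 (n + 1)) π))
    {x : M} (hx : x ∈ φ.source) {v : TangentSpace (𝓡 (n + 1)) x}
    (hv : (⟨x, v⟩ : TangentBundle (𝓡 (n + 1)) M) ∈ J1 (𝓡 (n + 1)) π) :
    cotMom (𝓡 (n + 1)) φ.toPartialEquiv (legendre (𝓡 (n + 1)) π L ⟨x, v⟩) =
      legendreInCoord (lag φ L) (φ x, space n (hφ.chart.d x v)) := by
  refine ContinuousLinearMap.ext fun a => ?_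
  obtain ⟨X, rfl⟩ := SmoothChart.d_surjective (Χ := hφ.chart) hx a
  exact (SmoothChart.cotMom_d hφ.chart
    (α := legendre (𝓡 (n + 1)) π L ⟨x, v⟩) hx X).trans (hφ.legendre_apply hL hx hv X)

/-- A covector is a translate of the Legendre transform of a jet `v` if and only if its space
components are `∂L/∂q̇`; the translation is then by the value at `v` minus the Lagrangian. -/
lemma eq_translate_legendre_iff
    (hL : ContMDiffOn (𝓡 (n + 1)).tangent 𝓘(ℝ, ℝ) ∞ L (J1 (𝓡 (n + 1)) π))
    {α : CotangentBundle (𝓡 (n + 1)) M} (hα : α.proj ∈ φ.source)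
    {v : TangentSpace (𝓡 (n + 1)) α.proj}
    (hv : (⟨α.proj, v⟩ : TangentBundle (𝓡 (n + 1)) M) ∈ J1 (𝓡 (n + 1)) π) (c : ℝ) :
    α = translate (𝓡 (n + 1)) π c (legendre (𝓡 (n + 1)) π L ⟨α.proj, v⟩) ↔
      (∀ b, cotMom (𝓡 (n + 1)) φ.toPartialEquiv α (vert n b) =
        fderiv ℝ (lag φ L) (φ α.proj, space n (hφ.chart.d α.proj v)) (0, b)) ∧
        α.2 v - L ⟨α.proj, v⟩ = c := by
  have h1 : α = translate (𝓡 (n + 1)) π c (legendre (𝓡 (n + 1)) π L ⟨α.proj, v⟩) ↔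
      ∀ X, α.2 X = (legendre (𝓡 (n + 1)) π L ⟨α.proj, v⟩).2 X
        + c * mvfderiv (𝓡 (n + 1)) π α.proj X := by
    constructor
    · intro h X
      obtain ⟨x, a⟩ := α
      have h2 := eq_of_heq (Bundle.TotalSpace.mk.inj h).2
      exact DFunLike.congr_fun h2 X
    · intro h
      exact Bundle.TotalSpace.ext rfl (heq_of_eq (ContinuousLinearMap.ext h))
  have h2 : L ⟨α.proj, v⟩ = lag φ L (φ α.proj, space n (hφ.chart.d α.proj v)) :=
    (hφ.lag_tangent (v := ⟨α.proj, v⟩) hα hv).symm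
  have h3 : time n (hφ.chart.d α.proj v) = 1 := (hφ.mem_J1 (v := ⟨α.proj, v⟩) hα).1 hv
  have h4 : ∀ u : TangentSpace (𝓡 (n + 1)) α.proj,
      cotMom (𝓡 (n + 1)) φ.toPartialEquiv α (hφ.chart.d α.proj u) = α.2 u :=
    SmoothChart.cotMom_d hφ.chart (α := α) hα
  have h5 := eq_legendreInCoord_add_iff (Λ := lag φ L) (y := φ α.proj) h3 c
    (cotMom (𝓡 (n + 1)) φ.toPartialEquiv α)
  rw [h4, ← h2] at h5
  refine h1.trans (Iff.trans ?_ h5)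
  refine Iff.trans ?_ (SmoothChart.d_surjective (Χ := hφ.chart) (x := α.proj) hα).forall.symm
  refine forall_congr' fun X => ?_
  rw [hφ.legendre_apply hL hα hv, hφ.mvfderiv_apply hα, h4]

end IsAdaptedChart

end Legendre

/-! ### Sections of the cotangent bundle in adapted charts -/

section Sections

variable {n : ℕ} {M : Type*} [TopologicalSpace M]
  [ChartedSpace (EuclideanSpace ℝ (Fin (n + 1))) M] [IsManifold (𝓡 (n + 1)) ∞ M]
  {π : M → ℝ} {φ : OpenPartialHomeomorph M (EuclideanSpace ℝ (Fin (n + 1)))}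
  {L : TangentBundle (𝓡 (n + 1)) M → ℝ} {J : Set ℝ}
  {γ : ℝ → CotangentBundle (𝓡 (n + 1)) M} {t : ℝ}

/-- The positions `(t, q)` along a curve in the cotangent bundle. -/
def curvePos (φ : OpenPartialHomeomorph M (EuclideanSpace ℝ (Fin (n + 1))))
    (γ : ℝ → CotangentBundle (𝓡 (n + 1)) M) (s : ℝ) : EuclideanSpace ℝ (Fin (n + 1)) :=
  φ (γ s).proj

/-- The momenta along a curve in the cotangent bundle. -/
def curveMom (φ : OpenPartialHomeomorph M (EuclideanSpace ℝ (Fin (n + 1))))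
    (γ : ℝ → CotangentBundle (𝓡 (n + 1)) M) (s : ℝ) : EuclideanSpace ℝ (Fin (n + 1)) →L[ℝ] ℝ :=
  cotMom (𝓡 (n + 1)) φ.toPartialEquiv (γ s)

/-- The coordinates `((t, q), q̇)` of the jets of the projection to the base of a curve in the
cotangent bundle. -/
def curveJet (φ : OpenPartialHomeomorph M (EuclideanSpace ℝ (Fin (n + 1))))
    (γ : ℝ → CotangentBundle (𝓡 (n + 1)) M) (s : ℝ) :
    EuclideanSpace ℝ (Fin (n + 1)) × (Fin n → ℝ) :=
  (curvePos φ γ s, space n (deriv (curvePos φ γ) s))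

/-- The energy `p(ẏ) - L` along a curve in the cotangent bundle. -/
def energy (L : TangentBundle (𝓡 (n + 1)) M → ℝ) (γ : ℝ → CotangentBundle (𝓡 (n + 1)) M)
    (t : ℝ) : ℝ :=
  (γ t).2 (jet (𝓡 (n + 1)) (fun s => (γ s).proj) t).2
    - L (jet (𝓡 (n + 1)) (fun s => (γ s).proj) t)

lemma IsSectionOn.contMDiffAt {E : Type*} [NormedAddCommGroup E] [NormedSpace ℝ E]
    {H : Type*} [TopologicalSpace H] {I : ModelWithCorners ℝ E H} {N : Type*}
    [TopologicalSpace N] [ChartedSpace H N] {p : N → ℝ} {c : ℝ → N} (hc : IsSectionOn I p J c)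
    (hJ : IsOpen J) (ht : t ∈ J) : ContMDiffAt 𝓘(ℝ, ℝ) I ∞ c t :=
  hc.1.contMDiffAt (hJ.mem_nhds ht)

/-- The velocities of sections are jets. -/
lemma IsSectionOn.jet_mem_J1 {E : Type*} [NormedAddCommGroup E] [NormedSpace ℝ E]
    {H : Type*} [TopologicalSpace H] {I : ModelWithCorners ℝ E H} {N : Type*}
    [TopologicalSpace N] [ChartedSpace H N] {p : N → ℝ} {c : ℝ → N} (hc : IsSectionOn I p J c)
    (hp : ContMDiff I 𝓘(ℝ, ℝ) ∞ p) (hJ : IsOpen J) (ht : t ∈ J) : jet I c t ∈ J1 I p := by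
  have h1 := hasDerivAt_comp_jet ((hp (c t)).mdifferentiableAt (by simp))
    ((hc.contMDiffAt hJ ht).mdifferentiableAt (by simp))
  exact h1.unique ((hasDerivAt_id t).congr_of_eventuallyEq
    (Filter.eventually_of_mem (hJ.mem_nhds ht) hc.2))

lemma IsSectionOn.proj (hγ : IsSectionOn (cotModel (𝓡 (n + 1))) (cotFibration (𝓡 (n + 1)) π) J γ) :
    IsSectionOn (𝓡 (n + 1)) π J (fun s => (γ s).proj) :=
  ⟨SmoothChart.contMDiff_proj_cotangent.comp_contMDiffOn hγ.1, hγ.2⟩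

lemma contMDiff_cotFibration (hπ : ContMDiff (𝓡 (n + 1)) 𝓘(ℝ, ℝ) ∞ π) :
    ContMDiff (cotModel (𝓡 (n + 1))) 𝓘(ℝ, ℝ) ∞ (cotFibration (𝓡 (n + 1)) π) :=
  hπ.comp SmoothChart.contMDiff_proj_cotangent

lemma tangentProj_jet (hγ : MDifferentiableAt 𝓘(ℝ, ℝ) (cotModel (𝓡 (n + 1))) γ t) :
    tangentProj (𝓡 (n + 1)) (jet (cotModel (𝓡 (n + 1))) γ t)
      = jet (𝓡 (n + 1)) (fun s => (γ s).proj) t := by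
  have h1 := mfderiv_comp t
    ((SmoothChart.contMDiff_proj_cotangent (I := 𝓡 (n + 1)) (γ t)).mdifferentiableAt
      (by simp)) hγ
  exact Bundle.TotalSpace.ext rfl (heq_of_eq (DFunLike.congr_fun h1 (1 : ℝ)).symm)

namespace IsAdaptedChart

variable (hφ : IsAdaptedChart π φ) (hJ : IsOpen J)
  (hγ : IsSectionOn (cotModel (𝓡 (n + 1))) (cotFibration (𝓡 (n + 1)) π) J γ)
include hφ hJ hγ

lemma eventually_mem (ht : t ∈ J) (hx : (γ t).proj ∈ φ.source) :
    ∀ᶠ s in 𝓝 t, s ∈ J ∧ (γ s).proj ∈ φ.source :=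
  (hJ.eventually_mem ht).and ((hγ.contMDiffAt hJ ht).continuousAt.eventually
    (SmoothChart.source_mem_nhds (Χ := hφ.chart.cotangent) hx))

lemma contDiffAt_curve (ht : t ∈ J) (hx : (γ t).proj ∈ φ.source) :
    ContDiffAt ℝ ∞ (fun s => (curvePos φ γ s, curveMom φ γ s)) t :=
  SmoothChart.contDiffAt_comp (Χ := hφ.chart.cotangent) hx (hγ.contMDiffAt hJ ht)

lemma contDiffAt_curvePos (ht : t ∈ J) (hx : (γ t).proj ∈ φ.source) :
    ContDiffAt ℝ ∞ (curvePos φ γ) t :=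
  contDiffAt_fst.comp t (hφ.contDiffAt_curve hJ hγ ht hx)

lemma differentiableAt_curvePos (ht : t ∈ J) (hx : (γ t).proj ∈ φ.source) :
    DifferentiableAt ℝ (curvePos φ γ) t :=
  (hφ.contDiffAt_curvePos hJ hγ ht hx).differentiableAt (by simp)

lemma differentiableAt_curveMom (ht : t ∈ J) (hx : (γ t).proj ∈ φ.source) :
    DifferentiableAt ℝ (curveMom φ γ) t :=
  ContDiffAt.differentiableAt (n := ∞)
    (contDiffAt_snd.comp t (hφ.contDiffAt_curve hJ hγ ht hx)) (by simp)

lemma eventually_time_curvePos (ht : t ∈ J) (hx : (γ t).proj ∈ φ.source) :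
    ∀ᶠ s in 𝓝 t, time n (curvePos φ γ s) = s :=
  (hφ.eventually_mem hJ hγ ht hx).mono fun s hs => (hφ.2 _ hs.2).trans (hγ.2 s hs.1)

/-- The coordinates of the jets of a section of the cotangent bundle. -/
lemma tcot_jet (ht : t ∈ J) (hx : (γ t).proj ∈ φ.source) :
    hφ.tcot (jet (cotModel (𝓡 (n + 1))) γ t) =
      ((curvePos φ γ t, curveMom φ γ t), (deriv (curvePos φ γ) t, deriv (curveMom φ γ) t)) := by
  have h1 := SmoothChart.tangent_jet hφ.chart.cotangent (c := γ) (t := t) hx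
    ((hγ.contMDiffAt hJ ht).mdifferentiableAt (by simp))
  have h2 : HasDerivAt (fun s => (curvePos φ γ s, curveMom φ γ s)) _ t :=
    (hφ.differentiableAt_curvePos hJ hγ ht hx).hasDerivAt.prodMk
      (hφ.differentiableAt_curveMom hJ hγ ht hx).hasDerivAt
  exact h1.trans (Prod.ext rfl h2.deriv)

/-- The coordinates of the jets of the projection to the base. -/
lemma d_jet_proj (ht : t ∈ J) (hx : (γ t).proj ∈ φ.source) :
    hφ.chart.d (γ t).proj (jet (𝓡 (n + 1)) (fun s => (γ s).proj) t).2 = deriv (curvePos φ γ) t :=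
  SmoothChart.d_jet (Χ := hφ.chart) (c := fun s => (γ s).proj) hx
    ((hγ.proj.contMDiffAt hJ ht).mdifferentiableAt (by simp))

/-- The jet of a section lies in `S_L` if and only if the momenta are given by the Legendre
transformation and satisfy the equation `ṗ = ∂L/∂y`. -/
lemma jet_mem_lagrangianSet
    (hL : ContMDiffOn (𝓡 (n + 1)).tangent 𝓘(ℝ, ℝ) ∞ L (J1 (𝓡 (n + 1)) π))
    (ht : t ∈ J) (hx : (γ t).proj ∈ φ.source) :
    jet (cotModel (𝓡 (n + 1))) γ t ∈ lagrangianSet (𝓡 (n + 1)) π L ↔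
      (∀ b, curveMom φ γ t (vert n b) = fderiv ℝ (lag φ L) (curveJet φ γ t) (0, b)) ∧
        ∀ a, deriv (curveMom φ γ) t a = fderiv ℝ (lag φ L) (curveJet φ γ t) (a, 0) := by
  have h1 := hφ.mem_lagrangianSet hL (z := jet (cotModel (𝓡 (n + 1))) γ t) hx
  rw [hφ.tcot_jet hJ hγ ht hx] at h1
  refine h1.trans ?_
  have h2 : time n (deriv (curvePos φ γ) t) = 1 :=
    time_deriv (hφ.differentiableAt_curvePos hJ hγ ht hx)
      (hφ.eventually_time_curvePos hJ hγ ht hx)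
  constructor
  · rintro ⟨-, h⟩
    exact ⟨fun b => by simpa [curveJet] using h 0 b, fun a => by simpa [curveJet] using h a 0⟩
  · rintro ⟨h3, h4⟩
    refine ⟨h2, fun a b => ?_⟩
    have h5 : ((a, b) : EuclideanSpace ℝ (Fin (n + 1)) × (Fin n → ℝ)) = (a, 0) + (0, b) := by simp
    rw [h5, map_add]
    exact congrArg₂ (· + ·) (h4 a) (h3 b)

/-- At one point of a section, `γ - Leg_L ∘ j¹σ` is a multiple of `η` if and only if the space
momenta are `∂L/∂q̇`; the factor is the energy. -/
lemma curve_eq_translate_iff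
    (hL : ContMDiffOn (𝓡 (n + 1)).tangent 𝓘(ℝ, ℝ) ∞ L (J1 (𝓡 (n + 1)) π))
    (hπ : ContMDiff (𝓡 (n + 1)) 𝓘(ℝ, ℝ) ∞ π)
    (ht : t ∈ J) (hx : (γ t).proj ∈ φ.source) (c : ℝ) :
    γ t = translate (𝓡 (n + 1)) π c (legendre (𝓡 (n + 1)) π L
        (jet (𝓡 (n + 1)) (fun s => (γ s).proj) t)) ↔
      (∀ b, curveMom φ γ t (vert n b) = fderiv ℝ (lag φ L) (curveJet φ γ t) (0, b)) ∧
        energy L γ t = c := by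
  have h1 := hφ.eq_translate_legendre_iff hL (α := γ t) hx
    (v := (jet (𝓡 (n + 1)) (fun s => (γ s).proj) t).2) (hγ.proj.jet_mem_J1 hπ hJ ht) c
  rw [hφ.d_jet_proj hJ hγ ht hx] at h1
  exact h1

lemma energy_eq
    (hπ : ContMDiff (𝓡 (n + 1)) 𝓘(ℝ, ℝ) ∞ π) (ht : t ∈ J) (hx : (γ t).proj ∈ φ.source) :
    energy L γ t = curveMom φ γ t (deriv (curvePos φ γ) t) - lag φ L (curveJet φ γ t) := by
  have h1 := SmoothChart.cotMom_d hφ.chart (α := γ t) hx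
    (jet (𝓡 (n + 1)) (fun s => (γ s).proj) t).2
  have h2 := hφ.lag_tangent (L := L) (v := jet (𝓡 (n + 1)) (fun s => (γ s).proj) t) hx
    (hγ.proj.jet_mem_J1 hπ hJ ht)
  have h3 := SmoothChart.tangent_jet hφ.chart (c := fun s => (γ s).proj) (t := t) hx
    ((hγ.proj.contMDiffAt hJ ht).mdifferentiableAt (by simp))
  rw [h3] at h2
  rw [hφ.d_jet_proj hJ hγ ht hx] at h1
  exact congrArg₂ (· - ·) h1.symm h2.symm

lemma hasDerivAt_energy
    (hL : ContMDiffOn (𝓡 (n + 1)).tangent 𝓘(ℝ, ℝ) ∞ L (J1 (𝓡 (n + 1)) π))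
    (hπ : ContMDiff (𝓡 (n + 1)) 𝓘(ℝ, ℝ) ∞ π) (ht : t ∈ J) (hx : (γ t).proj ∈ φ.source)
    (h : ∀ b, curveMom φ γ t (vert n b) = fderiv ℝ (lag φ L) (curveJet φ γ t) (0, b)) :
    HasDerivAt (energy L γ) (deriv (curveMom φ γ) t (deriv (curvePos φ γ) t)
      - fderiv ℝ (lag φ L) (curveJet φ γ t) (deriv (curvePos φ γ) t, 0)) t :=
  (TimeMechanics.hasDerivAt_energy (hφ.contDiffAt_curvePos hJ hγ ht hx)
    (hφ.eventually_time_curvePos hJ hγ ht hx) (hφ.differentiableAt_curveMom hJ hγ ht hx)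
    (hφ.hasFDerivAt_lag hL (p := curveJet φ γ t) (φ.map_source hx)).differentiableAt
    h).congr_of_eventuallyEq ((hφ.eventually_mem hJ hγ ht hx).mono fun _ hs =>
      hφ.energy_eq hJ hγ hπ hs.1 hs.2)

/-- The Euler-Lagrange equations at one point of a section, in terms of the differential of the
Lagrangian function. -/
lemma eulerLagrange_iff
    (hL : ContMDiffOn (𝓡 (n + 1)).tangent 𝓘(ℝ, ℝ) ∞ L (J1 (𝓡 (n + 1)) π))
    (ht : t ∈ J) (hx : (γ t).proj ∈ φ.source) (i : Fin n) :
    HasDerivAt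
        (fun s => dLdv φ L i (φ (γ s).proj) (fun k => deriv (fun s' => φ (γ s').proj k.succ) s))
        (dLdx φ L i.succ (φ (γ t).proj) (fun k => deriv (fun s' => φ (γ s').proj k.succ) t)) t ↔
      HasDerivAt (fun s => fderiv ℝ (lag φ L) (curveJet φ γ s) (0, Pi.single i 1))
        (fderiv ℝ (lag φ L) (curveJet φ γ t) (vert n (Pi.single i 1), 0)) t := by
  have hw : ∀ s, s ∈ J ∧ (γ s).proj ∈ φ.source →
      (fun k : Fin n => deriv (fun s' => φ (γ s').proj k.succ) s) = (curveJet φ γ s).2 := by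
    intro s hs
    funext k
    exact (((ContinuousLinearMap.proj k : (Fin n → ℝ) →L[ℝ] ℝ) ∘L
      space n).hasFDerivAt.comp_hasDerivAt s
      (hφ.differentiableAt_curvePos hJ hγ hs.1 hs.2).hasDerivAt).deriv
  have h1 : dLdx φ L i.succ (φ (γ t).proj) (fun k => deriv (fun s' => φ (γ s').proj k.succ) t)
      = fderiv ℝ (lag φ L) (curveJet φ γ t) (vert n (Pi.single i 1), 0) := by
    rw [hw t ⟨ht, hx⟩, vert_single]
    exact hφ.dLdx_eq hL (p := curveJet φ γ t) (φ.map_source hx) i.succ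
  rw [h1]
  refine Filter.EventuallyEq.hasDerivAt_iff
    ((hφ.eventually_mem hJ hγ ht hx).mono fun s hs => ?_)
  change dLdv φ L i (φ (γ s).proj) (fun k => deriv (fun s' => φ (γ s').proj k.succ) s) = _
  rw [hw s hs]
  exact hφ.dLdv_eq hL (p := curveJet φ γ s) (φ.map_source hs.2) i

end IsAdaptedChart

end Sections

/-! ### The Euler-Lagrange equations -/

section EulerLagrangeEquations

variable {n : ℕ} {M : Type*} [TopologicalSpace M]
  [ChartedSpace (EuclideanSpace ℝ (Fin (n + 1))) M] [IsManifold (𝓡 (n + 1)) ∞ M]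
  {π : M → ℝ} {L : TangentBundle (𝓡 (n + 1)) M → ℝ} {J : Set ℝ}
  {γ : ℝ → CotangentBundle (𝓡 (n + 1)) M} {σ : ℝ → M}

lemma covector_ext {l l' : EuclideanSpace ℝ (Fin (n + 1)) →L[ℝ] ℝ}
    {u : EuclideanSpace ℝ (Fin (n + 1))} (hu : time n u = 1) (h : l u = l' u)
    (hv : ∀ i : Fin n, l (vert n (Pi.single i 1)) = l' (vert n (Pi.single i 1))) : l = l' := by
  have h1 : l ∘L vert n = l' ∘L vert n :=
    ContinuousLinearMap.coe_injective (LinearMap.pi_ext' fun i => LinearMap.ext_ring (hv i))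
  refine ContinuousLinearMap.ext fun a => ?_
  have h2 : a = time n a • u + vert n (space n a - time n a • space n u) :=
    ext_time_space (by simp [hu]) (by simp)
  rw [h2, map_add, map_add, map_smul, map_smul, h]
  exact congrArg _ (DFunLike.congr_fun h1 _)

/-- The jets of a section of `T^*M` lie in `S_L` if and only if its projection solves the
Euler-Lagrange equations, its space momenta are given by the Legendre transformation, and the
energy is constant. -/
theorem forall_jet_mem_lagrangianSet_iff (hπ : IsFibration (𝓡 (n + 1)) π)
    (hL : ContMDiffOn (𝓡 (n + 1)).tangent 𝓘(ℝ, ℝ) ∞ L (J1 (𝓡 (n + 1)) π)) (hJ : IsOpen J)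
    (hγ : IsSectionOn (cotModel (𝓡 (n + 1))) (cotFibration (𝓡 (n + 1)) π) J γ) :
    (∀ t ∈ J, jet (cotModel (𝓡 (n + 1))) γ t ∈ lagrangianSet (𝓡 (n + 1)) π L) ↔
      SolvesEulerLagrange π L J (fun t => (γ t).proj) ∧
        ∀ t ∈ J, γ t = translate (𝓡 (n + 1)) π (energy L γ t) (legendre (𝓡 (n + 1)) π L
            (jet (𝓡 (n + 1)) (fun s => (γ s).proj) t)) ∧ HasDerivAt (energy L γ) 0 t := by
  constructor
  · intro h
    constructor
    · intro φ hφ t ht hx i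
      refine (hφ.eulerLagrange_iff hJ hγ hL ht hx i).2 ?_
      have h1 := (hφ.jet_mem_lagrangianSet hJ hγ hL ht hx).1 (h t ht)
      refine ((hasDerivAt_momentum (hφ.differentiableAt_curveMom hJ hγ ht hx)
        (vert n (Pi.single i 1))).congr_of_eventuallyEq ?_).congr_deriv (h1.2 _)
      filter_upwards [hφ.eventually_mem hJ hγ ht hx] with s hs
      exact (((hφ.jet_mem_lagrangianSet hJ hγ hL hs.1 hs.2).1 (h s hs.1)).1 _).symm
    · intro t ht
      obtain ⟨φ, hφ, hx⟩ := hπ.exists_isAdaptedChart (γ t).proj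
      have h1 := (hφ.jet_mem_lagrangianSet hJ hγ hL ht hx).1 (h t ht)
      refine ⟨(hφ.curve_eq_translate_iff hJ hγ hL hπ.smooth ht hx _).2 ⟨h1.1, rfl⟩, ?_⟩
      exact (hφ.hasDerivAt_energy hJ hγ hL hπ.smooth ht hx h1.1).congr_deriv
        (sub_eq_zero.2 (h1.2 _))
  · rintro ⟨hEL, h⟩ t ht
    obtain ⟨φ, hφ, hx⟩ := hπ.exists_isAdaptedChart (γ t).proj
    have hm : ∀ s, s ∈ J ∧ (γ s).proj ∈ φ.source →
        ∀ b, curveMom φ γ s (vert n b) = fderiv ℝ (lag φ L) (curveJet φ γ s) (0, b) :=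
      fun s hs =>
        ((hφ.curve_eq_translate_iff hJ hγ hL hπ.smooth hs.1 hs.2 _).1 (h s hs.1).1).1
    refine (hφ.jet_mem_lagrangianSet hJ hγ hL ht hx).2 ⟨hm t ⟨ht, hx⟩, fun a => ?_⟩
    have hE := (hφ.hasDerivAt_energy hJ hγ hL hπ.smooth ht hx (hm t ⟨ht, hx⟩)).unique (h t ht).2
    refine DFunLike.congr_fun (covector_ext (u := deriv (curvePos φ γ) t)
      (l' := fderiv ℝ (lag φ L) (curveJet φ γ t) ∘L ContinuousLinearMap.inl ℝ _ _)
      (time_deriv (hφ.differentiableAt_curvePos hJ hγ ht hx)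
        (hφ.eventually_time_curvePos hJ hγ ht hx)) (sub_eq_zero.1 hE) fun i => ?_) a
    refine (hasDerivAt_momentum (hφ.differentiableAt_curveMom hJ hγ ht hx) _).unique
      (((hφ.eulerLagrange_iff hJ hγ hL ht hx i).1 (hEL φ hφ t ht hx i)).congr_of_eventuallyEq ?_)
    filter_upwards [hφ.eventually_mem hJ hγ ht hx] with s hs
    exact hm s hs _

/-- If a section is a translate, by a constant, of the Legendre transform of its projection, then
its jets lie in `S_L` if and only if its projection solves the Euler-Lagrange equations. -/
theorem forall_jet_mem_lagrangianSet_iff_of_eq_translate (hπ : IsFibration (𝓡 (n + 1)) π)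
    (hL : ContMDiffOn (𝓡 (n + 1)).tangent 𝓘(ℝ, ℝ) ∞ L (J1 (𝓡 (n + 1)) π)) (hJ : IsOpen J)
    (hγ : IsSectionOn (cotModel (𝓡 (n + 1))) (cotFibration (𝓡 (n + 1)) π) J γ) {c : ℝ}
    (hc : ∀ t ∈ J, γ t = translate (𝓡 (n + 1)) π c (legendre (𝓡 (n + 1)) π L
      (jet (𝓡 (n + 1)) (fun s => (γ s).proj) t))) :
    (∀ t ∈ J, jet (cotModel (𝓡 (n + 1))) γ t ∈ lagrangianSet (𝓡 (n + 1)) π L) ↔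
      SolvesEulerLagrange π L J (fun t => (γ t).proj) := by
  rw [forall_jet_mem_lagrangianSet_iff hπ hL hJ hγ]
  refine and_iff_left fun t ht => ?_
  have hE : ∀ s ∈ J, energy L γ s = c := by
    intro s hs
    obtain ⟨φ, hφ, hx⟩ := hπ.exists_isAdaptedChart (γ s).proj
    exact ((hφ.curve_eq_translate_iff hJ hγ hL hπ.smooth hs hx c).1 (hc s hs)).2
  refine ⟨by rw [hE t ht]; exact hc t ht, (hasDerivAt_const t c).congr_of_eventuallyEq ?_⟩
  exact Filter.eventually_of_mem (hJ.mem_nhds ht) hE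

/-- The description of the sections whose jets lie in `S_L`: on a connected domain, the energy is
a constant. -/
theorem forall_jet_mem_lagrangianSet_iff_exists (hπ : IsFibration (𝓡 (n + 1)) π)
    (hL : ContMDiffOn (𝓡 (n + 1)).tangent 𝓘(ℝ, ℝ) ∞ L (J1 (𝓡 (n + 1)) π)) (hJ : IsOpen J)
    (hJ' : IsPreconnected J)
    (hγ : IsSectionOn (cotModel (𝓡 (n + 1))) (cotFibration (𝓡 (n + 1)) π) J γ) :
    (∀ t ∈ J, jet (cotModel (𝓡 (n + 1))) γ t ∈ lagrangianSet (𝓡 (n + 1)) π L) ↔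
      SolvesEulerLagrange π L J (fun t => (γ t).proj) ∧
        ∃ c : ℝ, ∀ t ∈ J, γ t = translate (𝓡 (n + 1)) π c (legendre (𝓡 (n + 1)) π L
            (jet (𝓡 (n + 1)) (fun s => (γ s).proj) t)) := by
  constructor
  · intro h
    obtain ⟨h1, h2⟩ := (forall_jet_mem_lagrangianSet_iff hπ hL hJ hγ).1 h
    refine ⟨h1, ?_⟩
    rcases J.eq_empty_or_nonempty with rfl | ⟨t₀, ht₀⟩
    · exact ⟨0, fun t ht => ht.elim⟩
    · refine ⟨energy L γ t₀, fun t ht => ?_⟩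
      have h3 : energy L γ t₀ = energy L γ t := hJ.is_const_of_deriv_eq_zero hJ'
        (fun s hs => (h2 s hs).2.differentiableAt.differentiableWithinAt)
        (fun s hs => (h2 s hs).2.deriv) ht₀ ht
      rw [h3]
      exact (h2 t ht).1
  · rintro ⟨h1, c, hc⟩
    exact (forall_jet_mem_lagrangianSet_iff_of_eq_translate hπ hL hJ hγ hc).2 h1

lemma translate_zero_eq (α : CotangentBundle (𝓡 (n + 1)) M) :
    translate (𝓡 (n + 1)) π 0 α = α := by
  refine Bundle.TotalSpace.ext rfl (heq_of_eq (ContinuousLinearMap.ext fun X => ?_))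
  change α.2 X + 0 * mvfderiv (𝓡 (n + 1)) π α.proj X = α.2 X
  rw [zero_mul, add_zero]

theorem isSectionOn_legendre (hπ : IsFibration (𝓡 (n + 1)) π)
    (hL : ContMDiffOn (𝓡 (n + 1)).tangent 𝓘(ℝ, ℝ) ∞ L (J1 (𝓡 (n + 1)) π)) (hJ : IsOpen J)
    (hσ : IsSectionOn (𝓡 (n + 1)) π J σ) :
    IsSectionOn (cotModel (𝓡 (n + 1))) (cotFibration (𝓡 (n + 1)) π) J
      (fun t => legendre (𝓡 (n + 1)) π L (jet (𝓡 (n + 1)) σ t)) := by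
  refine ⟨fun t ht => ContMDiffAt.contMDiffWithinAt ?_, hσ.2⟩
  obtain ⟨φ, hφ, hx⟩ := hπ.exists_isAdaptedChart (σ t)
  have hev : ∀ᶠ s in 𝓝 t, s ∈ J ∧ σ s ∈ φ.source :=
    (hJ.eventually_mem ht).and ((hσ.contMDiffAt hJ ht).continuousAt.eventually
      (SmoothChart.source_mem_nhds (Χ := hφ.chart) hx))
  refine SmoothChart.contMDiffAt_of_comp_curve (Χ := hφ.chart.cotangent) hx
    (hev.mono fun s hs => hs.2) ?_
  have hy : ContDiffAt ℝ ∞ (fun s => φ (σ s)) t :=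
    SmoothChart.contDiffAt_comp (Χ := hφ.chart) hx (hσ.contMDiffAt hJ ht)
  have hj : ContDiffAt ℝ ∞ (fun s => (φ (σ s), space n (deriv (fun s => φ (σ s)) s))) t :=
    hy.prodMk ((space n).contDiff.contDiffAt.comp t (contDiffAt_deriv hy))
  have hleg : ContDiffAt ℝ ∞ (fun s => legendreInCoord (lag φ L)
      (φ (σ s), space n (deriv (fun s => φ (σ s)) s))) t :=
    ContDiffAt.comp (g := legendreInCoord (lag φ L)) t
      (contDiffAt_legendreInCoord (hφ.contDiffAt_lag hL (φ.map_source hx))) hj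
  refine (hy.prodMk hleg).congr_of_eventuallyEq (hev.mono fun s hs => Prod.ext rfl ?_)
  refine (hφ.cotMom_legendre hL hs.2 (hσ.jet_mem_J1 hπ.smooth hJ hs.1)).trans ?_
  exact congrArg (fun w => legendreInCoord (lag φ L) (φ (σ s), space n w))
    (SmoothChart.d_jet (Χ := hφ.chart) hs.2
      ((hσ.contMDiffAt hJ hs.1).mdifferentiableAt (by simp)))

/-- For sections of the cotangent bundle, membership of the jets in `S_L` is the equation
`Ã_π ∘ j¹γ = dL ∘ j¹σ`. -/
lemma jet_mem_lagrangianSet_iff (hπ : IsFibration (𝓡 (n + 1)) π) (hJ : IsOpen J)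
    (hγ : IsSectionOn (cotModel (𝓡 (n + 1))) (cotFibration (𝓡 (n + 1)) π) J γ) {t : ℝ}
    (ht : t ∈ J) :
    jet (cotModel (𝓡 (n + 1))) γ t ∈ lagrangianSet (𝓡 (n + 1)) π L ↔
      diffOn (𝓡 (n + 1)).tangent (J1 (𝓡 (n + 1)) π) L
          (jet (𝓡 (n + 1)) (fun s => (γ s).proj) t) =
        extendedTulczyjew (𝓡 (n + 1)) π (jet (cotModel (𝓡 (n + 1))) γ t) := by
  constructor
  · rintro ⟨-, v, -, h⟩
    have h1 : tangentProj (𝓡 (n + 1)) (jet (cotModel (𝓡 (n + 1))) γ t) = v :=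
      congrArg Sigma.fst h
    rw [tangentProj_jet ((hγ.contMDiffAt hJ ht).mdifferentiableAt (by simp))] at h1
    rw [h1, h]
  · exact fun h => ⟨hγ.jet_mem_J1 (contMDiff_cotFibration hπ.smooth) hJ ht, _,
      hγ.proj.jet_mem_J1 hπ.smooth hJ ht, h.symm⟩

end EulerLagrangeEquations

end TimeMechanics

end

open TimeMechanics in
theorem mainTheorem9 {n : ℕ} {M : Type*} [TopologicalSpace M]
    [ChartedSpace (EuclideanSpace ℝ (Fin (n + 1))) M] [IsManifold (𝓡 (n + 1)) ∞ M]
    (π : M → ℝ) (hπ : IsFibration (𝓡 (n + 1)) π)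
    (L : TangentBundle (𝓡 (n + 1)) M → ℝ)
    (hL : ContMDiffOn (𝓡 (n + 1)).tangent 𝓘(ℝ, ℝ) ∞ L (J1 (𝓡 (n + 1)) π)) :
    (∀ (J : Set ℝ) (σ : ℝ → M), IsOpen J → IsSectionOn (𝓡 (n + 1)) π J σ →
      IsSectionOn (cotModel (𝓡 (n + 1))) (cotFibration (𝓡 (n + 1)) π) J
          (fun t => legendre (𝓡 (n + 1)) π L (jet (𝓡 (n + 1)) σ t)) ∧
      (SolvesEulerLagrange π L J σ ↔
        ∀ t ∈ J,
          diffOn (𝓡 (n + 1)).tangent (J1 (𝓡 (n + 1)) π) L (jet (𝓡 (n + 1)) σ t) =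
            extendedTulczyjew (𝓡 (n + 1)) π
              (jet (cotModel (𝓡 (n + 1)))
                (fun s => legendre (𝓡 (n + 1)) π L (jet (𝓡 (n + 1)) σ s)) t))) ∧
    IsLagrangianSubmanifold (cotModel (𝓡 (n + 1))).tangent (J1Cot (𝓡 (n + 1)) π)
      (completeLift (cotModel (𝓡 (n + 1))) (canonicalForm (𝓡 (n + 1))))
      (lagrangianSet (𝓡 (n + 1)) π L) ∧
    (∀ φ : OpenPartialHomeomorph M (EuclideanSpace ℝ (Fin (n + 1))), IsAdaptedChart π φ →
      DefinesSubmanifoldOn (cotModel (𝓡 (n + 1))).tangent (localEquations φ L)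
        {z | z.proj.proj ∈ φ.source} (lagrangianSet (𝓡 (n + 1)) π L)) ∧
    (∀ (J : Set ℝ) (γ : ℝ → CotangentBundle (𝓡 (n + 1)) M), IsOpen J → IsPreconnected J →
      IsSectionOn (cotModel (𝓡 (n + 1))) (cotFibration (𝓡 (n + 1)) π) J γ →
      ((∀ t ∈ J, jet (cotModel (𝓡 (n + 1))) γ t ∈ lagrangianSet (𝓡 (n + 1)) π L) ↔
        SolvesEulerLagrange π L J (fun t => (γ t).proj) ∧
        ∃ c : ℝ, ∀ t ∈ J,
          γ t = translate (𝓡 (n + 1)) π c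
            (legendre (𝓡 (n + 1)) π L (jet (𝓡 (n + 1)) (fun s => (γ s).proj) t)))) := by
  refine ⟨fun J σ hJ hσ => ?_, isLagrangianSubmanifold_lagrangianSet hπ hL,
    fun φ hφ => hφ.definesSubmanifoldOn_lagrangianSet hL,
    fun J γ hJ hJ' hγ => forall_jet_mem_lagrangianSet_iff_exists hπ hL hJ hJ' hγ⟩
  have hγ := isSectionOn_legendre hπ hL hJ hσ
  refine ⟨hγ, Iff.trans ?_ (forall₂_congr fun t ht => jet_mem_lagrangianSet_iff hπ hJ hγ ht)⟩
  exact (forall_jet_mem_lagrangianSet_iff_of_eq_translate (c := 0) hπ hL hJ hγ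
    fun t _ => (translate_zero_eq _).symm).symm
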